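/- \textbf{Setting.} Let $\rho>0$ (density), $\gamma>0$ (power-law exponent), and let $\underline c=(c_{pq})$, $\underline v=(v_{pq})$ be real $6\times 6$ matrices, both of the form $$\begin{pmatrix}\mu_{11}&-\mu_{66}&-\mu_{55}&0&0&0\\-\mu_{66}&\mu_{22}&-\mu_{44}&0&0&0\\-\mu_{55}&-\mu_{44}&\mu_{33}&0&0&0\\0&0&0&\mu_{44}&0&0\\0&0&0&0&\mu_{55}&0\\0&0&0&0&0&\mu_{66}\end{pmatrix},$$ which are the Voigt representations of a stiffness tensor $C$ and a viscosity tensor $V$ on $\mathbb R^3$, i.e. $C_{ijkl}=c_{p(i,j)p(k,l)}$ with $p(i,i)=i$, $p(2,3)=4$, $p(1,3)=5$, $p(1,2)=6$, $p(i,j)=p(j,i)$, and likewise for $V$. Assume $C$ and $V$ are positive definite on symmetric $3\times3$ matrices. Let $\Gamma^c_{ij}(n)=\sum_{k,l}C_{kilj}n_kn_l$ and $\Gamma^v_{ij}(n)=\sum_{k,l}V_{kilj}n_kn_l$ be the Christoffel tensors, put $$L_1^\mu(n)=\mu_{11}n_1^2+\mu_{66}n_2^2+\mu_{55}n_3^2,\quad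 L_2^\mu(n)=\mu_{66}n_1^2+\mu_{22}n_2^2+\mu_{44}n_3^2,\quad L_3^\mu(n)=\mu_{55}n_1^2+\mu_{44}n_2^2+\mu_{33}n_3^2$$ for $\mu=c,v$, and assume $L_i^v=\beta_iL_i^c$ with real $\beta_i$, $i=1,2,3$. Let $B=\mathrm{diag}(\beta_1,\beta_2,\beta_3)$. The loss operator $\mathcal A$ is convolution in $t$ with the kernel $-(-1)^{\gamma/2}\delta^{(\gamma-1)}$ if $\gamma$ is an even integer, $\frac2\pi(\gamma-1)!(-1)^{(\gamma+1)/2}H(t)t^{-\gamma}$ if $\gamma$ is an odd integer, and $-\frac2\pi\Gamma(\gamma)\sin(\gamma\pi/2)H(t)|t|^{-\gamma}$ otherwise, where $H$ is the Heaviside function and $H(t)t^{-\gamma}$ is understood as Hadamard's finite part. The action of $\mathcal A$ on a tempered distribution $T$ on $\mathbb R^3\times\mathbb R$ is $\langle\mathcal A[T],\psi\rangle=\langle T,\mathcal A^{\!\top}\psi\rangle$, for the Schwartz functions $\psi$ such that $\mathcal A^{\!\top}\psi$ is a Schwartz function. The temporal Fourier transform is $\hat f(\omega)=\int f(t)e^{i\omega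 t}\,dt$. The viscoelastic Green function is a matrix $\mathbf G$ of tempered distributions on $\mathbb R^3\times\mathbb R$ with $$\rho\,\partial_t^2\mathbf G-\Gamma^c[\nabla]\mathbf G-\Gamma^v[\nabla]\mathcal A[\mathbf G]=\delta(t)\delta(x)I. \tag{1}$$ Applying $1-B\mathcal A$ to (1) and dropping the second-order term $-B^2\mathcal A^2\,\Gamma^c[\nabla]\mathbf G$ gives the approximate equation $$\Gamma^c[\nabla]\mathbf G+\rho B\,\mathcal A[\partial_t^2\mathbf G]-\rho\,\partial_t^2\mathbf G=-\delta(x)\bigl(\delta(t)I-B\,\mathcal A[\delta(t)]\bigr). \tag{2}$$ \textbf{Theorem.} (a) For all $n\in\mathbb R^3$, the coordinate vectors $e_i$ are eigenvectors of $\Gamma^c(n)$ and of $\Gamma^v(n)$, with eigenvalues $L_i^c(n)$ and $L_i^v(n)$. (b) Equation (2) differs from $1-B\mathcal A$ applied to (1) exactly by the dropped term: for every matrix $\mathbf G$ of tempered distributions, $(1-B\mathcal A)\bigl(\Gamma^c[\nabla]\mathbf G+\Gamma^v[\nabla]\mathcal A[\mathbf G]-\rho\,\partial_t^2\mathbf G+\delta(t)\delta(x)I\bigr)$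 equals the left side minus the right side of (2), minus $B^2\mathcal A^2\Gamma^c[\nabla]\mathbf G$ (tested against $\psi$ with $\mathcal A^{\!\top}\psi$ and $(\mathcal A^{\!\top})^2\psi$ Schwartz functions). (c) The Fourier transform of the kernel of $\mathcal A$ is a function $\hat{\mathcal A}(\omega)$, continuous for $\omega\ne0$. Let $c_p=\sqrt{c_{pp}/\rho}$, let $(b_{ij})_j$ be $(c_1,c_6,c_5)$, $(c_6,c_2,c_4)$, $(c_5,c_4,c_3)$ for $i=1,2,3$, and $$\tau_i(x)=\sqrt{\sum_{j}x_j^2/b_{ij}^2},\qquad K_i(\omega)=\sqrt{\omega^2\bigl(1-\beta_i\hat{\mathcal A}(\omega)\bigr)}\ \text{ with }\ \operatorname{Im}K_i\ge0,$$ $$\Phi_i(x,\omega)=\bigl(1-\beta_i\hat{\mathcal A}(\omega)\bigr)\frac{e^{\sqrt{-1}\,K_i(\omega)\tau_i(x)}}{4\pi\rho\,b_{i1}b_{i2}b_{i3}\,\tau_i(x)} .$$ (d) For every $\omega\neq0$ and every $i$, $\Phi_i(\cdot,\omega)$ defines a tempered distribution on $\mathbb R^3$, and it is the unique tempered solution of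 the anisotropic Helmholtz equation $$L_i^c(\nabla)\Phi_i+\rho\,\omega^2\bigl(1-\beta_i\hat{\mathcal A}(\omega)\bigr)\Phi_i=-\bigl(1-\beta_i\hat{\mathcal A}(\omega)\bigr)\delta .$$ (e) The function $$\hat{\mathbf G}(x,\omega)=\sum_{i=1}^3\Phi_i(x,\omega)\,e_i\otimes e_i=\frac1{4\pi\rho}\sum_{i=1}^3\left[\frac{c_{i+3}\bigl(1-\beta_i\hat{\mathcal A}(\omega)\bigr)}{c_i\,c_4c_5c_6\,\tau_i(x)}\,e^{\sqrt{-1}\,K_i(\omega)\tau_i(x)}\right]e_i\otimes e_i$$ is the temporal Fourier transform of a tempered solution $\mathbf G$ of (2), and the temporal Fourier transform of every tempered solution of (2) coincides with $\hat{\mathbf G}$ on $\{\omega\neq0\}$. -/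

import Mathlib

open scoped SchwartzMap LineDeriv

noncomputable section

namespace Viscoelastic

/-- Points of physical space. -/
abbrev Space := EuclideanSpace ℝ (Fin 3)

/-- Space-time, with points written as pairs `(x, t)`. -/
abbrev SpaceTime := Space × ℝ

/-- The Cartesian basis vector `e k` of physical space. -/
def basisVec (k : Fin 3) : Space := EuclideanSpace.single k 1

/-! ### Elasticity tensors (indices start at `0`) -/

/-- Tensors of order four on `ℝ³`. -/
abbrev Tensor4 := Fin 3 → Fin 3 → Fin 3 → Fin 3 → ℝ

/-- Voigt numbering of index pairs: `11, 22, 33, 23, 13, 12` are numbered `1, …, 6` (here from `0`). -/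
def voigtIndex : Matrix (Fin 3) (Fin 3) (Fin 6) :=
  !![0, 5, 4;
     5, 1, 3;
     4, 3, 2]

/-- The tensor of order four with a given Voigt representation. -/
def tensorOfVoigt (μ : Matrix (Fin 6) (Fin 6) ℝ) : Tensor4 :=
  fun i j k l => μ (voigtIndex i j) (voigtIndex k l)

/-- Positive definiteness: `(C : ξ) : ξ ≥ δ |ξ|²` for all symmetric `ξ`, for some `δ > 0`. -/
def IsPositiveDefinite (C : Tensor4) : Prop :=
  ∃ δ : ℝ, 0 < δ ∧ ∀ ξ : Matrix (Fin 3) (Fin 3) ℝ, ξ.IsSymm →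
    δ * ∑ i, ∑ j, ξ i j ^ 2 ≤ ∑ i, ∑ j, ∑ k, ∑ l, C i j k l * ξ k l * ξ i j

/-- The special orthorhombic structure of the first medium, for a Voigt matrix. -/
def IsMediumI (μ : Matrix (Fin 6) (Fin 6) ℝ) : Prop :=
  μ = !![ μ 0 0, -μ 5 5, -μ 4 4,     0,     0,     0;
         -μ 5 5,  μ 1 1, -μ 3 3,     0,     0,     0;
         -μ 4 4, -μ 3 3,  μ 2 2,     0,     0,     0;
              0,      0,      0, μ 3 3,     0,     0;
              0,      0,      0,     0, μ 4 4,     0;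
              0,      0,      0,     0,     0, μ 5 5]

/-- The Christoffel tensor `Γ i j (n) = ∑ k l, C k i l j * n k * n l`. -/
def christoffel (C : Tensor4) (n : Fin 3 → ℝ) : Matrix (Fin 3) (Fin 3) ℝ :=
  Matrix.of fun i j => ∑ k, ∑ l, C k i l j * n k * n l

/-- Row `i` holds the coefficients of the quadratic form `L i`. -/
def eigenCoeff (μ : Matrix (Fin 6) (Fin 6) ℝ) : Matrix (Fin 3) (Fin 3) ℝ :=
  !![μ 0 0, μ 5 5, μ 4 4;
     μ 5 5, μ 1 1, μ 3 3;
     μ 4 4, μ 3 3, μ 2 2]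

/-- The quadratic form `L i (n)`. -/
def eigenForm (μ : Matrix (Fin 6) (Fin 6) ℝ) (i : Fin 3) (n : Fin 3 → ℝ) : ℝ :=
  ∑ j, eigenCoeff μ i j * n j ^ 2

/-! ### The loss operator -/

/-- Hadamard finite part of `∫ t in (0, ∞), t ^ (-γ) * φ t`, for `γ > 0`: the action on `φ` of the
distribution `H(t) / t ^ γ`. For `γ < 1` it is the ordinary integral. -/
def finitePart (γ : ℝ) (φ : ℝ → ℂ) : ℂ :=
  (∫ t in Set.Ioc (0 : ℝ) 1, ((t ^ (-γ) : ℝ) : ℂ) *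
      (φ t - ∑ k ∈ Finset.range (⌊γ⌋₊ + 1),
        iteratedDeriv k φ 0 / (k.factorial : ℂ) * (t : ℂ) ^ k)) +
    (∫ t in Set.Ioi (1 : ℝ), ((t ^ (-γ) : ℝ) : ℂ) * φ t) +
    ∑ k ∈ Finset.range (⌊γ⌋₊ + 1),
      if (k : ℝ) + 1 = γ then 0
      else iteratedDeriv k φ 0 / (k.factorial : ℂ) / (((k : ℝ) + 1 - γ : ℝ) : ℂ)

open Classical in
/-- The action on `φ` of the convolution kernel of the power-law loss operator `𝒜` of exponent `γ`.
The kernel is `-(-1)^(γ/2) δ^(γ-1)` for an even integer `γ`,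
`(2/π) (γ-1)! (-1)^((γ+1)/2) H(t)/t^γ` for an odd integer `γ`, and
`-(2/π) Γ(γ) sin(γπ/2) H(t)/|t|^γ` for a non-integer `γ`. -/
def lossKernel (γ : ℝ) (φ : ℝ → ℂ) : ℂ :=
  if γ = (⌊γ⌋₊ : ℝ) then
    if Even ⌊γ⌋₊ then
      -(-1) ^ (⌊γ⌋₊ / 2) * ((-1) ^ (⌊γ⌋₊ - 1) * iteratedDeriv (⌊γ⌋₊ - 1) φ 0)
    else
      2 / (Real.pi : ℂ) * ((⌊γ⌋₊ - 1).factorial : ℂ) * (-1) ^ ((⌊γ⌋₊ + 1) / 2) * finitePart γ φ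
  else
    -(2 / (Real.pi : ℂ)) * ((Real.Gamma γ * Real.sin (γ * Real.pi / 2) : ℝ) : ℂ) * finitePart γ φ

/-- `a` is the Fourier transform `Â(ω) = ∫ k(t) exp(iωt) dt` of the convolution kernel `k` of the
loss operator, as a tempered distribution; `a` is taken continuous away from zero frequency. -/
def IsLossSymbol (γ : ℝ) (a : ℝ → ℂ) : Prop :=
  ContinuousOn a {0}ᶜ ∧
  ∀ φ : 𝓢(ℝ, ℂ), MeasureTheory.Integrable (fun ω => a ω * φ ω) ∧
    lossKernel γ (fun t => ∫ ω, φ ω * Complex.exp (Complex.I * ω * t)) = ∫ ω, a ω * φ ω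

/-- `χ` is the transpose of the loss operator (acting in `t`) applied to the test function `ψ`. For a
distribution `T`, the value of `𝒜[T]` on `ψ` is the value of `T` on `χ`. -/
def IsTransposedLoss (γ : ℝ) (ψ χ : 𝓢(SpaceTime, ℂ)) : Prop :=
  ∀ (x : Space) (t : ℝ), χ (x, t) = lossKernel γ (fun s => ψ (x, t + s))

/-! ### The equations -/

/-- Matrices of tempered distributions on space-time. -/
abbrev MatrixDistribution := Fin 3 → Fin 3 → 𝓢'(SpaceTime, ℂ)

/-- The entry `(i, m)` of `Γ[∇] G`. -/
def christoffelOp (C : Tensor4) (G : MatrixDistribution) (i m : Fin 3) : 𝓢'(SpaceTime, ℂ) :=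
  ∑ j, ∑ k, ∑ l, ((C k i l j : ℝ) : ℂ) •
    (∂_{((basisVec k, 0) : SpaceTime)} (∂_{((basisVec l, 0) : SpaceTime)} (G j m)))

/-- The second time derivative. -/
def timeDeriv2 (T : 𝓢'(SpaceTime, ℂ)) : 𝓢'(SpaceTime, ℂ) :=
  ∂_{((0, 1) : SpaceTime)} (∂_{((0, 1) : SpaceTime)} T)

/-- The entry `(i, m)` of `Γᶜ[∇] G + Γᵛ[∇] 𝒜[G] - ρ ∂²G/∂t² + δ(t) δ(x) I`, tested against `ψ`, where
`χ` is the transposed loss operator applied to `ψ`. It vanishes when `G` is the response of the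
viscoelastic medium to the point forces `F = δ(t) δ(x) I`. -/
def viscoelasticResidual (C V : Tensor4) (ρ : ℝ) (G : MatrixDistribution) (i m : Fin 3)
    (ψ χ : 𝓢(SpaceTime, ℂ)) : ℂ :=
  christoffelOp C G i m ψ + christoffelOp V G i m χ - (ρ : ℂ) * timeDeriv2 (G i m) ψ
    + (if i = m then 1 else 0) * ψ 0

/-- The entry `(i, m)` of
`Γᶜ[∇] G + ρ B 𝒜[∂²G/∂t²] - ρ ∂²G/∂t² + δ(x) (δ(t) I - B 𝒜[δ(t)])` with `B = diag(β)`, tested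
against `ψ`, where `χ` is the transposed loss operator applied to `ψ`. -/
def approxResidual (C : Tensor4) (β : Fin 3 → ℝ) (ρ : ℝ) (G : MatrixDistribution) (i m : Fin 3)
    (ψ χ : 𝓢(SpaceTime, ℂ)) : ℂ :=
  christoffelOp C G i m ψ + (ρ : ℂ) * (β i : ℂ) * timeDeriv2 (G i m) χ
    - (ρ : ℂ) * timeDeriv2 (G i m) ψ
    + (if i = m then 1 else 0) * (ψ 0 - (β i : ℂ) * χ 0)

/-- `G` is a Green function of the viscoelastic medium with the terms of second order in `β`
dropped. -/
def IsApproxGreen (C : Tensor4) (β : Fin 3 → ℝ) (ρ γ : ℝ) (G : MatrixDistribution) : Prop :=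
  ∀ ψ χ : 𝓢(SpaceTime, ℂ), IsTransposedLoss γ ψ χ →
    ∀ i m, approxResidual C β ρ G i m ψ χ = 0

/-- The anisotropic Helmholtz equation
`L i (∇) S + ρ ω² (1 - β Â(ω)) S = -(1 - β Â(ω)) δ` on `ℝ³`. -/
def IsHelmholtzSolution (μ : Matrix (Fin 6) (Fin 6) ℝ) (ρ : ℝ) (β : Fin 3 → ℝ) (a : ℝ → ℂ)
    (i : Fin 3) (ω : ℝ) (S : 𝓢'(Space, ℂ)) : Prop :=
  (∑ j, ((eigenCoeff μ i j : ℝ) : ℂ) • (∂_{basisVec j} (∂_{basisVec j} S)))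
      + ((ρ : ℂ) * (ω : ℂ) ^ 2 * (1 - (β i : ℂ) * a ω)) • S
    = (-(1 - (β i : ℂ) * a ω)) • TemperedDistribution.delta (0 : Space)

/-! ### Fourier transform in time -/

/-- `Ψ(x, t) = ∫ ψ(x, ω) exp(iωt) dω`. -/
def IsTimeFourierOf (ψ Ψ : 𝓢(SpaceTime, ℂ)) : Prop :=
  ∀ (x : Space) (t : ℝ), Ψ (x, t) = ∫ ω : ℝ, ψ (x, ω) * Complex.exp (Complex.I * ω * t)

/-- The Fourier transform of `T` with respect to time, `∫ T(x, t) exp(iωt) dt`, is the function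
`g(x, ω)`. -/
def HasTimeFourier (T : 𝓢'(SpaceTime, ℂ)) (g : Space → ℝ → ℂ) : Prop :=
  ∀ ψ Ψ : 𝓢(SpaceTime, ℂ), IsTimeFourierOf ψ Ψ →
    MeasureTheory.Integrable (fun p : SpaceTime => ψ p * g p.1 p.2) ∧
      T Ψ = ∫ p : SpaceTime, ψ p * g p.1 p.2

/-- The Fourier transform of `T` with respect to time coincides with the function `g(x, ω)` on the
open set `ω ≠ 0`. -/
def HasTimeFourierOffZero (T : 𝓢'(SpaceTime, ℂ)) (g : Space → ℝ → ℂ) : Prop :=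
  ∀ ψ Ψ : 𝓢(SpaceTime, ℂ), IsTimeFourierOf ψ Ψ → HasCompactSupport ψ →
    (∀ p ∈ tsupport ψ, p.2 ≠ 0) →
    MeasureTheory.Integrable (fun p : SpaceTime => ψ p * g p.1 p.2) ∧
      T Ψ = ∫ p : SpaceTime, ψ p * g p.1 p.2

/-! ### The closed form -/

/-- `c p = √(c p p / ρ)`. -/
def speed (c : Matrix (Fin 6) (Fin 6) ℝ) (ρ : ℝ) (p : Fin 6) : ℝ := √(c p p / ρ)

/-- Row `i` holds the density-normalized constants `b 1, b 2, b 3` of the mode `i`. -/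
def modeSpeeds (c : Matrix (Fin 6) (Fin 6) ℝ) (ρ : ℝ) : Matrix (Fin 3) (Fin 3) ℝ :=
  !![speed c ρ 0, speed c ρ 5, speed c ρ 4;
     speed c ρ 5, speed c ρ 1, speed c ρ 3;
     speed c ρ 4, speed c ρ 3, speed c ρ 2]

/-- The ellipsoidal travel time `τ i (x)`. -/
def travelTime (c : Matrix (Fin 6) (Fin 6) ℝ) (ρ : ℝ) (i : Fin 3) (x : Space) : ℝ :=
  √(∑ j, x j ^ 2 / modeSpeeds c ρ i j ^ 2)

/-- The complex square root with nonnegative imaginary part. -/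
def upperSqrt (z : ℂ) : ℂ :=
  if 0 ≤ (z ^ (1 / 2 : ℂ)).im then z ^ (1 / 2 : ℂ) else -z ^ (1 / 2 : ℂ)

/-- The complex wave number `K i (ω) = √(ω² (1 - β i Â(ω)))`. -/
def waveNumber (β : Fin 3 → ℝ) (a : ℝ → ℂ) (i : Fin 3) (ω : ℝ) : ℂ :=
  upperSqrt ((ω : ℂ) ^ 2 * (1 - (β i : ℂ) * a ω))

/-- `Φ i (x, ω) = (1 - β i Â(ω)) exp(√-1 K i (ω) τ i (x)) / (4 π ρ b τ i (x))`, where `b` is the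
product of the three constants of the mode `i`. -/
def phi (c : Matrix (Fin 6) (Fin 6) ℝ) (ρ : ℝ) (β : Fin 3 → ℝ) (a : ℝ → ℂ) (i : Fin 3)
    (x : Space) (ω : ℝ) : ℂ :=
  (1 - (β i : ℂ) * a ω) *
    Complex.exp (Complex.I * waveNumber β a i ω * (travelTime c ρ i x : ℂ)) /
      (4 * (Real.pi : ℂ) * (ρ : ℂ) * ((∏ j, modeSpeeds c ρ i j : ℝ) : ℂ) * (travelTime c ρ i x : ℂ))

/-- The dyad `e i ⊗ e i`. -/
def dyad (i : Fin 3) : Matrix (Fin 3) (Fin 3) ℂ := Matrix.vecMulVec (Pi.single i 1) (Pi.single i 1)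

/-- `Ĝ(x, ω) = ∑ i, Φ i (x, ω) e i ⊗ e i`. -/
def greenHat (c : Matrix (Fin 6) (Fin 6) ℝ) (ρ : ℝ) (β : Fin 3 → ℝ) (a : ℝ → ℂ)
    (x : Space) (ω : ℝ) : Matrix (Fin 3) (Fin 3) ℂ :=
  ∑ i, phi c ρ β a i x ω • dyad i

end Viscoelastic

end

noncomputable section

namespace Viscoelastic

open MeasureTheory Set Filter Topology FourierTransform

/-! The sign pattern of the medium makes the mixed terms of both Christoffel tensors cancel in
pairs, so they are diagonal with entries `L i`, and `L i ^ v = β i L i ^ c` becomes `Γᵛ[∇] = B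
Γᶜ[∇]` (`IsMediumI.sum_smul_eq`, `christoffelOp_apply`). Part (b) is then plain algebra, and the
approximate equation decouples into scalar equations, one for each row `i`.

The symbol `Â` is computed explicitly. For `0 < γ < 1`, damping by `exp(-εt)` and the Laplace
transform of a power give `Γ(1-γ) (i/ω)^(1-γ)` for `H(t)/t^γ`; the case `γ = 1` is the constant term
left after removing a pole as `γ → 1`, namely `log(i/ω) + Γ'(1)`; integration by parts raises `γ` by
one and multiplies by `iω`, up to a polynomial for integer exponents. The decisive outcome
(`exists_isRegularLossSymbol`) is that `Â` is smooth and not real at every `ω ≠ 0`, and polynomially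
integrable. Positive definiteness of `V` forces `β i ≠ 0`, so the Helmholtz coefficient `κ = ρω²(1 -
β i Â)` lies off the real axis.

Scaling the coordinates turns `Φ i` into a multiple of `exp(iK|x|)/|x|`, whose fundamental-solution
property follows by replacing `|x|` with `√(|x|² + ε²)` and letting `ε → 0`
(`integral_helmholtz_mul`, `integral_modeOp_mul_phi`). Uniqueness in (d) is duality: the Fourier
multiplier `κ - ∑ A j ξ j²` stays away from zero, so the operator maps Schwartz functions onto
Schwartz functions (`exists_helmholtz_solution`).

For (e), the Fourier transform in time is an automorphism of the Schwartz space under which the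
transposed loss operator becomes multiplication by `Â` (`IsLossSymbol.eq_mul_of_isTransposedLoss`).
Integrating the fixed-frequency identity over `ω` shows that `Ĝ` comes from a solution. Conversely,
a test function with compact support off `ω = 0` is, frequency by frequency, the Helmholtz operator
applied to some Schwartz function (`exists_modeOp_fstSlice_eq`), so the equation determines every
solution on it. -/

/-! ### Laplace transform of powers -/

lemma integrableOn_rpow_mul_exp_neg {a b : ℝ} (ha : -1 < a) (hb : 0 < b) :
    IntegrableOn (fun t : ℝ => t ^ a * Real.exp (-b * t)) (Ioi 0) := by
  simpa using integrableOn_rpow_mul_exp_neg_mul_rpow (p := 1) ha zero_lt_one hb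

lemma norm_cexp_neg_mul_ofReal (z : ℂ) (t : ℝ) :
    ‖Complex.exp (-z * t)‖ = Real.exp (-z.re * t) := by
  simp [Complex.norm_exp]

lemma integrableOn_rpow_mul_cexp_neg {a : ℝ} (ha : -1 < a) {z : ℂ} (hz : 0 < z.re) :
    IntegrableOn (fun t : ℝ => ((t ^ a : ℝ) : ℂ) * Complex.exp (-z * t)) (Ioi 0) := by
  refine (integrableOn_rpow_mul_exp_neg ha hz).mono' ?_ ?_
  · refine Measurable.aestronglyMeasurable ?_
    fun_prop
  · filter_upwards [ae_restrict_mem measurableSet_Ioi] with t ht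
    rw [norm_mul, norm_cexp_neg_mul_ofReal, Complex.norm_real,
      Real.norm_of_nonneg (Real.rpow_nonneg (le_of_lt ht) _)]

/-- The Laplace transform of a power, on the right half-plane. -/
theorem integral_rpow_mul_cexp_neg {a : ℝ} (ha : 0 < a) {z : ℂ} (hz : 0 < z.re) :
    ∫ t in Ioi (0 : ℝ), ((t ^ (a - 1) : ℝ) : ℂ) * Complex.exp (-z * t)
      = (1 / z) ^ (a : ℂ) * (Real.Gamma a : ℂ) := by
  have hU : IsOpen {z : ℂ | 0 < z.re} := isOpen_lt continuous_const Complex.continuous_re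
  set F : ℂ → ℂ := fun z => ∫ t in Ioi (0 : ℝ), ((t ^ (a - 1) : ℝ) : ℂ) * Complex.exp (-z * t)
    with hF
  have hFd : DifferentiableOn ℂ F {z : ℂ | 0 < z.re} := by
    intro w (hw : 0 < w.re)
    have hw2 : 0 < w.re / 2 := by linarith
    -- On the ball of radius `Re w / 2` about `w` the real part stays above `Re w / 2`, which
    -- supplies the dominating function.
    have := (hasDerivAt_integral_of_dominated_loc_of_deriv_le
      (μ := volume.restrict (Ioi (0 : ℝ))) (𝕜 := ℂ)
      (F := fun (z : ℂ) (t : ℝ) => ((t ^ (a - 1) : ℝ) : ℂ) * Complex.exp (-z * t))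
      (F' := fun (z : ℂ) (t : ℝ) => ((t ^ (a - 1) : ℝ) : ℂ) * (Complex.exp (-z * t) * (-t)))
      (x₀ := w) (s := Metric.ball w (w.re / 2))
      (bound := fun t => t ^ a * Real.exp (-(w.re / 2) * t))
      (Metric.ball_mem_nhds w hw2) ?_ ?_ ?_ ?_ ?_ ?_).2
    · exact this.differentiableAt.differentiableWithinAt
    · refine Eventually.of_forall fun z => Measurable.aestronglyMeasurable ?_
      fun_prop
    · exact integrableOn_rpow_mul_cexp_neg (by linarith) hw
    · refine Measurable.aestronglyMeasurable ?_
      fun_prop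
    · filter_upwards [ae_restrict_mem measurableSet_Ioi] with t ht z hz
      have ht : 0 < t := ht
      have hre : w.re / 2 ≤ z.re := by
        have h1 := (Complex.abs_re_le_norm (z - w)).trans (mem_ball_iff_norm.1 hz).le
        rw [Complex.sub_re, abs_le] at h1
        linarith
      rw [norm_mul, norm_mul, norm_cexp_neg_mul_ofReal, Complex.norm_real, norm_neg,
        Complex.norm_real, Real.norm_of_nonneg (Real.rpow_nonneg ht.le _),
        Real.norm_of_nonneg ht.le]
      have h2 : t ^ a = t ^ (a - 1) * t := by
        rw [← Real.rpow_add_one ht.ne']; simp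
      rw [h2]
      have h3 : Real.exp (-z.re * t) ≤ Real.exp (-(w.re / 2) * t) :=
        Real.exp_le_exp.2 (by nlinarith)
      have h4 := Real.rpow_nonneg ht.le (a - 1)
      nlinarith [mul_le_mul_of_nonneg_left h3 (mul_nonneg h4 ht.le)]
    · exact integrableOn_rpow_mul_exp_neg (by linarith) hw2
    · refine Eventually.of_forall fun t z _ => ?_
      refine HasDerivAt.const_mul _ ?_
      have h1 : HasDerivAt (fun z : ℂ => -z * t) (-(t : ℂ)) z := by
        simpa using ((hasDerivAt_id z).neg.mul_const (t : ℂ))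
      exact h1.cexp
  have hGd : DifferentiableOn ℂ (fun z : ℂ => (1 / z) ^ (a : ℂ) * (Real.Gamma a : ℂ))
      {z : ℂ | 0 < z.re} := by
    intro w (hw : 0 < w.re)
    have hw0 : w ≠ 0 := fun h => by simp [h] at hw
    refine DifferentiableAt.differentiableWithinAt ?_
    refine DifferentiableAt.mul_const (DifferentiableAt.cpow_const ?_ ?_) _
    · exact (differentiableAt_const _).div differentiableAt_id hw0
    · left
      rw [one_div, Complex.inv_re]
      exact div_pos hw (Complex.normSq_pos.2 hw0)
  -- Identity theorem: both sides are holomorphic on the half-plane, and they agree at the real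
  -- points `z > 1`, which accumulate at `1`.
  have hfreq : ∃ᶠ z in 𝓝[≠] (1 : ℂ), F z = (1 / z) ^ (a : ℂ) * (Real.Gamma a : ℂ) := by
    have htend : Tendsto (fun x : ℝ => (x : ℂ)) (𝓝[>] 1) (𝓝[≠] (1 : ℂ)) := by
      refine tendsto_nhdsWithin_iff.2 ⟨?_, ?_⟩
      · simpa using (Complex.continuous_ofReal.tendsto 1).mono_left nhdsWithin_le_nhds
      · filter_upwards [self_mem_nhdsWithin] with x hx
        have : x ≠ 1 := ne_of_gt hx
        simpa using this
    refine htend.frequently (Eventually.frequently ?_)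
    filter_upwards [self_mem_nhdsWithin] with x hx
    have hx0 : 0 < x := lt_trans zero_lt_one hx
    have h := Complex.integral_cpow_mul_exp_neg_mul_Ioi (a := (a : ℂ)) (r := x) (by simpa) hx0
    rw [Complex.Gamma_ofReal] at h
    rw [← h, hF]
    refine setIntegral_congr_fun measurableSet_Ioi fun t ht => ?_
    have ht : 0 < t := ht
    rw [Complex.ofReal_cpow ht.le]
    push_cast
    ring_nf
  have hpre : IsPreconnected {z : ℂ | 0 < z.re} :=
    (convex_halfSpace_re_gt 0).isPreconnected
  exact (hFd.analyticOnNhd hU).eqOn_of_preconnected_of_frequently_eq (hGd.analyticOnNhd hU) hpre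
    (by simp : (1 : ℂ) ∈ {z : ℂ | 0 < z.re}) hfreq hz

/-! ### Polynomial integrability, Taylor remainders and the recursion for finite parts -/

/-- `h` is absolutely integrable against some inverse power of `1 + ‖x‖`. -/
def PolyIntegrable {E : Type*} [NormedAddCommGroup E] [MeasureSpace E] (h : E → ℂ) : Prop :=
  ∃ N : ℕ, Integrable fun x => (((1 + ‖x‖) ^ N)⁻¹ : ℝ) * h x

/-- The Taylor polynomial of degree `n` at `0`. -/
def taylorPoly (f : ℝ → ℂ) (n : ℕ) (t : ℝ) : ℂ :=
  ∑ k ∈ Finset.range (n + 1), iteratedDeriv k f 0 / (k.factorial : ℂ) * (t : ℂ) ^ k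

lemma continuous_taylorPoly (f : ℝ → ℂ) (n : ℕ) : Continuous (taylorPoly f n) := by
  unfold taylorPoly
  fun_prop

lemma hasDerivAt_taylorPoly_succ (f : ℝ → ℂ) (n : ℕ) (t : ℝ) :
    HasDerivAt (taylorPoly f (n + 1)) (taylorPoly (deriv f) n t) t := by
  have h1 : HasDerivAt (taylorPoly f (n + 1))
      (∑ k ∈ Finset.range (n + 1 + 1), iteratedDeriv k f 0 / (k.factorial : ℂ) *
        (k * (t : ℂ) ^ (k - 1))) t := by
    unfold taylorPoly
    refine HasDerivAt.fun_sum fun k _ => HasDerivAt.const_mul _ ?_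
    simpa using (Complex.ofRealCLM.hasDerivAt (x := t)).fun_pow k
  refine h1.congr_deriv ?_
  rw [Finset.sum_range_succ', taylorPoly]
  simp only [Nat.cast_zero, zero_mul, mul_zero, add_zero]
  refine Finset.sum_congr rfl fun k _ => ?_
  rw [iteratedDeriv_succ', Nat.factorial_succ]
  have : ((k : ℂ) + 1) ≠ 0 := by exact_mod_cast k.succ_ne_zero
  have : (k.factorial : ℂ) ≠ 0 := by exact_mod_cast k.factorial_ne_zero
  push_cast
  field_simp

lemma exists_norm_sub_taylorPoly_le (f : 𝓢(ℝ, ℂ)) (n : ℕ) :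
    ∃ C, 0 ≤ C ∧ ∀ t ∈ Icc (0 : ℝ) 1, ‖f t - taylorPoly f n t‖ ≤ C * t ^ (n + 1) := by
  have hf : ContDiff ℝ (n + 1) f := by exact_mod_cast f.smooth (n + 1)
  obtain ⟨C, hC⟩ := exists_taylor_mean_remainder_bound (a := (0 : ℝ)) (b := 1) (n := n) zero_le_one
    hf.contDiffOn
  refine ⟨|C|, abs_nonneg _, fun t ht => ?_⟩
  have h := hC t ht
  have h2 : taylorWithinEval f n (Icc 0 1) 0 t = taylorPoly f n t := by
    rw [taylor_within_apply, taylorPoly]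
    refine Finset.sum_congr rfl fun k _ => ?_
    rw [iteratedDerivWithin_eq_iteratedDeriv (uniqueDiffOn_Icc zero_lt_one)
      (f.contDiffAt k) (by simp)]
    rw [Complex.real_smul]
    push_cast
    simp only [sub_zero]
    ring
  rw [h2, sub_zero] at h
  exact h.trans (mul_le_mul_of_nonneg_right (le_abs_self _) (pow_nonneg ht.1 _))

/-- Vanishing to order `n ≥ α` at the origin compensates the singularity `t ^ (-α)`. -/
lemma norm_rpow_neg_mul_le {h : ℝ → ℂ} {C α : ℝ} {n : ℕ} (hC : 0 ≤ C) (hn : α ≤ n)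
    {t : ℝ} (ht : t ∈ Ioc (0 : ℝ) 1) (hb : ‖h t‖ ≤ C * t ^ n) :
    ‖((t ^ (-α) : ℝ) : ℂ) * h t‖ ≤ C := by
  rw [norm_mul, Complex.norm_real, Real.norm_of_nonneg (Real.rpow_nonneg ht.1.le _)]
  calc t ^ (-α) * ‖h t‖ ≤ t ^ (-α) * (C * t ^ n) :=
        mul_le_mul_of_nonneg_left hb (Real.rpow_nonneg ht.1.le _)
    _ = C * t ^ (-α + n) := by rw [Real.rpow_add_natCast ht.1.ne']; ring
    _ ≤ C * 1 := mul_le_mul_of_nonneg_left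
        (Real.rpow_le_one ht.1.le ht.2 (by linarith)) hC
    _ = C := mul_one _

lemma integrableOn_rpow_neg_mul {h : ℝ → ℂ} {C α : ℝ} {n : ℕ} (hC : 0 ≤ C) (hn : α ≤ n)
    (hm : Measurable h) (hb : ∀ t ∈ Icc (0 : ℝ) 1, ‖h t‖ ≤ C * t ^ n) :
    IntegrableOn (fun t : ℝ => ((t ^ (-α) : ℝ) : ℂ) * h t) (Ioc 0 1) := by
  refine Integrable.mono' (g := fun _ => C) (integrable_const C) ?_ ?_
  · refine Measurable.aestronglyMeasurable ?_
    fun_prop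
  · filter_upwards [ae_restrict_mem measurableSet_Ioc] with t ht
    exact norm_rpow_neg_mul_le hC hn ht (hb t ⟨ht.1.le, ht.2⟩)

lemma integrableOn_rpow_neg_mul_Ioi (f : 𝓢(ℝ, ℂ)) {α : ℝ} (hα : 0 ≤ α) :
    IntegrableOn (fun t : ℝ => ((t ^ (-α) : ℝ) : ℂ) * f t) (Ioi 1) := by
  refine Integrable.mono' (f.integrable.norm.integrableOn (s := Ioi 1)) ?_ ?_
  · refine Measurable.aestronglyMeasurable ?_
    have := f.continuous.measurable
    fun_prop
  · filter_upwards [ae_restrict_mem measurableSet_Ioi] with t ht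
    have ht : 1 < t := ht
    rw [norm_mul, Complex.norm_real, Real.norm_of_nonneg (Real.rpow_nonneg (by linarith) _)]
    exact mul_le_of_le_one_left (norm_nonneg _)
      (Real.rpow_le_one_of_one_le_of_nonpos ht.le (by linarith))

lemma hasDerivAt_ofReal_rpow {t : ℝ} (ht : 0 < t) (α : ℝ) :
    HasDerivAt (fun t : ℝ => ((t ^ α : ℝ) : ℂ)) ((α : ℂ) * ((t ^ (α - 1) : ℝ) : ℂ)) t := by
  have := (Real.hasDerivAt_rpow_const (p := α) (Or.inl ht.ne')).ofReal_comp
  exact_mod_cast this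

/-- Integration by parts. The remainder is `O(t ^ (n + 2))` and `γ < n + 2`, so the boundary term at
`0` vanishes; differentiating a Taylor remainder gives the remainder of the derivative, one degree
lower. -/
lemma integral_rpow_neg_mul_taylor_remainder (f : 𝓢(ℝ, ℂ)) {γ : ℝ} (hγ : 1 < γ) {n : ℕ}
    (hn : γ < n + 2) :
    ∫ t in Ioc (0 : ℝ) 1, ((t ^ (-γ) : ℝ) : ℂ) * (f t - taylorPoly f (n + 1) t)
      = (γ - 1 : ℂ)⁻¹ * ((∫ t in Ioc (0 : ℝ) 1, ((t ^ (-(γ - 1)) : ℝ) : ℂ) *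
          (deriv f t - taylorPoly (deriv f) n t)) - (f 1 - taylorPoly f (n + 1) 1)) := by
  obtain ⟨C, hC, hb⟩ := exists_norm_sub_taylorPoly_le f (n + 1)
  obtain ⟨C', hC', hb'⟩ := exists_norm_sub_taylorPoly_le (SchwartzMap.derivCLM ℂ ℂ f) n
  have hd : (SchwartzMap.derivCLM ℂ ℂ f : ℝ → ℂ) = deriv f := by ext; simp
  rw [hd] at hb'
  have hI1 := integrableOn_rpow_neg_mul (h := fun t => f t - taylorPoly f (n + 1) t)
    (α := γ) hC (by push_cast; linarith)
    (f.continuous.sub (continuous_taylorPoly f _)).measurable hb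
  have hcd : Continuous (deriv f) := by rw [← hd]; exact SchwartzMap.continuous _
  have hI2 := integrableOn_rpow_neg_mul (h := fun t => deriv f t - taylorPoly (deriv f) n t)
    (α := γ - 1) hC' (by push_cast; linarith)
    (hcd.sub (continuous_taylorPoly (deriv f) _)).measurable hb'
  set g : ℝ → ℂ := fun t => f t - taylorPoly f (n + 1) t with hg
  set g' : ℝ → ℂ := fun t => deriv f t - taylorPoly (deriv f) n t with hg'
  have hgd : ∀ t, HasDerivAt g (g' t) t := fun t =>
    (f.hasDerivAt t).sub (hasDerivAt_taylorPoly_succ f n t)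
  have key := intervalIntegral.integral_eq_sub_of_hasDerivAt_of_tendsto (a := (0 : ℝ)) (b := 1)
    (f := fun t => ((t ^ (-(γ - 1)) : ℝ) : ℂ) * g t)
    (f' := fun t => (1 - γ : ℂ) * (((t ^ (-γ) : ℝ) : ℂ) * g t) + ((t ^ (-(γ - 1)) : ℝ) : ℂ) * g' t)
    (fa := 0) (fb := g 1) zero_lt_one ?_ ?_ ?_ ?_
  · rw [intervalIntegral.integral_of_le zero_le_one,
      integral_add (Integrable.const_mul hI1 _) hI2, integral_const_mul] at key
    have h1 : (γ - 1 : ℂ) ≠ 0 := by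
      have : (γ - 1 : ℝ) ≠ 0 := by linarith
      exact_mod_cast this
    rw [eq_inv_mul_iff_mul_eq₀ h1]
    linear_combination -key
  · intro t ht
    refine ((hasDerivAt_ofReal_rpow ht.1 (-(γ - 1))).mul (hgd t)).congr_deriv ?_
    rw [show -(γ - 1) - 1 = -γ by ring]
    push_cast
    ring
  · rw [intervalIntegrable_iff_integrableOn_Ioc_of_le zero_le_one]
    exact (Integrable.const_mul hI1 _).add hI2
  · rw [tendsto_zero_iff_norm_tendsto_zero]
    refine squeeze_zero' (g := fun t => C * t) (Eventually.of_forall fun _ => norm_nonneg _) ?_ ?_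
    · filter_upwards [Ioc_mem_nhdsGT zero_lt_one] with t ht
      have h1 := norm_rpow_neg_mul_le (h := g) (n := n + 1 + 1) (α := γ) hC
        (by push_cast; linarith) ht (hb t ⟨ht.1.le, ht.2⟩)
      have h2 : t ^ (-(γ - 1)) = t ^ (-γ) * t := by
        rw [← Real.rpow_add_one ht.1.ne']; congr 1; ring
      rw [h2]
      push_cast
      rw [mul_right_comm, norm_mul, Complex.norm_real, Real.norm_of_nonneg ht.1.le]
      exact mul_le_mul_of_nonneg_right h1 ht.1.le
    · have : Tendsto (fun t : ℝ => C * t) (𝓝 0) (𝓝 (C * 0)) := (continuous_const_mul C).tendsto 0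
      rw [mul_zero] at this
      exact this.mono_left nhdsWithin_le_nhds
  · have : ContinuousAt (fun t : ℝ => ((t ^ (-(γ - 1)) : ℝ) : ℂ) * g t) 1 :=
      ((hasDerivAt_ofReal_rpow zero_lt_one _).mul (hgd 1)).continuousAt
    have h := this.tendsto
    simp only [Real.one_rpow, Complex.ofReal_one, one_mul] at h
    exact h.mono_left nhdsWithin_le_nhds

/-- Companion integration by parts on `(1, ∞)`. Its boundary value `f 1` cancels the one produced on
`(0, 1]`. -/
lemma integral_Ioi_rpow_neg_mul (f : 𝓢(ℝ, ℂ)) {γ : ℝ} (hγ : 1 < γ) :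
    ∫ t in Ioi (1 : ℝ), ((t ^ (-γ) : ℝ) : ℂ) * f t
      = (γ - 1 : ℂ)⁻¹ * ((∫ t in Ioi (1 : ℝ), ((t ^ (-(γ - 1)) : ℝ) : ℂ) * deriv f t) + f 1) := by
  have hd : (SchwartzMap.derivCLM ℂ ℂ f : ℝ → ℂ) = deriv f := by ext; simp
  have hI1 := integrableOn_rpow_neg_mul_Ioi f (α := γ) (by linarith)
  have hI2 := integrableOn_rpow_neg_mul_Ioi (SchwartzMap.derivCLM ℂ ℂ f) (α := γ - 1) (by linarith)
  rw [hd] at hI2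
  have hder : ∀ t : ℝ, 0 < t → HasDerivAt (fun t => ((t ^ (-(γ - 1)) : ℝ) : ℂ) * f t)
      ((1 - γ : ℂ) * (((t ^ (-γ) : ℝ) : ℂ) * f t) + ((t ^ (-(γ - 1)) : ℝ) : ℂ) * deriv f t) t := by
    intro t ht
    refine ((hasDerivAt_ofReal_rpow ht (-(γ - 1))).mul (f.hasDerivAt t)).congr_deriv ?_
    rw [show -(γ - 1) - 1 = -γ by ring]
    push_cast
    ring
  have key := integral_Ioi_of_hasDerivAt_of_tendsto (a := (1 : ℝ))
    (f := fun t => ((t ^ (-(γ - 1)) : ℝ) : ℂ) * f t) (m := 0)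
    (hder 1 zero_lt_one).continuousAt.continuousWithinAt
    (fun t ht => hder t (lt_trans zero_lt_one ht))
    ((Integrable.const_mul hI1 _).add hI2) ?_
  · rw [integral_add (Integrable.const_mul hI1 _) hI2, integral_const_mul] at key
    have h1 : (γ - 1 : ℂ) ≠ 0 := by
      have : (γ - 1 : ℝ) ≠ 0 := by linarith
      exact_mod_cast this
    simp only [Real.one_rpow, Complex.ofReal_one, one_mul] at key
    rw [eq_inv_mul_iff_mul_eq₀ h1]
    linear_combination -key
  · rw [tendsto_zero_iff_norm_tendsto_zero]
    refine squeeze_zero' (g := fun t => ‖f t‖) (Eventually.of_forall fun _ => norm_nonneg _) ?_ ?_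
    · filter_upwards [eventually_ge_atTop 1] with t ht
      rw [norm_mul, Complex.norm_real, Real.norm_of_nonneg (Real.rpow_nonneg (by linarith) _)]
      exact mul_le_of_le_one_left (norm_nonneg _)
        (Real.rpow_le_one_of_one_le_of_nonpos ht (by linarith))
    · have := f.tendsto_cocompact.mono_left atTop_le_cocompact
      simpa using this.norm

/-- Raising the exponent of a finite part by one. -/
theorem finitePart_eq_deriv (f : 𝓢(ℝ, ℂ)) {γ : ℝ} (hγ : 1 < γ) :
    finitePart γ f = (γ - 1 : ℂ)⁻¹ * (finitePart (γ - 1) (deriv f) +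
      ∑ k ∈ Finset.range (⌊γ⌋₊ + 1), if (k : ℝ) + 1 = γ then
        iteratedDeriv k f 0 / (k.factorial : ℂ) else 0) := by
  obtain ⟨n, hn⟩ : ∃ n, ⌊γ⌋₊ = n + 1 :=
    ⟨⌊γ⌋₊ - 1, (Nat.sub_add_cancel (Nat.le_floor (by exact_mod_cast hγ.le))).symm⟩
  have hn' : ⌊γ - 1⌋₊ = n := by rw [Nat.floor_sub_one, hn]; rfl
  have hlt : γ < n + 2 := by
    have := Nat.lt_floor_add_one γ
    rw [hn] at this; push_cast at this; linarith
  have h1 : (γ - 1 : ℂ) ≠ 0 := by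
    have : (γ - 1 : ℝ) ≠ 0 := by linarith
    exact_mod_cast this
  rw [finitePart, finitePart, hn, hn']
  have e1 := integral_rpow_neg_mul_taylor_remainder f hγ hlt
  have e2 := integral_Ioi_rpow_neg_mul f hγ
  unfold taylorPoly at e1
  rw [e1, e2]
  simp only [Complex.ofReal_one, one_pow, mul_one]
  -- After the two values `f 1` cancel, the Taylor polynomial at `1` remains. It combines with the
  -- correction sums after an index shift: the term `k = 0` drops out, and the term `k + 1 = γ`,
  -- where the definition puts `0`, survives as the anomaly of integer exponents.
  have e3 : ∑ k ∈ Finset.range (n + 1 + 1), iteratedDeriv k f 0 / (k.factorial : ℂ)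
      + (γ - 1) * (∑ k ∈ Finset.range (n + 1 + 1), if (k : ℝ) + 1 = γ then 0
        else iteratedDeriv k f 0 / (k.factorial : ℂ) / (((k : ℝ) + 1 - γ : ℝ) : ℂ))
      = (∑ k ∈ Finset.range (n + 1), if (k : ℝ) + 1 = γ - 1 then 0
        else iteratedDeriv k (deriv f) 0 / (k.factorial : ℂ) /
          (((k : ℝ) + 1 - (γ - 1) : ℝ) : ℂ)) +
        ∑ k ∈ Finset.range (n + 1 + 1), if (k : ℝ) + 1 = γ then
        iteratedDeriv k f 0 / (k.factorial : ℂ) else 0 := by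
    rw [Finset.mul_sum, ← Finset.sum_add_distrib, Finset.sum_range_succ',
      Finset.sum_range_succ' _ (n + 1)]
    have h0 : ¬ (((0 : ℕ) : ℝ) + 1 = γ) := by push_cast; linarith
    rw [if_neg h0, if_neg h0, add_zero, ← add_assoc, add_assoc, ← Finset.sum_add_distrib]
    have h00 : ((((0 : ℕ) : ℝ) + 1 - γ : ℝ) : ℂ) = -(γ - 1) := by push_cast; ring
    rw [h00]
    have : iteratedDeriv 0 f 0 / (Nat.factorial 0 : ℂ) + (γ - 1) *
        (iteratedDeriv 0 f 0 / (Nat.factorial 0 : ℂ) / -(γ - 1)) = 0 := by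
      field_simp; ring
    rw [this, add_zero]
    refine Finset.sum_congr rfl fun k _ => ?_
    rw [← iteratedDeriv_succ']
    by_cases hk : ((k + 1 : ℕ) : ℝ) + 1 = γ
    · have hk' : (k : ℝ) + 1 = γ - 1 := by push_cast at hk; linarith
      simp [hk']
    · have hk' : ¬ ((k : ℝ) + 1 = γ - 1) := fun h => hk (by push_cast; linarith)
      rw [if_neg hk, if_neg hk', if_neg hk]
      have h2 : ((k : ℂ) + 1 + 1 - γ) ≠ 0 := by
        have : ((k : ℝ) + 1 + 1 - γ) ≠ 0 := fun h => hk (by push_cast; linarith)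
        exact_mod_cast this
      have h3 : (k.factorial : ℂ) ≠ 0 := by exact_mod_cast k.factorial_ne_zero
      have h4 : ((k : ℂ) + 1) ≠ 0 := by exact_mod_cast k.succ_ne_zero
      rw [Nat.factorial_succ]
      push_cast
      have h5 : ((k : ℂ) + 1 - (γ - 1)) ≠ 0 := by
        convert h2 using 1; ring
      rw [show ((k : ℂ) + 1 - (γ - 1)) = (k : ℂ) + 1 + 1 - γ by ring, add_zero]
      field_simp
      ring
  rw [eq_inv_mul_iff_mul_eq₀ h1]
  simp only [mul_add, ← mul_assoc, mul_inv_cancel₀ h1, one_mul]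
  linear_combination e3

/-! ### Tempered distributions given by functions -/

lemma norm_mul_one_add_pow_le {E : Type*} [NormedAddCommGroup E] [NormedSpace ℝ E]
    (φ : 𝓢(E, ℂ)) (N : ℕ) (x : E) :
    (1 + ‖x‖) ^ N * ‖φ x‖ ≤
      2 ^ N * (Finset.Iic (N, 0)).sup (schwartzSeminormFamily ℂ E ℂ) φ := by
  have := SchwartzMap.one_add_le_sup_seminorm_apply (𝕜 := ℂ) (m := (N, 0)) (k := N) (n := 0)
    le_rfl le_rfl φ x
  rw [norm_iteratedFDeriv_zero] at this
  exact this

section PolyIntegrable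

variable {E : Type*} [NormedAddCommGroup E] [MeasureSpace E]

lemma PolyIntegrable.add {f g : E → ℂ} [BorelSpace E] (hf : PolyIntegrable f)
    (hg : PolyIntegrable g) : PolyIntegrable (fun x => f x + g x) := by
  have aux : ∀ {h : E → ℂ} {N : ℕ} (M : ℕ),
      Integrable (fun x => (((1 + ‖x‖) ^ N)⁻¹ : ℝ) * h x) →
      Integrable (fun x => (((1 + ‖x‖) ^ (M + N))⁻¹ : ℝ) * h x) := by
    intro h N M hh
    refine (hh.bdd_mul (f := fun x => ((((1 + ‖x‖) ^ M)⁻¹ : ℝ) : ℂ)) (c := 1)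
      ?_ ?_).congr (Eventually.of_forall fun x => ?_)
    · exact Measurable.aestronglyMeasurable (by fun_prop)
    · refine Eventually.of_forall fun x => ?_
      rw [Complex.norm_real, Real.norm_of_nonneg (by positivity)]
      exact inv_le_one_of_one_le₀ (one_le_pow₀ (by linarith [norm_nonneg x]))
    · simp only [pow_add, mul_inv]
      push_cast
      ring
  obtain ⟨N, hN⟩ := hf
  obtain ⟨M, hM⟩ := hg
  refine ⟨M + N, ?_⟩
  have h2 := aux N hM
  rw [add_comm] at h2
  refine ((aux M hN).add h2).congr (Eventually.of_forall fun x => ?_)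
  simp only [Pi.add_apply, mul_add]

lemma PolyIntegrable.mul_of_norm_le {f g : E → ℂ} [BorelSpace E] (hf : PolyIntegrable f)
    (hg : Measurable g) {C : ℝ} {M : ℕ} (hC : ∀ x, ‖g x‖ ≤ C * (1 + ‖x‖) ^ M) :
    PolyIntegrable (fun x => g x * f x) := by
  obtain ⟨N, hN⟩ := hf
  refine ⟨M + N, ?_⟩
  refine (hN.bdd_mul (f := fun x => ((((1 + ‖x‖) ^ M)⁻¹ : ℝ) : ℂ) * g x) (c := C)
      ?_ ?_).congr (Eventually.of_forall fun x => ?_)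
  · exact Measurable.aestronglyMeasurable (by fun_prop)
  · refine Eventually.of_forall fun x => ?_
    have : 0 < (1 + ‖x‖) ^ M := pow_pos (by linarith [norm_nonneg x]) _
    rw [norm_mul, Complex.norm_real, Real.norm_of_nonneg (by positivity), inv_mul_le_iff₀ this,
      mul_comm]
    exact hC x
  · simp only [pow_add, mul_inv]
    push_cast
    ring

lemma PolyIntegrable.const_mul {f : E → ℂ} (hf : PolyIntegrable f) (c : ℂ) :
    PolyIntegrable (fun x => c * f x) := by
  obtain ⟨N, hN⟩ := hf
  refine ⟨N, (hN.const_mul c).congr (Eventually.of_forall fun x => ?_)⟩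
  simp only
  ring

lemma PolyIntegrable.mono {f g : E → ℂ} (hf : PolyIntegrable f)
    (hg : AEStronglyMeasurable g) (h : ∀ᵐ x, ‖g x‖ ≤ ‖f x‖) [BorelSpace E] : PolyIntegrable g := by
  obtain ⟨N, hN⟩ := hf
  refine ⟨N, hN.mono ?_ ?_⟩
  · exact (Measurable.aestronglyMeasurable (by fun_prop)).mul hg
  · filter_upwards [h] with x hx
    rw [norm_mul, norm_mul]
    gcongr

variable [NormedSpace ℝ E]

lemma PolyIntegrable.integrable_mul [BorelSpace E] [SecondCountableTopology E] {h : E → ℂ}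
    (hh : PolyIntegrable h) (φ : 𝓢(E, ℂ)) : Integrable fun x => φ x * h x := by
  obtain ⟨N, hN⟩ := hh
  refine (hN.bdd_mul (f := fun x => (((1 + ‖x‖) ^ N : ℝ) : ℂ) * φ x)
    (c := 2 ^ N * (Finset.Iic (N, 0)).sup (schwartzSeminormFamily ℂ E ℂ) φ) ?_ ?_).congr
    (Eventually.of_forall fun x => ?_)
  · refine Continuous.aestronglyMeasurable ?_
    have := φ.continuous
    fun_prop
  · refine Eventually.of_forall fun x => ?_
    rw [norm_mul, Complex.norm_real, Real.norm_of_nonneg (by positivity)]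
    exact norm_mul_one_add_pow_le φ N x
  · have : ((1 + ‖x‖ : ℝ) : ℂ) ^ N ≠ 0 := by
      have : (1 + ‖x‖) ^ N ≠ 0 := by positivity
      exact_mod_cast this
    push_cast at this ⊢
    field_simp

/-- A polynomially integrable function defines a tempered distribution. -/
theorem PolyIntegrable.exists_distribution [BorelSpace E] [SecondCountableTopology E] {h : E → ℂ}
    (hh : PolyIntegrable h) : ∃ T : 𝓢'(E, ℂ), ∀ φ : 𝓢(E, ℂ), T φ = ∫ x, φ x * h x := by
  refine ⟨ContinuousLinearMap.toPointwiseConvergenceCLM _ _ _ _ (SchwartzMap.mkCLMtoNormedSpace (𝕜 := ℂ)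
    (fun φ : 𝓢(E, ℂ) => ∫ x, φ x * h x) ?_ ?_ ?_), fun φ => rfl⟩
  · intro φ ψ
    rw [← integral_add (hh.integrable_mul φ) (hh.integrable_mul ψ)]
    simp [add_mul]
  · intro c φ
    rw [RingHom.id_apply, smul_eq_mul, ← integral_const_mul]
    simp [mul_assoc]
  · obtain ⟨N, hN⟩ := hh
    refine ⟨Finset.Iic (N, 0), 2 ^ N * ∫ x, ‖(((1 + ‖x‖) ^ N)⁻¹ : ℝ) * h x‖,
      mul_nonneg (by positivity) (integral_nonneg fun _ => norm_nonneg _), fun φ => ?_⟩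
    set S := (Finset.Iic (N, 0)).sup (schwartzSeminormFamily ℂ E ℂ) φ
    calc ‖∫ x, φ x * h x‖ ≤ ∫ x, (2 ^ N * S) * ‖(((1 + ‖x‖) ^ N)⁻¹ : ℝ) * h x‖ := by
          refine norm_integral_le_of_norm_le (hN.norm.const_mul _)
            (Eventually.of_forall fun x => ?_)
          have hp : 0 < (1 + ‖x‖) ^ N := by positivity
          have h1 := norm_mul_one_add_pow_le φ N x
          rw [norm_mul, norm_mul, Complex.norm_real, Real.norm_of_nonneg (by positivity),
            ← mul_assoc]
          refine mul_le_mul_of_nonneg_right ?_ (norm_nonneg _)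
          rw [← div_eq_mul_inv, le_div_iff₀ hp, mul_comm]
          exact h1
      _ = _ := by rw [integral_const_mul]; ring

end PolyIntegrable

/-- In polar coordinates the integrand is at most `r ^ (d - 1 - α)` near `0`, integrable because `α
< d`, and at most `r ^ (-2)` at infinity thanks to the weight. -/
lemma integrable_norm_rpow_neg_mul {E : Type*} [NormedAddCommGroup E] [NormedSpace ℝ E]
    [FiniteDimensional ℝ E] [Nontrivial E] [MeasureSpace E] [BorelSpace E]
    [(volume : Measure E).IsAddHaarMeasure] {α : ℝ} (h0 : 0 ≤ α)
    (hα : α < Module.finrank ℝ E) :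
    Integrable fun x : E => ‖x‖ ^ (-α) * ((1 + ‖x‖) ^ (Module.finrank ℝ E + 1))⁻¹ := by
  set d := Module.finrank ℝ E with hd
  have hd1 : 1 ≤ d := Module.finrank_pos
  rw [integrable_fun_norm_addHaar volume
    (f := fun r : ℝ => r ^ (-α) * ((1 + r) ^ (d + 1))⁻¹), ← hd, ← Ioc_union_Ioi_eq_Ioi zero_le_one]
  have heq : ∀ r : ℝ, 0 < r → r ^ (d - 1) • (r ^ (-α) * ((1 + r) ^ (d + 1))⁻¹)
      = r ^ ((d : ℝ) - 1 - α) * ((1 + r) ^ (d + 1))⁻¹ := by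
    intro r hr
    rw [smul_eq_mul, ← mul_assoc, ← Real.rpow_natCast, ← Real.rpow_add hr, Nat.cast_sub hd1]
    push_cast
    ring_nf
  have hm : Measurable (fun r : ℝ => r ^ (d - 1) • (r ^ (-α) * ((1 + r) ^ (d + 1))⁻¹)) := by
    simp only [smul_eq_mul]; fun_prop
  refine IntegrableOn.union ?_ ?_
  · have h1 : IntegrableOn (fun r : ℝ => r ^ ((d : ℝ) - 1 - α)) (Ioc 0 1) := by
      rw [← intervalIntegrable_iff_integrableOn_Ioc_of_le zero_le_one]
      exact intervalIntegral.intervalIntegrable_rpow' (by linarith)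
    refine h1.mono' hm.aestronglyMeasurable ?_
    filter_upwards [ae_restrict_mem measurableSet_Ioc] with r hr
    have hr0 : 0 < r := hr.1
    rw [heq r hr0, norm_mul, Real.norm_of_nonneg (by positivity), Real.norm_of_nonneg (by positivity)]
    exact mul_le_of_le_one_right (by positivity)
      (inv_le_one_of_one_le₀ (one_le_pow₀ (by linarith)))
  · have h1 : IntegrableOn (fun r : ℝ => r ^ ((-2 : ℝ))) (Ioi 1) :=
      integrableOn_Ioi_rpow_of_lt (by norm_num) zero_lt_one
    refine h1.mono' hm.aestronglyMeasurable ?_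
    filter_upwards [ae_restrict_mem measurableSet_Ioi] with r hr
    have hr1 : 1 < r := hr
    have hr0 : 0 < r := by linarith
    rw [heq r hr0, norm_mul, Real.norm_of_nonneg (by positivity), Real.norm_of_nonneg (by positivity)]
    calc r ^ ((d : ℝ) - 1 - α) * ((1 + r) ^ (d + 1))⁻¹
        ≤ r ^ ((d : ℝ) - 1) * (r ^ (d + 1))⁻¹ := by
          refine mul_le_mul (Real.rpow_le_rpow_of_exponent_le hr1.le (by linarith)) ?_
            (by positivity) (by positivity)
          gcongr
          linarith
      _ = r ^ (-2 : ℝ) := by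
          rw [← Real.rpow_natCast, ← Real.rpow_neg hr0.le, ← Real.rpow_add hr0]
          push_cast
          ring_nf

lemma polyIntegrable_norm_rpow_neg {E : Type*} [NormedAddCommGroup E] [NormedSpace ℝ E]
    [FiniteDimensional ℝ E] [Nontrivial E] [MeasureSpace E] [BorelSpace E]
    [(volume : Measure E).IsAddHaarMeasure] {α : ℝ} (h0 : 0 ≤ α)
    (hα : α < Module.finrank ℝ E) :
    PolyIntegrable fun x : E => ((‖x‖ ^ (-α) : ℝ) : ℂ) := by
  refine ⟨Module.finrank ℝ E + 1, (integrable_norm_rpow_neg_mul h0 hα).ofReal.congr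
    (Eventually.of_forall fun x => ?_)⟩
  simp only [RCLike.ofReal_mul, Complex.coe_algebraMap]
  exact mul_comm _ _

/-! ### The transform `∫ φ(ω) exp(iωt) dω` on Schwartz functions of one variable -/

/-- The Fourier transform `∫ φ(ω) exp(iωt) dω` of a Schwartz function, as a Schwartz function. -/
def waveTransform (φ : 𝓢(ℝ, ℂ)) : 𝓢(ℝ, ℂ) :=
  SchwartzMap.compCLMOfContinuousLinearEquiv ℂ
    -- The kernel of `𝓕⁻` is `exp(2πiωt)`, hence the dilation by `1 / (2π)`.
    (ContinuousLinearEquiv.unitsEquivAut ℝ (Units.mk0 (2 * Real.pi)⁻¹ (by positivity))) (𝓕⁻ φ)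

lemma waveTransform_apply (φ : 𝓢(ℝ, ℂ)) (t : ℝ) :
    waveTransform φ t = ∫ ω, φ ω * Complex.exp (Complex.I * ω * t) := by
  rw [waveTransform, SchwartzMap.compCLMOfContinuousLinearEquiv_apply, Function.comp_apply,
    ContinuousLinearEquiv.unitsEquivAut_apply, SchwartzMap.fourierInv_coe, Real.fourierInv_eq']
  refine integral_congr_ae (Eventually.of_forall fun ω => ?_)
  simp only [smul_eq_mul, RCLike.inner_apply, conj_trivial, Units.val_mk0]
  rw [mul_comm]
  congr 2
  have : (Real.pi : ℂ) ≠ 0 := by exact_mod_cast Real.pi_ne_zero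
  push_cast
  field_simp

/-- Multiplication by `iω`. -/
def mulFreq : 𝓢(ℝ, ℂ) →L[ℂ] 𝓢(ℝ, ℂ) :=
  SchwartzMap.smulLeftCLM ℂ (fun ω : ℝ => Complex.I * (ω : ℂ))

lemma mulFreq_apply (φ : 𝓢(ℝ, ℂ)) (ω : ℝ) : mulFreq φ ω = Complex.I * ω * φ ω := by
  have h : (fun ω : ℝ => Complex.I * (ω : ℂ)).HasTemperateGrowth :=
    (Function.HasTemperateGrowth.const Complex.I).mul Function.Complex.hasTemperateGrowth_ofReal
  rw [mulFreq, SchwartzMap.smulLeftCLM_apply_apply h, smul_eq_mul]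

lemma mulFreq_iterate_apply (φ : 𝓢(ℝ, ℂ)) (k : ℕ) (ω : ℝ) :
    (mulFreq^[k] φ) ω = (Complex.I * ω) ^ k * φ ω := by
  induction k with
  | zero => simp
  | succ k ih => rw [Function.iterate_succ_apply', mulFreq_apply, ih]; ring

lemma norm_cexp_I_mul_mul (ω t : ℝ) : ‖Complex.exp (Complex.I * ω * t)‖ = 1 := by
  rw [show Complex.I * (ω : ℂ) * t = ((ω * t : ℝ) : ℂ) * Complex.I by push_cast; ring]
  exact Complex.norm_exp_ofReal_mul_I _

lemma integrable_mul_cexp (φ : 𝓢(ℝ, ℂ)) (t : ℝ) :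
    Integrable fun ω : ℝ => φ ω * Complex.exp (Complex.I * ω * t) := by
  refine φ.integrable.mono (Continuous.aestronglyMeasurable ?_) (Eventually.of_forall fun ω => ?_)
  · have := φ.continuous
    fun_prop
  · rw [norm_mul, norm_cexp_I_mul_mul, mul_one]

lemma deriv_waveTransform (φ : 𝓢(ℝ, ℂ)) :
    deriv (waveTransform φ) = waveTransform (mulFreq φ) := by
  ext t
  have h := (hasDerivAt_integral_of_dominated_loc_of_deriv_le (μ := volume) (𝕜 := ℝ)
    (F := fun (t ω : ℝ) => φ ω * Complex.exp (Complex.I * ω * t))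
    (F' := fun (t ω : ℝ) => mulFreq φ ω * Complex.exp (Complex.I * ω * t))
    (x₀ := t) (s := univ) (bound := fun ω => ‖mulFreq φ ω‖) univ_mem ?_ ?_ ?_ ?_ ?_ ?_).2
  · rw [waveTransform_apply, ← h.deriv]
    congr 1
    ext t
    exact waveTransform_apply φ t
  · exact Eventually.of_forall fun t => (integrable_mul_cexp φ t).aestronglyMeasurable
  · exact integrable_mul_cexp φ t
  · exact (integrable_mul_cexp (mulFreq φ) t).aestronglyMeasurable
  · exact Eventually.of_forall fun ω t _ => by rw [norm_mul, norm_cexp_I_mul_mul, mul_one]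
  · exact (mulFreq φ).integrable.norm
  · refine Eventually.of_forall fun ω t _ => ?_
    have h1 : HasDerivAt (fun t : ℝ => Complex.I * (ω : ℂ) * (t : ℂ)) (Complex.I * ω) t := by
      simpa using (Complex.ofRealCLM.hasDerivAt (x := t)).const_mul (Complex.I * (ω : ℂ))
    refine (h1.cexp.const_mul (φ ω)).congr_deriv ?_
    rw [mulFreq_apply]
    ring

lemma iteratedDeriv_waveTransform (φ : 𝓢(ℝ, ℂ)) (k : ℕ) :
    iteratedDeriv k (waveTransform φ) = waveTransform (mulFreq^[k] φ) := by
  induction k with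
  | zero => simp
  | succ k ih => rw [iteratedDeriv_succ, ih, deriv_waveTransform, Function.iterate_succ_apply']

lemma iteratedDeriv_waveTransform_zero (φ : 𝓢(ℝ, ℂ)) (k : ℕ) :
    iteratedDeriv k (waveTransform φ) 0 = ∫ ω : ℝ, (Complex.I * ω) ^ k * φ ω := by
  rw [iteratedDeriv_waveTransform, waveTransform_apply]
  simp [mulFreq_iterate_apply]

/-! ### Fourier transform of `H(t) / t ^ γ` for `0 < γ < 1` -/

lemma finitePart_of_lt_one (f : 𝓢(ℝ, ℂ)) {γ : ℝ} (h1 : γ < 1) :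
    finitePart γ f = (∫ t in Ioc (0 : ℝ) 1, ((t ^ (-γ) : ℝ) : ℂ) * (f t - f 0)) +
      (∫ t in Ioi (1 : ℝ), ((t ^ (-γ) : ℝ) : ℂ) * f t) + f 0 / (1 - γ : ℂ) := by
  have hfl : ⌊γ⌋₊ = 0 := Nat.floor_eq_zero.2 h1
  have h2 : ¬ (1 = γ) := by linarith
  simp [finitePart, hfl, h2]

lemma integrableOn_rpow_neg_Ioc {γ : ℝ} (h1 : γ < 1) :
    IntegrableOn (fun t : ℝ => ((t ^ (-γ) : ℝ) : ℂ)) (Ioc 0 1) := by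
  have : IntegrableOn (fun t : ℝ => t ^ (-γ)) (Ioc 0 1) := by
    rw [← intervalIntegrable_iff_integrableOn_Ioc_of_le zero_le_one]
    exact intervalIntegral.intervalIntegrable_rpow' (by linarith)
  exact this.ofReal

lemma integrableOn_Ioi_rpow_neg_mul (f : 𝓢(ℝ, ℂ)) {γ : ℝ} (h0 : 0 < γ) (h1 : γ < 1) :
    IntegrableOn (fun t : ℝ => ((t ^ (-γ) : ℝ) : ℂ) * f t) (Ioi 0) := by
  rw [← Ioc_union_Ioi_eq_Ioi zero_le_one]
  refine IntegrableOn.union ?_ (integrableOn_rpow_neg_mul_Ioi f h0.le)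
  refine Integrable.mul_bdd (c := SchwartzMap.seminorm ℝ 0 0 f) (integrableOn_rpow_neg_Ioc h1)
    f.continuous.aestronglyMeasurable (Eventually.of_forall fun t => f.norm_le_seminorm ℝ t)

/-- The value `f 0` subtracted on `(0, 1]` is given back by the last term, since `∫ t ^ (-γ)` over
`(0, 1]` is `1 / (1 - γ)`. -/
lemma finitePart_eq_integral (f : 𝓢(ℝ, ℂ)) {γ : ℝ} (h0 : 0 < γ) (h1 : γ < 1) :
    finitePart γ f = ∫ t in Ioi (0 : ℝ), ((t ^ (-γ) : ℝ) : ℂ) * f t := by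
  have hI := integrableOn_Ioi_rpow_neg_mul f h0 h1
  rw [finitePart_of_lt_one f h1, ← Ioc_union_Ioi_eq_Ioi zero_le_one,
    setIntegral_union (by simp) measurableSet_Ioi
      (hI.mono_set Ioc_subset_Ioi_self) (hI.mono_set (Ioi_subset_Ioi zero_le_one))]
  simp only [mul_sub]
  rw [integral_sub (hI.mono_set Ioc_subset_Ioi_self) ((integrableOn_rpow_neg_Ioc h1).mul_const _),
    integral_mul_const]
  have : ∫ t in Ioc (0 : ℝ) 1, ((t ^ (-γ) : ℝ) : ℂ) = 1 / (1 - γ) := by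
    rw [integral_complex_ofReal, ← intervalIntegral.integral_of_le zero_le_one,
      integral_rpow (Or.inl (by linarith)), Real.one_rpow, Real.zero_rpow (by linarith)]
    push_cast
    ring_nf
  rw [this]
  ring

/-- The damping factor makes Fubini applicable; the inner integral in `t` is then the Laplace
transform at `z = ε - iω`. -/
lemma integral_rpow_mul_exp_mul_waveTransform (φ : 𝓢(ℝ, ℂ)) {γ ε : ℝ} (h1 : γ < 1)
    (hε : 0 < ε) :
    ∫ t in Ioi (0 : ℝ), ((t ^ (-γ) : ℝ) : ℂ) * (Real.exp (-ε * t) : ℂ) * waveTransform φ t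
      = ∫ ω, φ ω * ((1 / (ε - Complex.I * ω)) ^ ((1 - γ : ℝ) : ℂ) * (Real.Gamma (1 - γ) : ℂ)) := by
  have hγ : (-1 : ℝ) < -γ := by linarith
  have hI : Integrable (Function.uncurry fun (t ω : ℝ) =>
      ((t ^ (-γ) : ℝ) : ℂ) * (Real.exp (-ε * t) : ℂ) * (φ ω * Complex.exp (Complex.I * ω * t)))
      ((volume.restrict (Ioi 0)).prod volume) := by
    have := (integrableOn_rpow_mul_exp_neg hγ hε).mul_prod
      (φ.integrable (μ := volume)).norm
    refine this.mono' ?_ ?_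
    · refine Measurable.aestronglyMeasurable ?_
      have := φ.continuous.measurable
      unfold Function.uncurry
      fun_prop
    · rw [Measure.ae_prod_iff_ae_ae ?_]
      · filter_upwards [ae_restrict_mem measurableSet_Ioi] with t ht
        refine Eventually.of_forall fun ω => ?_
        have ht : 0 < t := ht
        simp only [Function.uncurry, norm_mul, norm_cexp_I_mul_mul, mul_one, Complex.norm_real]
        rw [Real.norm_of_nonneg (Real.rpow_nonneg ht.le _), Real.norm_of_nonneg (Real.exp_nonneg _)]
      · refine measurableSet_le ?_ ?_
        · have := φ.continuous.measurable
          unfold Function.uncurry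
          fun_prop
        · have := φ.continuous.measurable
          fun_prop
  calc _ = ∫ t in Ioi (0 : ℝ), ∫ ω : ℝ, ((t ^ (-γ) : ℝ) : ℂ) * (Real.exp (-ε * t) : ℂ) *
        (φ ω * Complex.exp (Complex.I * ω * t)) := by
        refine integral_congr_ae (Eventually.of_forall fun t => ?_)
        simp only
        rw [integral_const_mul, waveTransform_apply]
    _ = ∫ ω : ℝ, ∫ t in Ioi (0 : ℝ), ((t ^ (-γ) : ℝ) : ℂ) * (Real.exp (-ε * t) : ℂ) *
        (φ ω * Complex.exp (Complex.I * ω * t)) := integral_integral_swap hI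
    _ = _ := by
        refine integral_congr_ae (Eventually.of_forall fun ω => ?_)
        simp only
        have hre : 0 < ((ε : ℂ) - Complex.I * ω).re := by simpa using hε
        rw [← integral_rpow_mul_cexp_neg (by linarith) hre, ← integral_const_mul]
        refine integral_congr_ae (Eventually.of_forall fun t => ?_)
        simp only
        rw [show (1 : ℝ) - γ - 1 = -γ by ring, Complex.ofReal_exp,
          show -((ε : ℂ) - Complex.I * ω) * t = ((-ε * t : ℝ) : ℂ) + Complex.I * ω * t by
            push_cast; ring, Complex.exp_add]
        ring

/-- `s` is the Fourier transform of the finite part of `H(t) / t ^ γ`. -/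
def IsFinitePartSymbol (γ : ℝ) (s : ℝ → ℂ) : Prop :=
  PolyIntegrable s ∧ ∀ φ : 𝓢(ℝ, ℂ), finitePart γ (waveTransform φ) = ∫ ω, φ ω * s ω

lemma norm_I_div_cpow {ω : ℝ} (hω : ω ≠ 0) (α : ℝ) :
    ‖(Complex.I / ω) ^ (α : ℂ)‖ = ‖ω‖ ^ (-α) := by
  have h : Complex.I / ω ≠ 0 := div_ne_zero Complex.I_ne_zero (by exact_mod_cast hω)
  rw [Complex.norm_cpow_of_ne_zero h]
  simp [Real.rpow_neg, Real.inv_rpow]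

lemma measurable_I_div_cpow (α : ℂ) : Measurable fun ω : ℝ => (Complex.I / ω) ^ α := by
  fun_prop

lemma polyIntegrable_I_div_cpow {α : ℝ} (h0 : 0 < α) (h1 : α < 1) :
    PolyIntegrable fun ω : ℝ => (Complex.I / ω) ^ (α : ℂ) := by
  refine (polyIntegrable_norm_rpow_neg (E := ℝ) h0.le (by simpa using h1)).mono
    (measurable_I_div_cpow _).aestronglyMeasurable ?_
  filter_upwards [compl_mem_ae_iff.2 (measure_singleton (0 : ℝ))] with ω hω
  rw [norm_I_div_cpow hω, Complex.norm_real]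
  exact Real.le_norm_self _

lemma I_div_mem_slitPlane {ω : ℝ} (hω : ω ≠ 0) : Complex.I / ω ∈ Complex.slitPlane := by
  rw [Complex.mem_slitPlane_iff]
  right
  simp [hω]

/-- Abel summation: let `ε → 0` in the damped identity. On the frequency side `1 / (ε - iω)` tends
to `i / ω`, which is off the branch cut, and `|ε - iω| ≥ |ω|` shows that the limit itself dominates.
-/
theorem isFinitePartSymbol_of_lt_one {γ : ℝ} (h0 : 0 < γ) (h1 : γ < 1) :
    IsFinitePartSymbol γ
      (fun ω => (Real.Gamma (1 - γ) : ℂ) * (Complex.I / ω) ^ ((1 - γ : ℝ) : ℂ)) := by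
  have hP := polyIntegrable_I_div_cpow (α := 1 - γ) (by linarith) (by linarith)
  refine ⟨hP.const_mul _, fun φ => ?_⟩
  have hL : Tendsto (fun ε : ℝ => ∫ t in Ioi (0 : ℝ), ((t ^ (-γ) : ℝ) : ℂ) *
      (Real.exp (-ε * t) : ℂ) * waveTransform φ t) (𝓝[>] 0)
      (𝓝 (∫ t in Ioi (0 : ℝ), ((t ^ (-γ) : ℝ) : ℂ) * waveTransform φ t)) := by
    refine tendsto_integral_filter_of_dominated_convergence
      (fun t => ‖((t ^ (-γ) : ℝ) : ℂ) * waveTransform φ t‖) ?_ ?_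
      (integrableOn_Ioi_rpow_neg_mul _ h0 h1).norm ?_
    · refine Eventually.of_forall fun ε => Measurable.aestronglyMeasurable ?_
      have := (waveTransform φ).continuous.measurable
      fun_prop
    · filter_upwards [self_mem_nhdsWithin] with ε hε
      have hε : 0 < ε := hε
      filter_upwards [ae_restrict_mem measurableSet_Ioi] with t ht
      have ht : 0 < t := ht
      rw [mul_right_comm, norm_mul, Complex.norm_real (Real.exp _),
        Real.norm_of_nonneg (Real.exp_nonneg _)]
      exact mul_le_of_le_one_right (norm_nonneg _) (Real.exp_le_one_iff.2 (by nlinarith))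
    · refine Eventually.of_forall fun t => ?_
      have : Continuous fun ε : ℝ => ((t ^ (-γ) : ℝ) : ℂ) *
          (Real.exp (-ε * t) : ℂ) * waveTransform φ t := by fun_prop
      have h := (this.tendsto 0).mono_left (nhdsWithin_le_nhds (s := Ioi 0))
      simpa using h
  have hR : Tendsto (fun ε : ℝ => ∫ ω, φ ω * ((1 / (ε - Complex.I * ω)) ^ ((1 - γ : ℝ) : ℂ) *
      (Real.Gamma (1 - γ) : ℂ))) (𝓝[>] 0)
      (𝓝 (∫ ω, φ ω * ((Complex.I / ω) ^ ((1 - γ : ℝ) : ℂ) * (Real.Gamma (1 - γ) : ℂ)))) := by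
    refine tendsto_integral_filter_of_dominated_convergence
      (fun ω => ‖φ ω * ((Complex.I / ω) ^ ((1 - γ : ℝ) : ℂ) * (Real.Gamma (1 - γ) : ℂ))‖) ?_ ?_
      ?_ ?_
    · refine Eventually.of_forall fun ε => Measurable.aestronglyMeasurable ?_
      have := φ.continuous.measurable
      fun_prop
    · filter_upwards [self_mem_nhdsWithin] with ε hε
      have hε : 0 < ε := hε
      filter_upwards [compl_mem_ae_iff.2 (measure_singleton (0 : ℝ))] with ω hω
      have hω : ω ≠ 0 := hω
      have hz : (ε : ℂ) - Complex.I * ω ≠ 0 := fun h => by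
        have := congrArg Complex.re h
        simp at this
        exact hε.ne' this
      simp only [norm_mul]
      refine mul_le_mul_of_nonneg_left (mul_le_mul_of_nonneg_right ?_ (norm_nonneg _))
        (norm_nonneg _)
      rw [norm_I_div_cpow hω, Complex.norm_cpow_of_ne_zero (one_div_ne_zero hz)]
      simp only [Complex.ofReal_im, mul_zero, Real.exp_zero, div_one, Complex.ofReal_re]
      rw [norm_div, norm_one, Real.rpow_neg (norm_nonneg _), ← Real.inv_rpow (norm_nonneg _),
        one_div]
      refine Real.rpow_le_rpow (by positivity) ?_ (by linarith)
      refine inv_anti₀ (by positivity) ?_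
      have := Complex.abs_im_le_norm ((ε : ℂ) - Complex.I * ω)
      simpa using this
    · have := (hP.const_mul (Real.Gamma (1 - γ) : ℂ)).integrable_mul φ
      refine (this.norm).congr (Eventually.of_forall fun ω => ?_)
      simp only [norm_mul]
      ring
    · filter_upwards [compl_mem_ae_iff.2 (measure_singleton (0 : ℝ))] with ω hω
      have hω : (ω : ℂ) ≠ 0 := by exact_mod_cast hω
      have e : 1 / (((0 : ℝ) : ℂ) - Complex.I * ω) = Complex.I / ω := by
        rw [Complex.ofReal_zero, zero_sub, eq_div_iff hω, one_div, neg_mul_eq_neg_mul,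
          mul_inv, mul_assoc, inv_mul_cancel₀ hω, mul_one, Complex.inv_def]
        simp
      have hc : ContinuousAt (fun ε : ℝ => φ ω * ((1 / ((ε : ℂ) - Complex.I * ω)) ^
          ((1 - γ : ℝ) : ℂ) * (Real.Gamma (1 - γ) : ℂ))) 0 := by
        refine continuousAt_const.mul (ContinuousAt.mul (ContinuousAt.cpow ?_ continuousAt_const ?_)
          continuousAt_const)
        · refine continuousAt_const.div (by fun_prop) ?_
          simpa using hω
        · rw [e]; exact I_div_mem_slitPlane (by exact_mod_cast hω)
      have h := hc.tendsto.mono_left (nhdsWithin_le_nhds (s := Ioi 0))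
      rw [e] at h
      exact h
  rw [finitePart_eq_integral _ h0 h1]
  have := tendsto_nhds_unique hL (hR.congr' ?_)
  · rw [this]
    refine integral_congr_ae (Eventually.of_forall fun ω => ?_)
    simp only
    ring
  · filter_upwards [self_mem_nhdsWithin] with ε hε
    exact (integral_rpow_mul_exp_mul_waveTransform φ h1 hε).symm

/-! ### Fourier transform of the finite part of `H(t) / t` -/

lemma norm_log_I_div_le (ω : ℝ) : ‖Complex.log (Complex.I / ω)‖ ≤ |Real.log ‖ω‖| + 2 := by
  refine (Complex.norm_le_abs_re_add_abs_im _).trans (add_le_add ?_ ?_)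
  · rw [Complex.log_re, norm_div, Complex.norm_I, one_div, Real.log_inv, abs_neg,
      Complex.norm_real]
  · rw [Complex.log_im]
    -- At `ω = 0` the conventions `I / 0 = 0` and `arg 0 = 0` apply; otherwise `I / ω` is purely
    -- imaginary and `π / 2 ≤ 2`.
    by_cases h : ω = 0
    · simp [h]
    refine (Complex.abs_arg_le_pi_div_two_iff.2 ?_).trans (by linarith [Real.pi_le_four])
    simp

lemma exp_mul_abs_log_le {ω : ℝ} (hω : ω ≠ 0) {c : ℝ} (hc : 0 ≤ c) (hc1 : c ≤ 1) :
    Real.exp (c * |Real.log ‖ω‖|) ≤ ‖ω‖ ^ (-c) + (1 + ‖ω‖) := by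
  have hp : 0 < ‖ω‖ := norm_pos_iff.2 hω
  rcases le_total 0 (Real.log ‖ω‖) with h | h
  · rw [abs_of_nonneg h, mul_comm, ← Real.rpow_def_of_pos hp]
    have h1 : ‖ω‖ ^ c ≤ (1 + ‖ω‖) ^ (1 : ℝ) :=
      (Real.rpow_le_rpow hp.le (by linarith) hc).trans
        (Real.rpow_le_rpow_of_exponent_le (by linarith) hc1)
    rw [Real.rpow_one] at h1
    linarith [Real.rpow_nonneg hp.le (-c)]
  · rw [abs_of_nonpos h, mul_neg, ← neg_mul, mul_comm, ← Real.rpow_def_of_pos hp]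
    linarith

/-- The linear factor is absorbed by raising the exponent from `1/2` to `3/4`. As `3/4 < 1`, the
singularity `|ω| ^ (-3/4)` to which this leads is still integrable. -/
lemma norm_mul_exp_half_le (w : ℂ) :
    ‖w‖ * Real.exp (‖w‖ / 2) ≤ 4 * Real.exp (3 / 4 * ‖w‖) := by
  have h1 := Real.add_one_le_exp (‖w‖ / 4)
  have h2 : Real.exp (3 / 4 * ‖w‖) = Real.exp (‖w‖ / 4) * Real.exp (‖w‖ / 2) := by
    rw [← Real.exp_add]; ring_nf
  rw [h2]
  have := Real.exp_pos (‖w‖ / 2)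
  nlinarith

/-- The quotient `(z ^ δ - 1) / δ` is controlled near `0` and `∞`. -/
lemma norm_I_div_cpow_sub_one_le {ω δ : ℝ} (hω : ω ≠ 0) (h0 : 0 < δ) (h1 : δ ≤ 1 / 2) :
    ‖(Complex.I / ω) ^ (δ : ℂ) - 1‖ ≤ δ * (4 * Real.exp 2 * (‖ω‖ ^ (-(3 / 4) : ℝ) + (1 + ‖ω‖))) := by
  have hz : Complex.I / (ω : ℂ) ≠ 0 := div_ne_zero Complex.I_ne_zero (by exact_mod_cast hω)
  set w := Complex.log (Complex.I / ω) with hw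
  have hb := Complex.norm_exp_sub_sum_le_norm_mul_exp (w * δ) 1
  simp only [Finset.range_one, Finset.sum_singleton, pow_zero, Nat.factorial_zero, Nat.cast_one,
    div_one, pow_one] at hb
  rw [Complex.cpow_def_of_ne_zero hz, ← hw]
  have hn : ‖w * δ‖ = δ * ‖w‖ := by
    rw [norm_mul, Complex.norm_real, Real.norm_of_nonneg h0.le, mul_comm]
  rw [hn] at hb
  calc _ ≤ δ * ‖w‖ * Real.exp (δ * ‖w‖) := hb
    _ ≤ δ * ‖w‖ * Real.exp (‖w‖ / 2) := by
        gcongr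
        nlinarith [norm_nonneg w]
    _ = δ * (‖w‖ * Real.exp (‖w‖ / 2)) := by ring
    _ ≤ δ * (4 * Real.exp (3 / 4 * ‖w‖)) :=
        mul_le_mul_of_nonneg_left (norm_mul_exp_half_le w) h0.le
    _ ≤ δ * (4 * Real.exp (2 + 3 / 4 * |Real.log ‖ω‖|)) := by
        gcongr
        linarith [norm_log_I_div_le ω]
    _ ≤ _ := by
        rw [Real.exp_add, ← mul_assoc 4]
        gcongr
        exact exp_mul_abs_log_le hω (by norm_num) (by norm_num)

lemma polyIntegrable_of_norm_le {h : ℝ → ℂ} (hm : AEStronglyMeasurable h) {C : ℝ}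
    (hC : ∀ ω : ℝ, ω ≠ 0 → ‖h ω‖ ≤ C * (‖ω‖ ^ (-(3 / 4) : ℝ) + (1 + ‖ω‖))) :
    PolyIntegrable h := by
  have hC0 : 0 ≤ C := by
    have := (norm_nonneg _).trans (hC 1 one_ne_zero)
    norm_num at this
    linarith
  have h1 : PolyIntegrable fun ω : ℝ => ((‖ω‖ ^ (-(3 / 4) : ℝ) : ℝ) : ℂ) :=
    polyIntegrable_norm_rpow_neg (E := ℝ) (by norm_num) (by norm_num)
  have h0 : PolyIntegrable fun ω : ℝ => ((‖ω‖ ^ (-(0 : ℝ)) : ℝ) : ℂ) :=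
    polyIntegrable_norm_rpow_neg (E := ℝ) le_rfl (by norm_num)
  have h2 : PolyIntegrable fun ω : ℝ => ((1 + ‖ω‖ : ℝ) : ℂ) * ((‖ω‖ ^ (-(0 : ℝ)) : ℝ) : ℂ) :=
    h0.mul_of_norm_le (C := 1) (M := 1) (by fun_prop) fun x => by
      rw [Complex.norm_real, Real.norm_of_nonneg (by positivity)]; simp
  refine ((h1.add h2).const_mul C).mono hm ?_
  filter_upwards [compl_mem_ae_iff.2 (measure_singleton (0 : ℝ))] with ω hω
  refine (hC ω hω).trans (le_of_eq ?_)
  rw [neg_zero, Real.rpow_zero, Complex.ofReal_one, mul_one, ← Complex.ofReal_add,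
    ← Complex.ofReal_mul, Complex.norm_real]
  exact (Real.norm_of_nonneg (by positivity)).symm

lemma polyIntegrable_log_I_div : PolyIntegrable fun ω : ℝ => Complex.log (Complex.I / ω) := by
  refine polyIntegrable_of_norm_le (C := 4 * Real.exp 2)
    (Measurable.aestronglyMeasurable (by fun_prop)) fun ω hω => ?_
  set w := Complex.log (Complex.I / ω) with hw
  calc ‖w‖ ≤ ‖w‖ * Real.exp (‖w‖ / 2) :=
        le_mul_of_one_le_right (norm_nonneg _) (Real.one_le_exp (by positivity))
    _ ≤ 4 * Real.exp (3 / 4 * ‖w‖) := norm_mul_exp_half_le w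
    _ ≤ 4 * Real.exp (2 + 3 / 4 * |Real.log ‖ω‖|) := by
        gcongr
        linarith [norm_log_I_div_le ω]
    _ ≤ _ := by
        rw [Real.exp_add, ← mul_assoc 4]
        gcongr
        exact exp_mul_abs_log_le hω (by norm_num) (by norm_num)

lemma polyIntegrable_one : PolyIntegrable fun _ : ℝ => (1 : ℂ) :=
  polyIntegrable_of_norm_le (C := 1) aestronglyMeasurable_const fun ω _ => by
    rw [norm_one, one_mul]
    linarith [norm_nonneg ω, Real.rpow_nonneg (norm_nonneg ω) (-(3 / 4))]

/-- For `γ = 1` the definition subtracts a Taylor polynomial of degree one, although degree zero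
suffices. The extra `f' 0` integrates to the `k = 1` correction, and the two cancel. -/
lemma finitePart_one (f : 𝓢(ℝ, ℂ)) :
    finitePart 1 f = (∫ t in Ioc (0 : ℝ) 1, ((t ^ (-1 : ℝ) : ℝ) : ℂ) * (f t - f 0)) +
      ∫ t in Ioi (1 : ℝ), ((t ^ (-1 : ℝ) : ℝ) : ℂ) * f t := by
  have h1 : ∀ t ∈ Ioc (0 : ℝ) 1, ((t ^ (-1 : ℝ) : ℝ) : ℂ) * (f t - (f 0 + deriv f 0 * t)) =
      ((t ^ (-1 : ℝ) : ℝ) : ℂ) * (f t - f 0) - deriv f 0 := by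
    intro t ht
    have : (t : ℂ) ≠ 0 := by exact_mod_cast ht.1.ne'
    rw [Real.rpow_neg_one]
    push_cast
    field_simp
    ring
  obtain ⟨C, hC, hb⟩ := exists_norm_sub_taylorPoly_le f 0
  have hI := integrableOn_rpow_neg_mul (h := fun t => f t - taylorPoly f 0 t) (α := 1) hC (by simp)
    (f.continuous.sub (continuous_taylorPoly f _)).measurable hb
  simp only [taylorPoly, zero_add, Finset.range_one, Finset.sum_singleton, iteratedDeriv_zero,
    Nat.factorial_zero, Nat.cast_one, div_one, pow_zero, mul_one] at hI
  have h2 : (1 : ℝ) + 1 - 1 = 1 := by norm_num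
  simp only [finitePart, Nat.floor_one, Finset.sum_range_succ, Finset.range_zero,
    Finset.sum_empty, zero_add, iteratedDeriv_zero, Nat.factorial_zero, Nat.cast_one, div_one,
    pow_zero, mul_one, iteratedDeriv_one, Nat.factorial_one, pow_one, Nat.cast_zero, if_true]
  rw [setIntegral_congr_fun measurableSet_Ioc h1, integral_sub hI (integrable_const _)]
  norm_num
  ring

/-- As a function of the exponent, the finite part has a simple pole at `γ = 1`; the finite part at
`1` is its constant term. -/
lemma tendsto_finitePart_one (f : 𝓢(ℝ, ℂ)) :
    Tendsto (fun δ : ℝ => finitePart (1 - δ) f - f 0 / δ) (𝓝[>] 0) (𝓝 (finitePart 1 f)) := by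
  obtain ⟨C, hC, hb⟩ := exists_norm_sub_taylorPoly_le f 0
  simp only [taylorPoly, zero_add, Finset.range_one, Finset.sum_singleton, iteratedDeriv_zero,
    Nat.factorial_zero, Nat.cast_one, div_one, pow_zero, mul_one] at hb
  have hlim : ∀ t : ℝ, 0 < t → ∀ z : ℂ, Tendsto (fun δ : ℝ => ((t ^ (-(1 - δ)) : ℝ) : ℂ) * z)
      (𝓝[>] 0) (𝓝 (((t ^ (-1 : ℝ) : ℝ) : ℂ) * z)) := by
    intro t ht z
    have : ContinuousAt (fun δ : ℝ => ((t ^ (-(1 - δ)) : ℝ) : ℂ) * z) 0 := by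
      refine ContinuousAt.mul ?_ continuousAt_const
      refine Complex.continuous_ofReal.continuousAt.comp ?_
      exact ContinuousAt.rpow continuousAt_const (by fun_prop) (Or.inl ht.ne')
    have h := this.tendsto.mono_left (nhdsWithin_le_nhds (s := Ioi 0))
    simpa using h
  have hsmall : ∀ᶠ δ : ℝ in 𝓝[>] 0, 0 < δ ∧ δ < 1 := Ioo_mem_nhdsGT zero_lt_one
  have hA : Tendsto (fun δ : ℝ => ∫ t in Ioc (0 : ℝ) 1, ((t ^ (-(1 - δ)) : ℝ) : ℂ) * (f t - f 0))
      (𝓝[>] 0) (𝓝 (∫ t in Ioc (0 : ℝ) 1, ((t ^ (-1 : ℝ) : ℝ) : ℂ) * (f t - f 0))) := by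
    refine tendsto_integral_filter_of_dominated_convergence (fun _ => C) ?_ ?_
      (integrable_const _) ?_
    · refine Eventually.of_forall fun δ => Measurable.aestronglyMeasurable ?_
      have := f.continuous.measurable
      fun_prop
    · filter_upwards [hsmall] with δ hδ
      filter_upwards [ae_restrict_mem measurableSet_Ioc] with t ht
      exact norm_rpow_neg_mul_le (h := fun t => f t - f 0) (n := 1) hC
        (by push_cast; linarith [hδ.1]) ht (hb t ⟨ht.1.le, ht.2⟩)
    · filter_upwards [ae_restrict_mem measurableSet_Ioc] with t ht
      exact hlim t ht.1 _
  have hB : Tendsto (fun δ : ℝ => ∫ t in Ioi (1 : ℝ), ((t ^ (-(1 - δ)) : ℝ) : ℂ) * f t)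
      (𝓝[>] 0) (𝓝 (∫ t in Ioi (1 : ℝ), ((t ^ (-1 : ℝ) : ℝ) : ℂ) * f t)) := by
    refine tendsto_integral_filter_of_dominated_convergence (fun t => ‖f t‖) ?_ ?_
      f.integrable.norm.integrableOn ?_
    · refine Eventually.of_forall fun δ => Measurable.aestronglyMeasurable ?_
      have := f.continuous.measurable
      fun_prop
    · filter_upwards [hsmall] with δ hδ
      filter_upwards [ae_restrict_mem measurableSet_Ioi] with t ht
      have ht : 1 < t := ht
      rw [norm_mul, Complex.norm_real, Real.norm_of_nonneg (Real.rpow_nonneg (by linarith) _)]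
      exact mul_le_of_le_one_left (norm_nonneg _)
        (Real.rpow_le_one_of_one_le_of_nonpos ht.le (by linarith [hδ.2]))
    · filter_upwards [ae_restrict_mem measurableSet_Ioi] with t ht
      exact hlim t (lt_trans zero_lt_one ht) _
  rw [finitePart_one]
  refine (hA.add hB).congr' ?_
  filter_upwards [hsmall] with δ hδ
  rw [finitePart_of_lt_one f (by linarith [hδ.1])]
  push_cast
  ring

/-- The limit `δ → 0` of the symbol at exponent `1 - δ` with its pole removed: `Γ(δ) (i/ω)^δ - 1/δ`
tends to `log(i/ω) + Γ'(1)`. -/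
theorem isFinitePartSymbol_one :
    IsFinitePartSymbol 1 (fun ω => Complex.log (Complex.I / ω) + (deriv Real.Gamma 1 : ℝ)) := by
  have hP : PolyIntegrable
      (fun ω : ℝ => Complex.log (Complex.I / ω) + ((deriv Real.Gamma 1 : ℝ) : ℂ)) := by
    simpa using polyIntegrable_log_I_div.add
      (polyIntegrable_one.const_mul ((deriv Real.Gamma 1 : ℝ) : ℂ))
  refine ⟨hP, fun φ => ?_⟩
  have hΓ : HasDerivAt (fun δ : ℝ => Real.Gamma (1 + δ)) (deriv Real.Gamma 1) 0 := by
    have h1 : HasDerivAt Real.Gamma (deriv Real.Gamma 1) (1 + 0) := by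
      rw [add_zero]
      refine (Real.differentiableAt_Gamma fun m => ?_).hasDerivAt
      have : (0 : ℝ) ≤ m := Nat.cast_nonneg m
      linarith
    simpa [Function.comp_def] using h1.comp (0 : ℝ) ((hasDerivAt_id (0 : ℝ)).const_add 1)
  have hsmall : ∀ᶠ δ : ℝ in 𝓝[>] 0, 0 < δ ∧ δ < 1 / 2 := Ioo_mem_nhdsGT (by norm_num)
  have hΓ2 : ∀ᶠ δ : ℝ in 𝓝[>] 0, |Real.Gamma (1 + δ)| ≤ 2 := by
    have h := hΓ.continuousAt.abs.tendsto.mono_left (nhdsWithin_le_nhds (s := Ioi 0))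
    refine (h.eventually_lt_const (u := 2) ?_).mono fun _ h => h.le
    simp
  have hslope : Tendsto (fun δ : ℝ => (Real.Gamma (1 + δ) - 1) / δ) (𝓝[>] 0)
      (𝓝 (deriv Real.Gamma 1)) := by
    have h := hΓ.tendsto_slope_zero_right
    simpa [div_eq_inv_mul] using h
  have hslope2 : ∀ᶠ δ : ℝ in 𝓝[>] 0,
      |(Real.Gamma (1 + δ) - 1) / δ| ≤ |deriv Real.Gamma 1| + 1 :=
    (hslope.abs.eventually_lt_const (lt_add_one _)).mono fun _ h => h.le
  -- Writing `Γ(δ) = Γ(1 + δ) / δ` splits the expression into difference quotients at `δ = 0` of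
  -- `(i/ω)^δ` and of `Γ(1 + δ)`.
  have hu : ∀ δ : ℝ, 0 < δ → ∀ ω : ℝ, (Real.Gamma δ : ℂ) * (Complex.I / ω) ^ (δ : ℂ) - 1 / δ
      = (Real.Gamma (1 + δ) : ℂ) * (((Complex.I / ω) ^ (δ : ℂ) - 1) / δ) +
        (((Real.Gamma (1 + δ) - 1) / δ : ℝ) : ℂ) := by
    intro δ hδ ω
    have hδ' : (δ : ℂ) ≠ 0 := by exact_mod_cast hδ.ne'
    rw [add_comm 1 δ, Real.Gamma_add_one hδ.ne']
    push_cast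
    field_simp
    ring
  have hL := tendsto_finitePart_one (waveTransform φ)
  have hR : Tendsto (fun δ : ℝ => ∫ ω : ℝ, φ ω *
      ((Real.Gamma δ : ℂ) * (Complex.I / ω) ^ (δ : ℂ) - 1 / δ)) (𝓝[>] 0)
      (𝓝 (∫ ω : ℝ, φ ω * (Complex.log (Complex.I / ω) + (deriv Real.Gamma 1 : ℝ)))) := by
    set c := |deriv Real.Gamma 1| + 1 with hc
    have hc0 : 0 < c := by positivity
    set C := 2 * (4 * Real.exp 2) + c with hCdef
    have hbP : PolyIntegrable fun ω : ℝ => ((C * (‖ω‖ ^ (-(3 / 4) : ℝ) + (1 + ‖ω‖)) : ℝ) : ℂ) := by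
      refine polyIntegrable_of_norm_le (C := C) (Measurable.aestronglyMeasurable (by fun_prop))
        fun ω _ => ?_
      rw [Complex.norm_real, Real.norm_of_nonneg (by positivity)]
    refine tendsto_integral_filter_of_dominated_convergence
      (fun ω => ‖φ ω * ((C * (‖ω‖ ^ (-(3 / 4) : ℝ) + (1 + ‖ω‖)) : ℝ) : ℂ)‖) ?_ ?_
      (hbP.integrable_mul φ).norm ?_
    · refine Eventually.of_forall fun δ => Measurable.aestronglyMeasurable ?_
      have := φ.continuous.measurable
      fun_prop
    · filter_upwards [hsmall, hΓ2, hslope2] with δ hδ h2 h3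
      filter_upwards [compl_mem_ae_iff.2 (measure_singleton (0 : ℝ))] with ω hω
      have hω : ω ≠ 0 := hω
      rw [norm_mul, norm_mul]
      refine mul_le_mul_of_nonneg_left ?_ (norm_nonneg _)
      rw [hu δ hδ.1, Complex.norm_real (C * _), Real.norm_of_nonneg (by positivity)]
      refine (norm_add_le _ _).trans ?_
      rw [norm_mul, norm_div, Complex.norm_real, Complex.norm_real, Complex.norm_real,
        Real.norm_eq_abs, Real.norm_eq_abs, Real.norm_eq_abs, abs_of_pos hδ.1]
      have h4 := norm_I_div_cpow_sub_one_le hω hδ.1 hδ.2.le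
      have h5 : ‖(Complex.I / ω) ^ (δ : ℂ) - 1‖ / δ ≤
          4 * Real.exp 2 * (‖ω‖ ^ (-(3 / 4) : ℝ) + (1 + ‖ω‖)) := by
        rw [div_le_iff₀ hδ.1]; linarith
      have h6 : 1 ≤ ‖ω‖ ^ (-(3 / 4) : ℝ) + (1 + ‖ω‖) := by
        linarith [norm_nonneg ω, Real.rpow_nonneg (norm_nonneg ω) (-(3 / 4))]
      calc _ ≤ 2 * (4 * Real.exp 2 * (‖ω‖ ^ (-(3 / 4) : ℝ) + (1 + ‖ω‖))) + c * 1 := by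
            rw [mul_one]
            exact add_le_add (mul_le_mul h2 h5 (div_nonneg (norm_nonneg _) hδ.1.le)
              (by norm_num)) h3
        _ ≤ 2 * (4 * Real.exp 2 * (‖ω‖ ^ (-(3 / 4) : ℝ) + (1 + ‖ω‖))) +
            c * (‖ω‖ ^ (-(3 / 4) : ℝ) + (1 + ‖ω‖)) := by gcongr
        _ = _ := by rw [hCdef]; ring
    · filter_upwards [compl_mem_ae_iff.2 (measure_singleton (0 : ℝ))] with ω hω
      have hω : (ω : ℂ) ≠ 0 := by exact_mod_cast hω
      have hz : Complex.I / (ω : ℂ) ≠ 0 := div_ne_zero Complex.I_ne_zero hω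
      refine Tendsto.const_mul _ ?_
      have h1 : HasDerivAt (fun δ : ℝ => (Complex.I / ω) ^ (δ : ℂ))
          (Complex.log (Complex.I / ω)) 0 := by
        have h := ((hasDerivAt_id ((0 : ℝ) : ℂ)).const_cpow
          (c := Complex.I / ω) (Or.inl hz)).comp_ofReal
        simpa using h
      have h2 := h1.tendsto_slope_zero_right
      have h3 : Tendsto (fun δ : ℝ => ((Complex.I / ω) ^ (δ : ℂ) - 1) / (δ : ℂ)) (𝓝[>] 0)
          (𝓝 (Complex.log (Complex.I / ω))) := by
        simpa [div_eq_inv_mul] using h2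
      have h4 : Tendsto (fun δ : ℝ => ((Real.Gamma (1 + δ) : ℝ) : ℂ)) (𝓝[>] 0) (𝓝 1) := by
        have h := (Complex.continuous_ofReal.tendsto _).comp
          (hΓ.continuousAt.tendsto.mono_left (nhdsWithin_le_nhds (s := Ioi 0)))
        simpa [Function.comp_def] using h
      have h5 : Tendsto (fun δ : ℝ => (((Real.Gamma (1 + δ) - 1) / δ : ℝ) : ℂ)) (𝓝[>] 0)
          (𝓝 ((deriv Real.Gamma 1 : ℝ) : ℂ)) := (Complex.continuous_ofReal.tendsto _).comp hslope
      have h6 := (h4.mul h3).add h5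
      rw [one_mul] at h6
      refine h6.congr' ?_
      filter_upwards [self_mem_nhdsWithin] with δ hδ
      exact (hu δ hδ ω).symm
  refine tendsto_nhds_unique hL (hR.congr' ?_)
  filter_upwards [hsmall] with δ hδ
  obtain ⟨hP1, h1⟩ := isFinitePartSymbol_of_lt_one (γ := 1 - δ) (by linarith [hδ.2])
    (by linarith [hδ.1])
  -- The pole term is also an integral against `φ`, because the value of the wave transform at `0`
  -- is `∫ φ`.
  rw [h1 φ, waveTransform_apply, ← integral_div, ← integral_sub (hP1.integrable_mul φ) ?_]
  · refine integral_congr_ae (Eventually.of_forall fun ω => ?_)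
    simp only [Complex.ofReal_zero, mul_zero, Complex.exp_zero, mul_one, sub_sub_cancel]
    ring
  · exact (integrable_mul_cexp φ 0).div_const _

/-! ### Raising the exponent: symbols of all finite parts -/

lemma PolyIntegrable.mulFreq {s : ℝ → ℂ} (hs : PolyIntegrable s) :
    PolyIntegrable fun ω : ℝ => Complex.I * ω * s ω :=
  hs.mul_of_norm_le (C := 1) (M := 1) (by fun_prop) fun x => by simp

lemma polyIntegrable_I_mul_pow (m : ℕ) : PolyIntegrable fun ω : ℝ => (Complex.I * ω) ^ m := by
  have h := polyIntegrable_one.mul_of_norm_le (g := fun ω : ℝ => (Complex.I * ω) ^ m) (C := 1)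
    (M := m) (by fun_prop) fun x => by
      simp only [norm_pow, norm_mul, Complex.norm_I, one_mul, Complex.norm_real]
      gcongr
      linarith
  simpa using h

/-- The recursion for finite parts on the frequency side, where a derivative is a factor `iω`. The
anomaly would need `k + 1 = γ + 1`, which `hn` excludes. -/
lemma IsFinitePartSymbol.succ {γ : ℝ} {s : ℝ → ℂ} (hs : IsFinitePartSymbol γ s) (hγ : 0 < γ)
    (hn : ∀ k : ℕ, (k : ℝ) ≠ γ) :
    IsFinitePartSymbol (γ + 1) fun ω => (γ : ℂ)⁻¹ * (Complex.I * ω * s ω) := by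
  refine ⟨hs.1.mulFreq.const_mul _, fun φ => ?_⟩
  rw [finitePart_eq_deriv _ (by linarith), add_sub_cancel_right, deriv_waveTransform, hs.2,
    Finset.sum_eq_zero, add_zero, ← integral_const_mul]
  · refine integral_congr_ae (Eventually.of_forall fun ω => ?_)
    simp only [mulFreq_apply]
    push_cast
    rw [add_sub_cancel_right]
    ring
  · intro k _
    rw [if_neg]
    intro h
    exact hn k (by linarith)

/-- Now the anomalous term is present, at `k = m + 1`; a derivative at `0` of the wave transform is
an integral against `(iω)^k`, so it adds a monomial to the symbol. -/
lemma IsFinitePartSymbol.succ_natCast {m : ℕ} {s : ℝ → ℂ}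
    (hs : IsFinitePartSymbol ((m : ℝ) + 1) s) :
    IsFinitePartSymbol ((m : ℝ) + 1 + 1) fun ω => (((m : ℝ) + 1 : ℝ) : ℂ)⁻¹ *
      (Complex.I * ω * s ω + ((m + 1).factorial : ℂ)⁻¹ * (Complex.I * ω) ^ (m + 1)) := by
  have hP1 := hs.1.mulFreq
  have hP2 := (polyIntegrable_I_mul_pow (m + 1)).const_mul ((m + 1).factorial : ℂ)⁻¹
  refine ⟨(hP1.add hP2).const_mul _, fun φ => ?_⟩
  have hsum : ∑ k ∈ Finset.range (⌊(m : ℝ) + 1 + 1⌋₊ + 1), (if (k : ℝ) + 1 = (m : ℝ) + 1 + 1 then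
        iteratedDeriv k (waveTransform φ) 0 / (k.factorial : ℂ) else 0)
      = iteratedDeriv (m + 1) (waveTransform φ) 0 / ((m + 1).factorial : ℂ) := by
    rw [Finset.sum_eq_single (m + 1)]
    · simp
    · intro k _ hk
      rw [if_neg]
      intro h
      apply hk
      have : (k : ℝ) = (m + 1 : ℕ) := by push_cast; linarith
      exact_mod_cast this
    · intro h
      exfalso
      apply h
      rw [Finset.mem_range, show (m : ℝ) + 1 + 1 = ((m + 2 : ℕ) : ℝ) by push_cast; ring,
        Nat.floor_natCast]
      omega
  have hm : (0 : ℝ) ≤ m := Nat.cast_nonneg m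
  rw [finitePart_eq_deriv _ (by linarith), hsum, add_sub_cancel_right, deriv_waveTransform, hs.2,
    iteratedDeriv_waveTransform_zero]
  have e1 : ∀ ω : ℝ, φ ω * ((((m : ℝ) + 1 : ℝ) : ℂ)⁻¹ *
      (Complex.I * ω * s ω + ((m + 1).factorial : ℂ)⁻¹ * (Complex.I * ω) ^ (m + 1)))
      = (((m : ℝ) + 1 : ℝ) : ℂ)⁻¹ * (φ ω * (Complex.I * ω * s ω) +
        φ ω * (((m + 1).factorial : ℂ)⁻¹ * (Complex.I * ω) ^ (m + 1))) := fun ω => by ring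
  simp only [e1]
  rw [integral_const_mul, integral_add (hP1.integrable_mul φ) (hP2.integrable_mul φ)]
  push_cast
  rw [add_sub_cancel_right]
  congr 2
  · refine integral_congr_ae (Eventually.of_forall fun ω => ?_)
    simp only [mulFreq_apply]
    ring
  · rw [← integral_div]
    refine integral_congr_ae (Eventually.of_forall fun ω => ?_)
    simp only
    ring

/-- Only that the factor `r` is real and nonzero matters later, for locating the symbol off the real
axis. -/
lemma exists_isFinitePartSymbol_of_fract {g : ℝ} (h0 : 0 < g) (h1 : g < 1) (m : ℕ) :
    ∃ r : ℝ, r ≠ 0 ∧ IsFinitePartSymbol (g + m)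
      fun ω => (r : ℂ) * ((Complex.I * ω) ^ m * (Complex.I / ω) ^ ((1 - g : ℝ) : ℂ)) := by
  induction m with
  | zero =>
    refine ⟨Real.Gamma (1 - g), (Real.Gamma_pos_of_pos (by linarith)).ne', ?_⟩
    simpa using isFinitePartSymbol_of_lt_one h0 h1
  | succ m ih =>
    obtain ⟨r, hr, h⟩ := ih
    have hm : (0 : ℝ) ≤ m := Nat.cast_nonneg m
    have hpos : 0 < g + m := by linarith
    have h' := h.succ hpos fun k hk => by
      have h2 : (m : ℝ) < k := by linarith
      have h3 : (k : ℝ) < m + 1 := by linarith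
      have h2' : m < k := by exact_mod_cast h2
      have h3' : k < m + 1 := by exact_mod_cast h3
      omega
    refine ⟨(g + m)⁻¹ * r, mul_ne_zero (inv_ne_zero hpos.ne') hr, ?_⟩
    convert h' using 1
    · push_cast; ring
    · ext ω; push_cast; ring

/-- The anomalies accumulate in the constant `c`. Since `c` is real, it does not disturb the
imaginary part of the logarithm. -/
lemma exists_isFinitePartSymbol_natCast (m : ℕ) :
    ∃ r c : ℝ, r ≠ 0 ∧ IsFinitePartSymbol ((m : ℝ) + 1)
      fun ω => (Complex.I * ω) ^ m * ((r : ℂ) * Complex.log (Complex.I / ω) + c) := by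
  induction m with
  | zero =>
    refine ⟨1, deriv Real.Gamma 1, one_ne_zero, ?_⟩
    simpa using isFinitePartSymbol_one
  | succ m ih =>
    obtain ⟨r, c, hr, h⟩ := ih
    have hpos : (m : ℝ) + 1 ≠ 0 := by positivity
    refine ⟨((m : ℝ) + 1)⁻¹ * r, ((m : ℝ) + 1)⁻¹ * (c + ((m + 1).factorial : ℝ)⁻¹),
      mul_ne_zero (inv_ne_zero hpos) hr, ?_⟩
    convert h.succ_natCast using 1
    · push_cast; ring
    · ext ω; push_cast; ring

/-! ### The loss symbol: existence, non-reality and uniqueness -/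

lemma arg_I_div {ω : ℝ} (hω : ω ≠ 0) :
    (Complex.I / ω).arg = Real.pi / 2 ∨ (Complex.I / ω).arg = -(Real.pi / 2) := by
  rcases lt_or_gt_of_ne hω with h | h
  · right
    have : Complex.I / (ω : ℂ) = ((-ω)⁻¹ : ℝ) * -Complex.I := by
      push_cast
      rw [inv_neg]
      ring
    rw [this, Complex.arg_real_mul _ (inv_pos.2 (by linarith)), Complex.arg_neg_I]
  · left
    have : Complex.I / (ω : ℂ) = (ω⁻¹ : ℝ) * Complex.I := by
      push_cast
      ring
    rw [this, Complex.arg_real_mul _ (inv_pos.2 h), Complex.arg_I]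

/-- The argument is `±πα/2`, strictly inside a quadrant. Both parts are needed because the factor
`(iω)^m` is real or imaginary according to the parity of `m`. -/
lemma I_div_cpow_re_im_ne_zero {ω α : ℝ} (hω : ω ≠ 0) (h0 : 0 < α) (h1 : α < 1) :
    ((Complex.I / ω) ^ (α : ℂ)).re ≠ 0 ∧ ((Complex.I / ω) ^ (α : ℂ)).im ≠ 0 := by
  have hz : Complex.I / (ω : ℂ) ≠ 0 := div_ne_zero Complex.I_ne_zero (by exact_mod_cast hω)
  rw [Complex.cpow_def_of_ne_zero hz, Complex.exp_re, Complex.exp_im, Complex.im_mul_ofReal,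
    Complex.log_im]
  have hp := Real.pi_pos
  have hc : 0 < Real.cos (Real.pi / 2 * α) :=
    Real.cos_pos_of_mem_Ioo ⟨by nlinarith, by nlinarith⟩
  have hs : 0 < Real.sin (Real.pi / 2 * α) := Real.sin_pos_of_pos_of_lt_pi (by positivity)
    (by nlinarith)
  rcases arg_I_div hω with h | h <;> rw [h]
  · exact ⟨(mul_pos (Real.exp_pos _) hc).ne', (mul_pos (Real.exp_pos _) hs).ne'⟩
  · rw [neg_mul, Real.cos_neg, Real.sin_neg]
    exact ⟨(mul_pos (Real.exp_pos _) hc).ne',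
      mul_ne_zero (Real.exp_pos _).ne' (neg_ne_zero.2 hs.ne')⟩

lemma I_mul_pow_eq {ω : ℝ} (hω : ω ≠ 0) (m : ℕ) :
    ∃ q : ℝ, q ≠ 0 ∧ ((Even m ∧ (Complex.I * ω) ^ m = q) ∨
      (Odd m ∧ (Complex.I * ω) ^ m = q * Complex.I)) := by
  rcases Nat.even_or_odd' m with ⟨k, rfl | rfl⟩
  · refine ⟨(-1) ^ k * ω ^ (2 * k), by positivity, Or.inl ⟨by simp, ?_⟩⟩
    rw [mul_pow, pow_mul, Complex.I_sq]
    push_cast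
    ring
  · refine ⟨(-1) ^ k * ω ^ (2 * k + 1), by positivity, Or.inr ⟨by simp, ?_⟩⟩
    rw [mul_pow, pow_succ Complex.I, pow_mul, Complex.I_sq]
    push_cast
    ring

lemma contDiffOn_log_I_div : ContDiffOn ℝ (⊤ : ℕ∞) (fun ω : ℝ => Complex.log (Complex.I / ω)) {0}ᶜ := by
  intro ω hω
  have hω : ω ≠ 0 := hω
  have h1 : ContDiffAt ℝ (⊤ : ℕ∞) (fun ω : ℝ => Complex.I / (ω : ℂ)) ω := by
    have h0 : ContDiffAt ℝ (⊤ : ℕ∞) (fun ω : ℝ => (ω : ℂ)) ω :=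
      Complex.ofRealCLM.contDiff.contDiffAt
    simp only [div_eq_mul_inv]
    exact contDiffAt_const.mul (h0.inv (by simpa using hω))
  have h2 : ContDiffAt ℝ (⊤ : ℕ∞) Complex.log (Complex.I / ω) :=
    (Complex.contDiffAt_log (n := (⊤ : ℕ∞)) (I_div_mem_slitPlane hω)).restrict_scalars ℝ
  exact (h2.comp ω h1).contDiffWithinAt

lemma contDiffOn_I_div_cpow (α : ℂ) :
    ContDiffOn ℝ (⊤ : ℕ∞) (fun ω : ℝ => (Complex.I / ω) ^ α) {0}ᶜ := by
  have h : ContDiffOn ℝ (⊤ : ℕ∞) (fun ω : ℝ => Complex.exp (Complex.log (Complex.I / ω) * α)) {0}ᶜ :=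
    (contDiffOn_log_I_div.mul contDiffOn_const).cexp
  refine h.congr fun ω hω => ?_
  have hω : (ω : ℂ) ≠ 0 := by exact_mod_cast hω
  exact Complex.cpow_def_of_ne_zero (div_ne_zero Complex.I_ne_zero hω) _

lemma contDiff_I_mul_pow (m : ℕ) : ContDiff ℝ (⊤ : ℕ∞) (fun ω : ℝ => (Complex.I * ω) ^ m) :=
  (contDiff_const.mul Complex.ofRealCLM.contDiff).pow m

/-- A loss symbol that is smooth and not real away from zero frequency. -/
def IsRegularLossSymbol (γ : ℝ) (a : ℝ → ℂ) : Prop :=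
  IsLossSymbol γ a ∧ ContDiffOn ℝ (⊤ : ℕ∞) a {0}ᶜ ∧ (∀ ω, ω ≠ 0 → (a ω).im ≠ 0) ∧ PolyIntegrable a

lemma isRegularLossSymbol_of_forall {γ : ℝ} {a : ℝ → ℂ} (hP : PolyIntegrable a)
    (hs : ContDiffOn ℝ (⊤ : ℕ∞) a {0}ᶜ) (him : ∀ ω, ω ≠ 0 → (a ω).im ≠ 0)
    (h : ∀ φ : 𝓢(ℝ, ℂ), lossKernel γ (waveTransform φ) = ∫ ω, φ ω * a ω) :
    IsRegularLossSymbol γ a := by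
  refine ⟨⟨hs.continuousOn, fun φ => ⟨?_, ?_⟩⟩, hs, him, hP⟩
  · simpa only [mul_comm] using hP.integrable_mul φ
  · have e : (fun t : ℝ => ∫ ω, φ ω * Complex.exp (Complex.I * ω * t)) = waveTransform φ :=
      funext fun t => (waveTransform_apply φ t).symm
    rw [e, h]
    simp only [mul_comm]

lemma isRegularLossSymbol_of_isFinitePartSymbol {γ k : ℝ} {s : ℝ → ℂ}
    (hs : IsFinitePartSymbol γ s) (hk : k ≠ 0)
    (hsm : ContDiffOn ℝ (⊤ : ℕ∞) s {0}ᶜ) (him : ∀ ω, ω ≠ 0 → (s ω).im ≠ 0)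
    (h : ∀ φ, lossKernel γ φ = k * finitePart γ φ) :
    IsRegularLossSymbol γ (fun ω => (k : ℂ) * s ω) := by
  refine isRegularLossSymbol_of_forall (hs.1.const_mul _) (contDiffOn_const.mul hsm)
    (fun ω hω => ?_) fun φ => ?_
  · rw [Complex.im_ofReal_mul]
    exact mul_ne_zero hk (him ω hω)
  · rw [h, hs.2, ← integral_const_mul]
    refine integral_congr_ae (Eventually.of_forall fun ω => ?_)
    simp only
    ring

/-- Three cases. For even `γ = m + 1` the symbol is a real multiple of `(iω)^m` with `m` odd. For
odd `γ`, `(iω)^m` is real and multiplies a logarithm with imaginary part `±π/2`. Otherwise `(iω)^n`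
multiplies a power of `i/ω` lying on neither axis. -/
theorem exists_isRegularLossSymbol {γ : ℝ} (hγ : 0 < γ) : ∃ a, IsRegularLossSymbol γ a := by
  by_cases hn : γ = (⌊γ⌋₊ : ℝ)
  · obtain ⟨n, hn'⟩ : ∃ n, ⌊γ⌋₊ = n := ⟨_, rfl⟩
    rw [hn'] at hn
    have hn0 : 0 < n := by rw [hn] at hγ; exact_mod_cast hγ
    obtain ⟨m, rfl⟩ : ∃ m, n = m + 1 := ⟨n - 1, by omega⟩
    by_cases he : Even (m + 1)
    · have hm : Odd m := by
        rcases Nat.even_or_odd m with h | h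
        · exact absurd he (by simpa [Nat.even_add_one] using h)
        · exact h
      -- The factor `(-1) ^ m` comes from moving the `m` derivatives off the delta distribution.
      refine ⟨fun ω => ((-((-1) ^ ((m + 1) / 2) * (-1) ^ m) : ℝ) : ℂ) * (Complex.I * ω) ^ m,
        isRegularLossSymbol_of_forall ((polyIntegrable_I_mul_pow m).const_mul _)
          (contDiff_const.mul (contDiff_I_mul_pow m)).contDiffOn (fun ω hω => ?_) fun φ => ?_⟩
      · obtain ⟨q, hq, ⟨h1, _⟩ | ⟨_, h2⟩⟩ := I_mul_pow_eq hω m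
        · exact absurd hm (by simpa using h1)
        · rw [h2, Complex.im_ofReal_mul, Complex.im_ofReal_mul, Complex.I_im, mul_one]
          refine mul_ne_zero (neg_ne_zero.2 (by positivity)) hq
      · rw [lossKernel, hn', if_pos hn, if_pos he, Nat.add_sub_cancel,
          iteratedDeriv_waveTransform_zero, ← mul_assoc, ← integral_const_mul]
        refine integral_congr_ae (Eventually.of_forall fun ω => ?_)
        simp only
        push_cast
        ring
    · have hm : Even m := by
        rcases Nat.even_or_odd m with h | h
        · exact h
        · exact absurd h.add_one he
      obtain ⟨r, c, hr, hs⟩ := exists_isFinitePartSymbol_natCast m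
      have hγm : γ = (m : ℝ) + 1 := by rw [hn]; push_cast; ring
      rw [← hγm] at hs
      refine ⟨_, isRegularLossSymbol_of_isFinitePartSymbol
        (k := 2 / Real.pi * (m.factorial : ℝ) * (-1) ^ ((m + 1 + 1) / 2)) hs ?_ ?_ ?_ ?_⟩
      · have := Real.pi_pos
        have : (0 : ℝ) < m.factorial := by exact_mod_cast m.factorial_pos
        positivity
      · exact (contDiff_I_mul_pow m).contDiffOn.mul
          ((contDiffOn_const.mul contDiffOn_log_I_div).add contDiffOn_const)
      · intro ω hω
        obtain ⟨q, hq, ⟨_, h1⟩ | ⟨h2, _⟩⟩ := I_mul_pow_eq hω m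
        · rw [h1, Complex.im_ofReal_mul, Complex.add_im, Complex.im_ofReal_mul, Complex.ofReal_im,
            add_zero, Complex.log_im]
          refine mul_ne_zero hq (mul_ne_zero hr ?_)
          have := Real.pi_pos
          rcases arg_I_div hω with h | h <;> rw [h] <;> linarith
        · exact absurd hm (by simpa using h2)
      · intro φ
        rw [lossKernel, hn', if_pos hn, if_neg he, Nat.add_sub_cancel]
        push_cast
        ring
  · set n := ⌊γ⌋₊ with hn'
    set g := γ - n with hg
    have hg0 : 0 < g := sub_pos.2 (lt_of_le_of_ne (Nat.floor_le hγ.le) (Ne.symm hn))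
    have hg1 : g < 1 := by
      have := Nat.lt_floor_add_one γ
      rw [hg, hn']
      linarith
    obtain ⟨r, hr, hs⟩ := exists_isFinitePartSymbol_of_fract hg0 hg1 n
    rw [show g + n = γ by rw [hg]; ring] at hs
    refine ⟨_, isRegularLossSymbol_of_isFinitePartSymbol
      (k := -(2 / Real.pi) * (Real.Gamma γ * Real.sin (γ * Real.pi / 2))) hs ?_ ?_ ?_ ?_⟩
    · refine mul_ne_zero (neg_ne_zero.2 (div_pos two_pos Real.pi_pos).ne')
        (mul_ne_zero (Real.Gamma_pos_of_pos hγ).ne' fun h => hn ?_)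
      -- A zero of `sin(γπ/2)` would make `γ` an even integer, hence equal to its floor.
      obtain ⟨j, hj⟩ := Real.sin_eq_zero_iff.1 h
      have hj2 : γ = 2 * j := by
        have := Real.pi_pos
        field_simp at hj
        linarith
      have hj0 : 0 ≤ j := by
        have : (0 : ℝ) ≤ j := by linarith
        exact_mod_cast this
      lift j to ℕ using hj0
      have hj3 : γ = ((2 * j : ℕ) : ℝ) := by rw [hj2]; push_cast; ring
      rw [hn', hj3, Nat.floor_natCast]
    · exact contDiffOn_const.mul ((contDiff_I_mul_pow n).contDiffOn.mul (contDiffOn_I_div_cpow _))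
    · intro ω hω
      obtain ⟨h1, h2⟩ := I_div_cpow_re_im_ne_zero (α := 1 - g) hω (by linarith) (by linarith)
      rw [Complex.im_ofReal_mul]
      obtain ⟨q, hq, ⟨_, h3⟩ | ⟨_, h3⟩⟩ := I_mul_pow_eq hω n
      · rw [h3, Complex.im_ofReal_mul]
        exact mul_ne_zero hr (mul_ne_zero hq h2)
      · rw [h3, mul_assoc, Complex.im_ofReal_mul, Complex.I_mul_im]
        exact mul_ne_zero hr (mul_ne_zero hq h1)
    · intro φ
      rw [lossKernel, if_neg hn]
      push_cast
      ring

lemma integral_mul_eq_zero_imp {f : ℝ → ℂ} {U : Set ℝ} (hU : IsOpen U)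
    (hf : LocallyIntegrableOn f U) (h : ∀ φ : 𝓢(ℝ, ℂ), ∫ ω, φ ω * f ω = 0) :
    ∀ᵐ ω, ω ∈ U → f ω = 0 := by
  refine hU.ae_eq_zero_of_integral_contDiff_smul_eq_zero hf fun g hg hgc _ => ?_
  have hg1 : ContDiff ℝ (⊤ : ℕ∞) (fun ω => (g ω : ℂ)) := Complex.ofRealCLM.contDiff.comp hg
  have hg2 : HasCompactSupport (fun ω => (g ω : ℂ)) :=
    hgc.comp_left (g := fun x : ℝ => (x : ℂ)) Complex.ofReal_zero
  have := h (hg2.toSchwartzMap hg1)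
  simpa using this

/-- Two loss symbols of the same exponent agree at nonzero frequencies. -/
theorem IsLossSymbol.eq_of_ne_zero {γ : ℝ} {a b : ℝ → ℂ} (ha : IsLossSymbol γ a)
    (hb : IsLossSymbol γ b) {ω : ℝ} (hω : ω ≠ 0) : a ω = b ω := by
  have hU : IsOpen ({0}ᶜ : Set ℝ) := isOpen_compl_singleton
  have h0 : ∀ᵐ ω : ℝ, ω ∈ ({0}ᶜ : Set ℝ) → a ω - b ω = 0 := by
    refine integral_mul_eq_zero_imp hU
      ((ha.1.sub hb.1).locallyIntegrableOn hU.measurableSet) fun φ => ?_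
    obtain ⟨h1, h2⟩ := ha.2 φ
    obtain ⟨h3, h4⟩ := hb.2 φ
    have e : (fun ω => φ ω * (a ω - b ω)) = fun ω => a ω * φ ω - b ω * φ ω := by
      ext ω; ring
    rw [e, integral_sub h1 h3, ← h2, ← h4, sub_self]
  have h1 : a =ᵐ[volume.restrict {0}ᶜ] b := by
    filter_upwards [ae_restrict_of_ae h0, ae_restrict_mem hU.measurableSet] with ω h hω
    exact sub_eq_zero.1 (h hω)
  exact Measure.eqOn_open_of_ae_eq h1 hU ha.1 hb.1 hω

/-- Every loss symbol has the regularity of the explicit one. -/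
theorem IsLossSymbol.isRegular {γ : ℝ} {a : ℝ → ℂ} (hγ : 0 < γ) (ha : IsLossSymbol γ a) :
    IsRegularLossSymbol γ a := by
  obtain ⟨b, hb, hs, him, hP⟩ := exists_isRegularLossSymbol hγ
  refine ⟨ha, hs.congr fun ω hω => ha.eq_of_ne_zero hb hω, fun ω hω => ?_, ?_⟩
  · rw [ha.eq_of_ne_zero hb hω]
    exact him ω hω
  · have hae : b =ᵐ[volume] a := by
      filter_upwards [compl_mem_ae_iff.2 (measure_singleton (0 : ℝ))] with ω hω
      exact hb.eq_of_ne_zero ha hω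
    obtain ⟨N, hN⟩ := hP
    refine ⟨N, hN.congr ?_⟩
    filter_upwards [hae] with ω hω
    rw [hω]

/-! ### Fourier transform in the second variable, on Schwartz functions -/

/-- The phase `exp(i c ⟪ω, t⟫)`. -/
def phase {F : Type} [NormedAddCommGroup F] [InnerProductSpace ℝ F] (c : ℝ) (ω t : F) : ℂ :=
  Complex.exp (Complex.I * ((c * inner ℝ ω t : ℝ) : ℂ))

lemma norm_phase {F : Type} [NormedAddCommGroup F] [InnerProductSpace ℝ F] (c : ℝ) (ω t : F) :
    ‖phase c ω t‖ = 1 := by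
  rw [phase, mul_comm, Complex.norm_exp_ofReal_mul_I]

lemma continuous_phase {F : Type} [NormedAddCommGroup F] [InnerProductSpace ℝ F] (c : ℝ) (t : F) :
    Continuous fun ω : F => phase c ω t := by
  unfold phase
  fun_prop

/-- The bilinear form `(x, ω), (y, s) ↦ ⟪ω, s⟫`. -/
def sndInner (E F : Type) [NormedAddCommGroup E] [NormedSpace ℝ E] [NormedAddCommGroup F]
    [InnerProductSpace ℝ F] : (E × F) →L[ℝ] (E × F) →L[ℝ] ℝ :=
  (innerSL ℝ).bilinearComp (ContinuousLinearMap.snd ℝ E F) (ContinuousLinearMap.snd ℝ E F)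

lemma sndInner_apply {E F : Type} [NormedAddCommGroup E] [NormedSpace ℝ E] [NormedAddCommGroup F]
    [InnerProductSpace ℝ F] (p q : E × F) : sndInner E F p q = inner ℝ p.2 q.2 := rfl

lemma hasFDerivAt_phase {E F : Type} [NormedAddCommGroup E] [NormedSpace ℝ E]
    [NormedAddCommGroup F] [InnerProductSpace ℝ F] (c : ℝ) (x : E) (ω : F) (p : E × F) :
    HasFDerivAt (fun p : E × F => phase c ω p.2)
      (phase c ω p.2 • (Complex.I * c) • (Complex.ofRealCLM.comp (sndInner E F (x, ω)))) p := by
  have h1 : HasFDerivAt (fun p : E × F => Complex.I * ((c * inner ℝ ω p.2 : ℝ) : ℂ))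
      ((Complex.I * c) • (Complex.ofRealCLM.comp (sndInner E F (x, ω)))) p := by
    have h2 : HasFDerivAt (fun p : E × F => (Complex.I * c) *
        (Complex.ofRealCLM.comp (sndInner E F (x, ω))) p)
      ((Complex.I * c) • (Complex.ofRealCLM.comp (sndInner E F (x, ω)))) p :=
      (ContinuousLinearMap.hasFDerivAt _).const_mul _
    refine h2.congr_of_eventuallyEq (Eventually.of_forall fun q => ?_)
    simp [sndInner_apply, mul_assoc]
  exact h1.cexp

set_option linter.unusedSectionVars false

section PartialFourier

variable {E F : Type} [NormedAddCommGroup E] [NormedSpace ℝ E]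
  [NormedAddCommGroup F] [InnerProductSpace ℝ F] [FiniteDimensional ℝ F] [MeasureSpace F]
  [BorelSpace F] [(volume : Measure F).IsAddHaarMeasure]
  {V : Type} [NormedAddCommGroup V] [NormedSpace ℝ V] [NormedSpace ℂ V] [IsScalarTower ℝ ℂ V]
  [SMulCommClass ℝ ℂ V]

/-- Decay in `ω` at any rate, uniform in `x` and with weights in both variables: the domination used
for every integral over a slice. -/
lemma one_add_pow_mul_norm_le (ψ : 𝓢(E × F, V)) (k N : ℕ) (x : E) (ω : F) :
    ‖(x, ω)‖ ^ k * ‖ψ (x, ω)‖ ≤ 2 ^ (k + N) *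
      (Finset.Iic (k + N, 0)).sup (schwartzSeminormFamily ℝ (E × F) V) ψ *
        (1 + ‖ω‖) ^ (-(N : ℝ)) := by
  have h := SchwartzMap.one_add_le_sup_seminorm_apply (𝕜 := ℝ) (m := (k + N, 0)) (k := k + N)
    (n := 0) le_rfl le_rfl ψ (x, ω)
  rw [norm_iteratedFDeriv_zero] at h
  have hp : 0 < (1 + ‖ω‖) ^ N := by positivity
  rw [Real.rpow_neg (by positivity), Real.rpow_natCast, ← div_eq_mul_inv, le_div_iff₀ hp]
  refine le_trans ?_ h
  rw [pow_add, mul_right_comm]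
  have h1 : ‖ω‖ ≤ ‖(x, ω)‖ := by rw [Prod.norm_def]; exact le_max_right _ _
  gcongr
  linarith

/-- The Fourier transform in the second variable. -/
def partialFourierFun (c : ℝ) (ψ : 𝓢(E × F, V)) (p : E × F) : V :=
  ∫ ω, phase c ω p.2 • ψ (p.1, ω)

lemma integrable_slice_mul (ψ : 𝓢(E × F, V)) (k : ℕ) (x : E) :
    Integrable fun ω : F => ‖(x, ω)‖ ^ k * ‖ψ (x, ω)‖ := by
  refine ((Measure.integrable_pow_neg_integrablePower (volume : Measure F)).const_mul
    (2 ^ (k + (volume : Measure F).integrablePower) *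
      (Finset.Iic (k + (volume : Measure F).integrablePower, 0)).sup
        (schwartzSeminormFamily ℝ (E × F) V) ψ)).mono' ?_ (Eventually.of_forall fun ω => ?_)
  · refine Continuous.aestronglyMeasurable ?_
    have := ψ.continuous
    fun_prop
  · rw [Real.norm_of_nonneg (by positivity)]
    exact one_add_pow_mul_norm_le ψ k _ x ω

lemma integrable_slice (ψ : 𝓢(E × F, V)) (x : E) : Integrable fun ω : F => ψ (x, ω) := by
  have h := integrable_slice_mul ψ 0 x
  simp only [pow_zero, one_mul] at h
  refine (integrable_norm_iff (Continuous.aestronglyMeasurable ?_)).1 h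
  have := ψ.continuous
  fun_prop

lemma integrable_phase_smul_slice (c : ℝ) (ψ : 𝓢(E × F, V)) (x : E) (t : F) :
    Integrable fun ω : F => phase c ω t • ψ (x, ω) := by
  refine (integrable_slice ψ x).mono ?_ (Eventually.of_forall fun ω => ?_)
  · refine Continuous.aestronglyMeasurable ?_
    have := ψ.continuous
    have := continuous_phase c t
    fun_prop
  · rw [norm_smul, norm_phase, one_mul]

/-- The operator corresponding to the derivative under the Fourier transform in the second
variable. -/
def phaseDeriv (c : ℝ) : 𝓢(E × F, V) →L[ℝ] 𝓢(E × F, (E × F) →L[ℝ] V) :=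
  -- The first summand is the derivative of `ψ` in `x`; the second is the factor `i c ⟪ω, ·⟫` from
  -- differentiating the phase in `t`.
  SchwartzMap.postcompCLM (ContinuousLinearMap.precomp V
      ((ContinuousLinearMap.inl ℝ E F).comp (ContinuousLinearMap.fst ℝ E F))) ∘L
    SchwartzMap.fderivCLM ℝ (E × F) V +
  SchwartzMap.smulRightCLM ℝ V (sndInner E F) ∘L
    ((Complex.I * c) • ContinuousLinearMap.id ℝ 𝓢(E × F, V))

lemma phaseDeriv_apply (c : ℝ) (ψ : 𝓢(E × F, V)) (p : E × F) :
    phaseDeriv c ψ p = (fderiv ℝ ψ p).comp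
      ((ContinuousLinearMap.inl ℝ E F).comp (ContinuousLinearMap.fst ℝ E F)) +
      (sndInner E F p).smulRight ((Complex.I * c) • ψ p) := rfl

/-- The derivative is again a transform of the same kind, of a Schwartz function with values in a
space of linear maps. This is why values in a general `V` are allowed: all derivatives follow by
induction. -/
theorem hasFDerivAt_partialFourierFun (c : ℝ) (ψ : 𝓢(E × F, V)) (p : E × F) :
    HasFDerivAt (partialFourierFun c ψ) (partialFourierFun c (phaseDeriv c ψ) p) p := by
  refine hasFDerivAt_integral_of_dominated_of_fderiv_le
    (F := fun (p : E × F) (ω : F) => phase c ω p.2 • ψ (p.1, ω))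
    (F' := fun (p : E × F) (ω : F) => phase c ω p.2 • phaseDeriv c ψ (p.1, ω))
    (s := univ)
    (bound := fun ω => (2 ^ (0 + (volume : Measure F).integrablePower) *
      (Finset.Iic (0 + (volume : Measure F).integrablePower, 0)).sup
        (schwartzSeminormFamily ℝ (E × F) ((E × F) →L[ℝ] V)) (phaseDeriv c ψ)) *
        (1 + ‖ω‖) ^ (-((volume : Measure F).integrablePower : ℝ)))
    univ_mem ?_ ?_ ?_ ?_ ?_ ?_
  · exact Eventually.of_forall fun p => (integrable_phase_smul_slice c ψ p.1 p.2).aestronglyMeasurable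
  · exact integrable_phase_smul_slice c ψ p.1 p.2
  · exact (integrable_phase_smul_slice c (phaseDeriv c ψ) p.1 p.2).aestronglyMeasurable
  · refine Eventually.of_forall fun ω p _ => ?_
    have h := one_add_pow_mul_norm_le (phaseDeriv c ψ) 0
      (volume : Measure F).integrablePower p.1 ω
    rw [pow_zero, one_mul] at h
    rw [norm_smul, norm_phase, one_mul]
    exact h
  · exact (Measure.integrable_pow_neg_integrablePower (volume : Measure F)).const_mul _
  · refine Eventually.of_forall fun ω p _ => ?_
    have h1 : HasFDerivAt (fun p : E × F => ψ (p.1, ω)) ((fderiv ℝ ψ (p.1, ω)).comp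
        ((ContinuousLinearMap.inl ℝ E F).comp (ContinuousLinearMap.fst ℝ E F))) p := by
      have h2 : HasFDerivAt (fun p : E × F => (p.1, ω))
          ((ContinuousLinearMap.inl ℝ E F).comp (ContinuousLinearMap.fst ℝ E F)) p := by
        have h3 := (ContinuousLinearMap.hasFDerivAt
          ((ContinuousLinearMap.inl ℝ E F).comp (ContinuousLinearMap.fst ℝ E F)) (x := p)).add_const
            ((0, ω) : E × F)
        refine h3.congr_of_eventuallyEq (Eventually.of_forall fun q => ?_)
        simp
      exact (ψ.hasFDerivAt (p.1, ω)).comp p h2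
    refine ((hasFDerivAt_phase c p.1 ω p).smul h1).congr_fderiv ?_
    ext q
    · simp [phaseDeriv_apply, sndInner_apply]
    · simp [phaseDeriv_apply, sndInner_apply, smul_smul]
      rw [RCLike.real_smul_eq_coe_smul (K := ℂ) (inner ℝ ω q), smul_smul, smul_smul]
      congr 1
      simp only [Complex.coe_algebraMap]
      ring

lemma hasFDerivAt_phase_left (c : ℝ) (ω t : F) :
    HasFDerivAt (fun ω : F => phase c ω t)
      (phase c ω t • (Complex.I * c) • (Complex.ofRealCLM.comp (innerSL ℝ t))) ω := by
  have h1 : HasFDerivAt (fun ω : F => Complex.I * ((c * inner ℝ ω t : ℝ) : ℂ))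
      ((Complex.I * c) • (Complex.ofRealCLM.comp (innerSL ℝ t))) ω := by
    have h2 : HasFDerivAt (fun ω : F => (Complex.I * c) *
        (Complex.ofRealCLM.comp (innerSL ℝ t)) ω)
      ((Complex.I * c) • (Complex.ofRealCLM.comp (innerSL ℝ t))) ω :=
      (ContinuousLinearMap.hasFDerivAt _).const_mul _
    refine h2.congr_of_eventuallyEq (Eventually.of_forall fun q => ?_)
    simp [mul_assoc, real_inner_comm]
  exact h1.cexp

/-- The derivative in the second variable. -/
def sndDeriv : 𝓢(E × F, V) →L[ℝ] 𝓢(E × F, F →L[ℝ] V) :=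
  SchwartzMap.postcompCLM (ContinuousLinearMap.precomp V (ContinuousLinearMap.inr ℝ E F)) ∘L
    SchwartzMap.fderivCLM ℝ (E × F) V

lemma hasFDerivAt_slice (ψ : 𝓢(E × F, V)) (x : E) (ω : F) :
    HasFDerivAt (fun ω : F => ψ (x, ω)) (sndDeriv ψ (x, ω)) ω :=
  (ψ.hasFDerivAt (x, ω)).comp ω (hasFDerivAt_prodMk_right x ω)

/-- Integration by parts in `ω`: a derivative of `ψ` becomes a factor linear in `t`, the source of
decay in `t`. -/
lemma integral_phase_smul_sndDeriv (c : ℝ) (ψ : 𝓢(E × F, V)) (x : E) (t m : F) :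
    ∫ ω, phase c ω t • sndDeriv ψ (x, ω) m =
      -((Complex.I * c * (inner ℝ t m : ℝ)) • ∫ ω, phase c ω t • ψ (x, ω)) := by
  have hd : ∀ ω : F, fderiv ℝ (fun ω => phase c ω t) ω m =
      (Complex.I * c * (inner ℝ t m : ℝ)) * phase c ω t := fun ω => by
    rw [(hasFDerivAt_phase_left c ω t).fderiv]
    simp
    ring
  have hs : ∀ ω : F, fderiv ℝ (fun ω => ψ (x, ω)) ω m = sndDeriv ψ (x, ω) m := fun ω => by
    rw [(hasFDerivAt_slice ψ x ω).fderiv]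
  have h := integral_smul_fderiv_eq_neg_fderiv_smul_of_integrable (μ := (volume : Measure F))
    (f := fun ω => phase c ω t) (g := fun ω => ψ (x, ω)) (v := m) ?_ ?_
    (integrable_phase_smul_slice c ψ x t)
    (fun ω _ => (hasFDerivAt_phase_left c ω t).differentiableAt)
    (fun ω _ => (hasFDerivAt_slice ψ x ω).differentiableAt)
  · simp only [hs, hd, mul_smul] at h
    rw [h]
    simp only [mul_smul, integral_smul]
  · simp only [hd, mul_smul]
    have := ((integrable_phase_smul_slice c ψ x t).smul ((inner ℝ t m : ℝ) : ℂ)).smul (c : ℂ)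
    exact this.smul Complex.I
  · simp only [hs]
    exact integrable_phase_smul_slice c (SchwartzMap.evalCLM ℝ (E × F) V m (sndDeriv ψ)) x t

lemma partialFourierFun_sndDeriv_apply [CompleteSpace V] (c : ℝ) (ψ : 𝓢(E × F, V)) (p : E × F)
    (m : F) : partialFourierFun c (sndDeriv ψ) p m =
      -((Complex.I * c * (inner ℝ p.2 m : ℝ)) • partialFourierFun c ψ p) := by
  rw [partialFourierFun, ContinuousLinearMap.integral_apply
    (integrable_phase_smul_slice c (sndDeriv ψ) p.1 p.2)]
  exact integral_phase_smul_sndDeriv c ψ p.1 p.2 m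

/-- Continuity expressed as seminorm bounds; it pulls estimates for `sndDeriv ψ` and `phaseDeriv c
ψ` back to `ψ`. -/
lemma exists_sup_seminorm_le {A B W : Type} [NormedAddCommGroup A] [NormedSpace ℝ A]
    [NormedAddCommGroup B] [NormedSpace ℝ B] [NormedAddCommGroup W] [NormedSpace ℝ W]
    (T : 𝓢(A, V) →L[ℝ] 𝓢(B, W)) (s : Finset (ℕ × ℕ)) :
    ∃ (s' : Finset (ℕ × ℕ)) (C : ℝ), 0 ≤ C ∧ ∀ ψ,
      s.sup (schwartzSeminormFamily ℝ B W) (T ψ) ≤ C * s'.sup (schwartzSeminormFamily ℝ A V) ψ := by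
  have hb : Seminorm.IsBounded (schwartzSeminormFamily ℝ A V) (schwartzSeminormFamily ℝ B W)
      T.toLinearMap := by
    intro i
    have hq : Continuous ((schwartzSeminormFamily ℝ B W i).comp T.toLinearMap) :=
      ((schwartz_withSeminorms ℝ B W).continuous_seminorm i).comp T.continuous
    obtain ⟨s, C, -, h⟩ := Seminorm.bound_of_continuous (schwartz_withSeminorms ℝ A V) _ hq
    exact ⟨s, C, h⟩
  obtain ⟨C, s', h⟩ := Seminorm.isBounded_sup hb s
  exact ⟨s', C, C.2, fun ψ => h ψ⟩

lemma exists_norm_fst_pow_mul_le (c : ℝ) (k : ℕ) : ∃ (s : Finset (ℕ × ℕ)) (C : ℝ), 0 ≤ C ∧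
    ∀ (ψ : 𝓢(E × F, V)) (p : E × F), ‖p.1‖ ^ k * ‖partialFourierFun c ψ p‖ ≤
      C * s.sup (schwartzSeminormFamily ℝ (E × F) V) ψ := by
  set N := (volume : Measure F).integrablePower
  refine ⟨Finset.Iic (k + N, 0), 2 ^ (k + N) * ∫ ω : F, (1 + ‖ω‖) ^ (-(N : ℝ)),
    mul_nonneg (by positivity) (integral_nonneg fun ω => by positivity), fun ψ p => ?_⟩
  set S := (Finset.Iic (k + N, 0)).sup (schwartzSeminormFamily ℝ (E × F) V) ψ
  have hI := Measure.integrable_pow_neg_integrablePower (volume : Measure F)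
  calc ‖p.1‖ ^ k * ‖partialFourierFun c ψ p‖
      ≤ ‖p.1‖ ^ k * ∫ ω, ‖ψ (p.1, ω)‖ := by
        gcongr
        refine (norm_integral_le_integral_norm _).trans (le_of_eq ?_)
        simp only [norm_smul, norm_phase, one_mul]
    _ = ∫ ω, ‖p.1‖ ^ k * ‖ψ (p.1, ω)‖ := (integral_const_mul _ _).symm
    _ ≤ ∫ ω : F, 2 ^ (k + N) * S * (1 + ‖ω‖) ^ (-(N : ℝ)) := by
        refine integral_mono ((integrable_slice ψ p.1).norm.const_mul _) (hI.const_mul _)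
          fun ω => ?_
        refine le_trans ?_ (one_add_pow_mul_norm_le ψ k N p.1 ω)
        have : ‖p.1‖ ≤ ‖(p.1, ω)‖ := by rw [Prod.norm_def]; exact le_max_left _ _
        gcongr
    _ = _ := by rw [integral_const_mul]; ring

/-- Each power of `t` is bought with one derivative in `ω`, by evaluating the transform of `sndDeriv
ψ` at `t` itself. The derivative changes the value space, so `V` is quantified inside the induction.
-/
lemma exists_norm_snd_pow_mul_le {c : ℝ} (hc : c ≠ 0) (k : ℕ) :
    ∀ (V : Type) [NormedAddCommGroup V] [NormedSpace ℝ V] [NormedSpace ℂ V] [IsScalarTower ℝ ℂ V]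
      [SMulCommClass ℝ ℂ V] [CompleteSpace V], ∃ (s : Finset (ℕ × ℕ)) (C : ℝ), 0 ≤ C ∧
    ∀ (ψ : 𝓢(E × F, V)) (p : E × F), ‖p.2‖ ^ k * ‖partialFourierFun c ψ p‖ ≤
      C * s.sup (schwartzSeminormFamily ℝ (E × F) V) ψ := by
  induction k with
  | zero =>
    intro V _ _ _ _ _ _
    simpa using exists_norm_fst_pow_mul_le (E := E) (F := F) (V := V) c 0
  | succ k ih =>
    intro V _ _ _ _ _ _
    obtain ⟨s, C, hC, h⟩ := ih (F →L[ℝ] V)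
    obtain ⟨s', C', hC', h'⟩ := exists_sup_seminorm_le (sndDeriv (E := E) (F := F) (V := V)) s
    have hc' : 0 < |c| := abs_pos.2 hc
    refine ⟨s', |c|⁻¹ * (C * C'), by positivity, fun ψ p => ?_⟩
    have h1 : |c| * ‖p.2‖ * ‖partialFourierFun c ψ p‖ ≤
        ‖partialFourierFun c (sndDeriv ψ) p‖ := by
      by_cases hp : p.2 = 0
      · simp [hp]
      have hp' : 0 < ‖p.2‖ := norm_pos_iff.2 hp
      have h2 := (partialFourierFun c (sndDeriv ψ) p).le_opNorm p.2
      rw [partialFourierFun_sndDeriv_apply, norm_neg, norm_smul, real_inner_self_eq_norm_sq] at h2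
      simp only [norm_mul, Complex.norm_I, one_mul, Complex.norm_real, Real.norm_eq_abs, abs_pow,
        abs_norm] at h2
      have h3 : |c| * ‖p.2‖ * ‖partialFourierFun c ψ p‖ * ‖p.2‖ ≤
        ‖partialFourierFun c (sndDeriv ψ) p‖ * ‖p.2‖ := by
          refine le_trans (le_of_eq ?_) h2
          ring
      exact le_of_mul_le_mul_right h3 hp'
    have h4 := h (sndDeriv ψ) p
    have h5 := h' ψ
    rw [mul_assoc, ← div_eq_inv_mul, le_div_iff₀ hc']
    calc ‖p.2‖ ^ (k + 1) * ‖partialFourierFun c ψ p‖ * |c|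
        = ‖p.2‖ ^ k * (|c| * ‖p.2‖ * ‖partialFourierFun c ψ p‖) := by ring
      _ ≤ ‖p.2‖ ^ k * ‖partialFourierFun c (sndDeriv ψ) p‖ := by gcongr
      _ ≤ _ := h4
      _ ≤ C * (C' * s'.sup (schwartzSeminormFamily ℝ (E × F) V) ψ) := by gcongr
      _ = _ := by ring

/-- The norm on the product is a maximum, so weights in each variable suffice at order zero; each
further derivative replaces `ψ` by `phaseDeriv c ψ`. -/
lemma exists_norm_iteratedFDeriv_le {c : ℝ} (hc : c ≠ 0) (n k : ℕ) :
    ∀ (V : Type) [NormedAddCommGroup V] [NormedSpace ℝ V] [NormedSpace ℂ V] [IsScalarTower ℝ ℂ V]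
      [SMulCommClass ℝ ℂ V] [CompleteSpace V], ∃ (s : Finset (ℕ × ℕ)) (C : ℝ), 0 ≤ C ∧
    ∀ (ψ : 𝓢(E × F, V)) (p : E × F), ‖p‖ ^ k * ‖iteratedFDeriv ℝ n (partialFourierFun c ψ) p‖ ≤
      C * s.sup (schwartzSeminormFamily ℝ (E × F) V) ψ := by
  induction n with
  | zero =>
    intro V _ _ _ _ _ _
    obtain ⟨s, C, hC, h⟩ := exists_norm_fst_pow_mul_le (E := E) (F := F) (V := V) c k
    obtain ⟨s', C', hC', h'⟩ := exists_norm_snd_pow_mul_le (E := E) (F := F) hc k V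
    refine ⟨s ∪ s', C + C', by positivity, fun ψ p => ?_⟩
    rw [norm_iteratedFDeriv_zero]
    have e1 : s.sup (schwartzSeminormFamily ℝ (E × F) V) ψ ≤
        (s ∪ s').sup (schwartzSeminormFamily ℝ (E × F) V) ψ :=
      Seminorm.le_def.1 (Finset.sup_mono Finset.subset_union_left) ψ
    have e2 : s'.sup (schwartzSeminormFamily ℝ (E × F) V) ψ ≤
        (s ∪ s').sup (schwartzSeminormFamily ℝ (E × F) V) ψ :=
      Seminorm.le_def.1 (Finset.sup_mono Finset.subset_union_right) ψ
    have e3 : 0 ≤ (s ∪ s').sup (schwartzSeminormFamily ℝ (E × F) V) ψ := apply_nonneg _ _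
    rcases le_total ‖p.1‖ ‖p.2‖ with hp | hp
    · rw [Prod.norm_def, max_eq_right hp]
      refine (h' ψ p).trans ?_
      nlinarith [mul_le_mul_of_nonneg_left e2 hC', mul_nonneg hC e3]
    · rw [Prod.norm_def, max_eq_left hp]
      refine (h ψ p).trans ?_
      nlinarith [mul_le_mul_of_nonneg_left e1 hC, mul_nonneg hC' e3]
  | succ n ih =>
    intro V _ _ _ _ _ _
    obtain ⟨s, C, hC, h⟩ := ih ((E × F) →L[ℝ] V)
    obtain ⟨s', C', hC', h'⟩ := exists_sup_seminorm_le (phaseDeriv (E := E) (F := F) (V := V) c) s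
    refine ⟨s', C * C', by positivity, fun ψ p => ?_⟩
    have hfd : fderiv ℝ (partialFourierFun c ψ) = partialFourierFun c (phaseDeriv c ψ) :=
      funext fun p => (hasFDerivAt_partialFourierFun c ψ p).fderiv
    rw [← norm_iteratedFDeriv_fderiv, hfd, mul_assoc]
    exact (h _ p).trans (mul_le_mul_of_nonneg_left (h' ψ) hC)

lemma contDiff_partialFourierFun (c : ℝ) (n : ℕ) :
    ∀ (V : Type) [NormedAddCommGroup V] [NormedSpace ℝ V] [NormedSpace ℂ V] [IsScalarTower ℝ ℂ V]
      [SMulCommClass ℝ ℂ V] (ψ : 𝓢(E × F, V)), ContDiff ℝ n (partialFourierFun c ψ) := by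
  induction n with
  | zero =>
    intro V _ _ _ _ _ ψ
    rw [Nat.cast_zero, contDiff_zero, continuous_iff_continuousAt]
    exact fun p => (hasFDerivAt_partialFourierFun c ψ p).continuousAt
  | succ n ih =>
    intro V _ _ _ _ _ ψ
    have hfd : fderiv ℝ (partialFourierFun c ψ) = partialFourierFun c (phaseDeriv c ψ) :=
      funext fun p => (hasFDerivAt_partialFourierFun c ψ p).fderiv
    push_cast
    rw [contDiff_succ_iff_fderiv]
    refine ⟨fun p => (hasFDerivAt_partialFourierFun c ψ p).differentiableAt, by simp, ?_⟩
    rw [hfd]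
    exact ih _ _

/-- The Fourier transform in the second variable, as a real-linear map. -/
def partialFourierReal {c : ℝ} (hc : c ≠ 0) : 𝓢(E × F, ℂ) →L[ℝ] 𝓢(E × F, ℂ) :=
  SchwartzMap.mkCLM (partialFourierFun c)
    (fun f g p => by
      simp only [partialFourierFun, _root_.add_apply, smul_add]
      exact integral_add (integrable_phase_smul_slice c f p.1 p.2)
        (integrable_phase_smul_slice c g p.1 p.2))
    (fun r f p => by
      simp only [partialFourierFun, _root_.smul_apply, RingHom.id_apply]
      rw [← integral_smul]
      simp only [smul_comm r])
    (fun f => contDiff_infty.2 fun n => contDiff_partialFourierFun c n ℂ f)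
    (fun n => exists_norm_iteratedFDeriv_le hc n.2 n.1 ℂ)

/-- The Fourier transform `∫ ψ(x, ω) exp(i c ⟪ω, t⟫) dω` in the second variable. -/
def partialFourier {c : ℝ} (hc : c ≠ 0) : 𝓢(E × F, ℂ) →L[ℂ] 𝓢(E × F, ℂ) where
  toFun := partialFourierReal hc
  map_add' := map_add _
  map_smul' r f := by
    ext p
    change partialFourierFun c (r • f) p = r • partialFourierFun c f p
    simp only [partialFourierFun, _root_.smul_apply]
    rw [← integral_smul]
    simp only [smul_comm r]
  cont := (partialFourierReal hc).continuous

lemma partialFourier_apply {c : ℝ} (hc : c ≠ 0) (ψ : 𝓢(E × F, ℂ)) (x : E) (t : F) :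
    partialFourier hc ψ (x, t) = ∫ ω, phase c ω t * ψ (x, ω) := rfl

lemma lineDeriv_fst_partialFourier {c : ℝ} (hc : c ≠ 0) (ψ : 𝓢(E × F, ℂ)) (y : E) :
    ∂_{((y, 0) : E × F)} (partialFourier hc ψ) = partialFourier hc (∂_{((y, 0) : E × F)} ψ) := by
  ext p
  rw [SchwartzMap.lineDerivOp_apply_eq_fderiv]
  rw [show fderiv ℝ (partialFourier hc ψ) p = _ from (hasFDerivAt_partialFourierFun c ψ p).fderiv]
  rw [partialFourierFun, ContinuousLinearMap.integral_apply
    (integrable_phase_smul_slice c (phaseDeriv c ψ) p.1 p.2)]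
  refine integral_congr_ae (Eventually.of_forall fun ω => ?_)
  simp [phaseDeriv_apply, sndInner_apply, SchwartzMap.lineDerivOp_apply_eq_fderiv]

/-- Multiplication by `i c ⟪ω, m⟫`. -/
def mulSnd (c : ℝ) (m : F) : 𝓢(E × F, ℂ) →L[ℂ] 𝓢(E × F, ℂ) :=
  SchwartzMap.smulLeftCLM ℂ (fun p : E × F => Complex.I * c * (inner ℝ p.2 m : ℝ))

lemma mulSnd_apply (c : ℝ) (m : F) (ψ : 𝓢(E × F, ℂ)) (p : E × F) :
    mulSnd c m ψ p = Complex.I * c * (inner ℝ p.2 m : ℝ) * ψ p := by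
  rw [mulSnd, SchwartzMap.smulLeftCLM_apply_apply, smul_eq_mul]
  have h : (fun p : E × F => ((inner ℝ p.2 m : ℝ) : ℂ)).HasTemperateGrowth := by
    convert (Complex.ofRealCLM.comp ((innerSL ℝ m).comp
      (ContinuousLinearMap.snd ℝ E F))).hasTemperateGrowth using 1
    ext p
    simp [real_inner_comm]
  exact (Function.HasTemperateGrowth.const _).mul h

lemma lineDeriv_snd_partialFourier {c : ℝ} (hc : c ≠ 0) (ψ : 𝓢(E × F, ℂ)) (m : F) :
    ∂_{((0, m) : E × F)} (partialFourier hc ψ) = partialFourier hc (mulSnd c m ψ) := by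
  ext p
  rw [SchwartzMap.lineDerivOp_apply_eq_fderiv]
  rw [show fderiv ℝ (partialFourier hc ψ) p = _ from (hasFDerivAt_partialFourierFun c ψ p).fderiv]
  rw [partialFourierFun, ContinuousLinearMap.integral_apply
    (integrable_phase_smul_slice c (phaseDeriv c ψ) p.1 p.2)]
  refine integral_congr_ae (Eventually.of_forall fun ω => ?_)
  simp [phaseDeriv_apply, sndInner_apply, mulSnd_apply, ← Prod.zero_eq_mk]
  exact Or.inl (by ring)

end PartialFourier

/-! ### Slices of test functions and Fourier inversion in one variable of a product -/

section Slice

variable {E F : Type} [NormedAddCommGroup E] [NormedSpace ℝ E] [NormedAddCommGroup F]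
  [NormedSpace ℝ F]

/-- The restriction of a test function to `{x} × F`. -/
def sndSlice (x : E) : 𝓢(E × F, ℂ) →L[ℂ] 𝓢(F, ℂ) :=
  SchwartzMap.compCLM ℂ (g := fun ω : F => (x, ω))
    (by
      have h : (fun ω : F => (x, ω)) = fun ω => (x, 0) + ContinuousLinearMap.inr ℝ E F ω := by
        ext ω <;> simp
      rw [h]
      exact (Function.HasTemperateGrowth.const _).add
        (ContinuousLinearMap.inr ℝ E F).hasTemperateGrowth)
    ⟨1, 1, fun ω => by
      have : ‖ω‖ ≤ ‖(x, ω)‖ := by rw [Prod.norm_def]; exact le_max_right _ _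
      rw [one_mul, pow_one]
      exact this.trans (le_add_of_nonneg_left zero_le_one)⟩

@[simp] lemma sndSlice_apply (x : E) (ψ : 𝓢(E × F, ℂ)) (ω : F) : sndSlice x ψ ω = ψ (x, ω) := rfl

/-- The restriction of a test function to `E × {ω}`. -/
def fstSlice (ω : F) : 𝓢(E × F, ℂ) →L[ℂ] 𝓢(E, ℂ) :=
  SchwartzMap.compCLM ℂ (g := fun x : E => (x, ω))
    (by
      have h : (fun x : E => (x, ω)) = fun x => (0, ω) + ContinuousLinearMap.inl ℝ E F x := by
        ext x <;> simp
      rw [h]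
      exact (Function.HasTemperateGrowth.const _).add
        (ContinuousLinearMap.inl ℝ E F).hasTemperateGrowth)
    ⟨1, 1, fun x => by
      have : ‖x‖ ≤ ‖(x, ω)‖ := by rw [Prod.norm_def]; exact le_max_left _ _
      rw [one_mul, pow_one]
      exact this.trans (le_add_of_nonneg_left zero_le_one)⟩

@[simp] lemma fstSlice_apply (ω : F) (ψ : 𝓢(E × F, ℂ)) (x : E) : fstSlice ω ψ x = ψ (x, ω) := rfl

lemma fstSlice_lineDeriv (ω : F) (ψ : 𝓢(E × F, ℂ)) (y : E) :
    fstSlice ω (∂_{((y, 0) : E × F)} ψ) = ∂_{y} (fstSlice ω ψ) := by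
  ext x
  rw [fstSlice_apply, SchwartzMap.lineDerivOp_apply_eq_fderiv,
    SchwartzMap.lineDerivOp_apply_eq_fderiv]
  have h : HasFDerivAt (fun x : E => ψ (x, ω)) ((fderiv ℝ ψ (x, ω)).comp
      (ContinuousLinearMap.inl ℝ E F)) x :=
    (ψ.hasFDerivAt (x, ω)).comp x (hasFDerivAt_prodMk_left x ω)
  rw [show fderiv ℝ (fstSlice ω ψ) x = _ from h.fderiv]
  simp

end Slice

section Inversion

variable {E F : Type} [NormedAddCommGroup E] [NormedSpace ℝ E] [NormedAddCommGroup F]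
  [InnerProductSpace ℝ F] [FiniteDimensional ℝ F] [MeasurableSpace F] [BorelSpace F]

lemma partialFourier_eq_fourierInv {c : ℝ} (hc : c ≠ 0) (ψ : 𝓢(E × F, ℂ)) (x : E) (t : F) :
    partialFourier hc ψ (x, t) = 𝓕⁻ (sndSlice x ψ) ((c / (2 * Real.pi)) • t) := by
  rw [partialFourier_apply, SchwartzMap.fourierInv_coe, Real.fourierInv_eq']
  refine integral_congr_ae (Eventually.of_forall fun ω => ?_)
  simp only [phase, sndSlice_apply, smul_eq_mul, inner_smul_right]
  congr 2
  push_cast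
  have : (Real.pi : ℂ) ≠ 0 := Complex.ofReal_ne_zero.2 Real.pi_ne_zero
  field_simp

/-- On each slice this is the usual inversion formula after dilating by `a = c / (2π)`; the constant
is the Jacobian of the dilation. -/
theorem partialFourier_neg_partialFourier {c : ℝ} (hc : c ≠ 0) (ψ : 𝓢(E × F, ℂ)) :
    partialFourier (neg_ne_zero.2 hc) (partialFourier hc ψ) =
      (((|2 * Real.pi / c| ^ Module.finrank ℝ F : ℝ)) : ℂ) • ψ := by
  ext ⟨x, ω⟩
  set a := c / (2 * Real.pi)
  have hpi := Real.pi_ne_zero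
  have ha : a ≠ 0 := by positivity
  have h1 : 𝓕 (𝓕⁻ (sndSlice x ψ)) ω = sndSlice x ψ ω := by
    rw [FourierTransform.fourier_fourierInv_eq]
  have h2 := Measure.integral_comp_smul (volume : Measure F)
    (fun s : F => phase (-(2 * Real.pi)) s ω * 𝓕⁻ (sndSlice x ψ) s) a
  rw [partialFourier_apply, _root_.smul_apply]
  simp only [partialFourier_eq_fourierInv]
  rw [SchwartzMap.fourier_coe, Real.fourier_eq'] at h1
  have h3 : ∫ s : F, phase (-(2 * Real.pi)) s ω * 𝓕⁻ (sndSlice x ψ) s = ψ (x, ω) := by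
    rw [← sndSlice_apply, ← h1]
    refine integral_congr_ae (Eventually.of_forall fun s => ?_)
    simp only [phase, smul_eq_mul]
    congr 2
    push_cast
    ring
  rw [h3] at h2
  refine Eq.trans (integral_congr_ae (Eventually.of_forall fun s => ?_)) (h2.trans ?_)
  · simp only [phase, inner_smul_left]
    congr 3
    simp [a]
    field_simp
  · rw [← Complex.coe_smul]
    congr 2
    rw [abs_inv, abs_pow, ← inv_pow, ← abs_inv]
    congr 2
    simp [a]

end Inversion

/-! ### Reciprocals of functions of temperate growth -/

lemma hasTemperateGrowth_real_inv {E : Type*} [NormedAddCommGroup E] [NormedSpace ℝ E] {f : E → ℝ}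
    (hf : f.HasTemperateGrowth) (h1 : ∀ x, 1 ≤ f x) :
    (fun x => (f x)⁻¹).HasTemperateGrowth := by
  have hunique : UniqueDiffOn ℝ (Ioi (1 / 2 : ℝ)) := isOpen_Ioi.uniqueDiffOn
  have hpos : ∀ x ∈ Ioi (1 / 2 : ℝ), 0 < x := fun x hx => lt_trans (by norm_num) (mem_Ioi.1 hx)
  refine Function.HasTemperateGrowth.comp' (g := fun x : ℝ => x⁻¹) (t := Ioi (1 / 2)) ?_ hunique
    (fun x hx => (contDiffAt_inv ℝ (hpos x hx).ne').contDiffWithinAt) (fun N => ?_) hf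
  · rintro _ ⟨x, rfl⟩
    exact lt_of_lt_of_le (by norm_num) (h1 x)
  -- The `n`-th derivative of `1/x` has size `n! x⁻¹ ^ (n + 1)`, and `x⁻¹ ≤ 2` on the open set
  -- `(1/2, ∞)`, chosen to contain `[1, ∞)`.
  refine ⟨0, (N.factorial : ℝ) * 2 ^ (N + 1), by positivity, fun n hn x hx => ?_⟩
  have hx0 := hpos x hx
  rw [norm_iteratedFDerivWithin_eq_norm_iteratedDerivWithin,
    iteratedDerivWithin_eq_iteratedDeriv hunique (contDiffAt_inv ℝ hx0.ne') hx,
    iteratedDeriv_eq_iterate, iter_deriv_inv', pow_zero, mul_one, norm_mul, norm_mul, norm_pow,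
    norm_neg, norm_one, one_pow, one_mul]
  have h2 : x ^ (-1 - (n : ℤ)) = x⁻¹ ^ (n + 1) := by
    rw [inv_pow, ← zpow_natCast, ← zpow_neg]
    congr 1
    push_cast
    ring
  have h3 : x⁻¹ ≤ 2 := by
    rw [inv_le_comm₀ hx0 two_pos]
    simpa using (mem_Ioi.1 hx).le
  rw [h2, Real.norm_of_nonneg (by positivity), Real.norm_of_nonneg (by positivity)]
  have h4 : (n.factorial : ℝ) ≤ N.factorial := by exact_mod_cast Nat.factorial_le hn
  have h5 : x⁻¹ ^ (n + 1) ≤ 2 ^ (N + 1) :=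
    (pow_le_pow_left₀ (by positivity) h3 _).trans
      (pow_le_pow_right₀ (by norm_num) (by omega))
  gcongr

/-- The reciprocal of a function of temperate growth bounded away from zero has temperate
growth. -/
theorem hasTemperateGrowth_inv {E : Type*} [NormedAddCommGroup E] [NormedSpace ℝ E] {s : E → ℂ}
    (hs : s.HasTemperateGrowth) {c : ℝ} (hc : 0 < c) (h : ∀ x, c ≤ ‖s x‖) :
    (fun x => (s x)⁻¹).HasTemperateGrowth := by
  have hconj : (fun x => (starRingEnd ℂ) (s x)).HasTemperateGrowth :=
    (Complex.conjCLE.toContinuousLinearMap.hasTemperateGrowth).comp hs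
  have hsq : (fun x => (c ^ 2)⁻¹ * Complex.normSq (s x)).HasTemperateGrowth := by
    have h1 : (fun x => (c ^ 2)⁻¹ * Complex.normSq (s x)) =
        fun x => (c ^ 2)⁻¹ * Complex.reCLM (starRingEnd ℂ (s x) * s x) := by
      ext x
      simp [Complex.normSq_apply]
    rw [h1]
    exact (Function.HasTemperateGrowth.const _).mul
      (Complex.reCLM.hasTemperateGrowth.comp (hconj.mul hs))
  have hinv := hasTemperateGrowth_real_inv hsq fun x => by
    rw [Complex.normSq_eq_norm_sq, ← div_eq_inv_mul, le_div_iff₀ (by positivity), one_mul]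
    exact pow_le_pow_left₀ hc.le (h x) 2
  have hinvC : (fun x => ((((c ^ 2)⁻¹ * Complex.normSq (s x))⁻¹ : ℝ) : ℂ)).HasTemperateGrowth :=
    Complex.ofRealCLM.hasTemperateGrowth.comp hinv
  -- `1/s` is the conjugate of `s` over `|s|²`; dividing by `c²` makes the denominator at least `1`.
  have h2 : (fun x => (s x)⁻¹) = fun x => (((c ^ 2)⁻¹ : ℝ) : ℂ) * (starRingEnd ℂ (s x) *
      ((((c ^ 2)⁻¹ * Complex.normSq (s x))⁻¹ : ℝ) : ℂ)) := by
    ext x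
    have hc' : (c : ℂ) ≠ 0 := Complex.ofReal_ne_zero.2 hc.ne'
    rw [Complex.inv_def]
    push_cast
    field_simp
  rw [h2]
  exact (Function.HasTemperateGrowth.const _).mul (hconj.mul hinvC)

/-! ### The fundamental solution of the Helmholtz equation in three dimensions -/

/-- The radial profile `exp(i K r) / r ^ n`. -/
def radialWave (K : ℂ) (n : ℕ) (r : ℝ) : ℂ := Complex.exp (Complex.I * K * r) / (r : ℂ) ^ n

lemma norm_cexp_I_mul_le {K : ℂ} (hK : 0 ≤ K.im) {r : ℝ} (hr : 0 ≤ r) :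
    ‖Complex.exp (Complex.I * K * r)‖ ≤ 1 := by
  rw [Complex.norm_exp, Real.exp_le_one_iff]
  simp
  positivity

lemma norm_radialWave_le {K : ℂ} (hK : 0 ≤ K.im) (n : ℕ) {r : ℝ} (hr : 0 < r) :
    ‖radialWave K n r‖ ≤ (r ^ n)⁻¹ := by
  rw [radialWave, norm_div, norm_pow, Complex.norm_real, Real.norm_of_nonneg hr.le, ← one_div]
  gcongr
  exact norm_cexp_I_mul_le hK hr.le

lemma radialWave_eq_mul (K : ℂ) (n : ℕ) {r : ℝ} (hr : r ≠ 0) :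
    radialWave K n r = r * radialWave K (n + 1) r := by
  have : (r : ℂ) ≠ 0 := Complex.ofReal_ne_zero.2 hr
  rw [radialWave, radialWave, pow_succ]
  field_simp

lemma hasDerivAt_radialWave (K : ℂ) (n : ℕ) {r : ℝ} (hr : r ≠ 0) :
    HasDerivAt (radialWave K n)
      (Complex.I * K * radialWave K n r - n * radialWave K (n + 1) r) r := by
  have hr' : (r : ℂ) ≠ 0 := Complex.ofReal_ne_zero.2 hr
  have h0 : HasDerivAt (fun r : ℝ => (r : ℂ)) 1 r := Complex.ofRealCLM.hasDerivAt
  have h1 := (h0.const_mul (Complex.I * K)).cexp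
  refine (h1.div (h0.fun_pow n) (pow_ne_zero n hr')).congr_deriv ?_
  rw [radialWave, radialWave]
  rcases n with _ | n
  · simp
    ring
  · simp
    field_simp
    ring

/-- The regularized norm `√(‖x‖² + ε²)`. -/
def regNorm (ε : ℝ) (x : Space) : ℝ := √(‖x‖ ^ 2 + ε ^ 2)

lemma sq_regNorm (ε : ℝ) (x : Space) : regNorm ε x ^ 2 = ‖x‖ ^ 2 + ε ^ 2 :=
  Real.sq_sqrt (by positivity)

lemma norm_le_regNorm (ε : ℝ) (x : Space) : ‖x‖ ≤ regNorm ε x :=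
  Real.le_sqrt_of_sq_le (by nlinarith)

lemma le_regNorm (ε : ℝ) (x : Space) : ε ≤ regNorm ε x :=
  Real.le_sqrt_of_sq_le (by nlinarith [sq_nonneg ‖x‖])

lemma regNorm_pos {ε : ℝ} (hε : 0 < ε) (x : Space) : 0 < regNorm ε x :=
  hε.trans_le (le_regNorm ε x)

lemma continuous_regNorm (ε : ℝ) : Continuous (regNorm ε) := by
  unfold regNorm
  fun_prop

lemma hasFDerivAt_regNorm {ε : ℝ} (hε : 0 < ε) (x : Space) :
    HasFDerivAt (regNorm ε) ((regNorm ε x)⁻¹ • innerSL ℝ x) x := by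
  have h1 : HasFDerivAt (fun x : Space => ‖x‖ ^ 2 + ε ^ 2) ((2 : ℝ) • innerSL ℝ x) x := by
    have := ((hasStrictFDerivAt_norm_sq x).hasFDerivAt).add_const (ε ^ 2)
    refine this.congr_fderiv ?_
    ext v
    simp
  refine (h1.sqrt (by positivity)).congr_fderiv ?_
  rw [smul_smul, regNorm]
  congr 1
  field_simp

/-- The gradient of the regularized norm is `x` over that norm; the division is absorbed into the
index, so derivatives stay within the family `radialWave K n`. -/
lemma hasFDerivAt_radialWave_regNorm (K : ℂ) (n : ℕ) {ε : ℝ} (hε : 0 < ε) (x : Space) :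
    HasFDerivAt (fun x => radialWave K n (regNorm ε x))
      ((innerSL ℝ x).smulRight (Complex.I * K * radialWave K (n + 1) (regNorm ε x) -
        n * radialWave K (n + 2) (regNorm ε x))) x := by
  have hR := (regNorm_pos hε x).ne'
  refine ((hasDerivAt_radialWave K n hR).hasFDerivAt.comp x
    (hasFDerivAt_regNorm hε x)).congr_fderiv ?_
  ext v
  rw [radialWave_eq_mul K n hR, radialWave_eq_mul K (n + 1) hR]
  have hR' : ((regNorm ε x : ℝ) : ℂ) ≠ 0 := Complex.ofReal_ne_zero.2 hR
  simp
  field_simp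

lemma continuous_radialWave_regNorm (K : ℂ) (n : ℕ) {ε : ℝ} (hε : 0 < ε) :
    Continuous fun x => radialWave K n (regNorm ε x) :=
  continuous_iff_continuousAt.2 fun x => (hasFDerivAt_radialWave_regNorm K n hε x).continuousAt

/-- Integration by parts of a test function against a bounded function. -/
lemma integral_lineDeriv_mul (φ : 𝓢(Space, ℂ)) (v : Space) {f f' : Space → ℂ}
    (hf : Differentiable ℝ f) (hf' : ∀ x, fderiv ℝ f x v = f' x) (hc : Continuous f') {C C' : ℝ}
    (hC : ∀ x, ‖f x‖ ≤ C) (hC' : ∀ x, ‖f' x‖ ≤ C') :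
    ∫ x, (∂_{v} φ) x * f x = -∫ x, φ x * f' x := by
  have hb : ∀ (ψ : 𝓢(Space, ℂ)) {g : Space → ℂ} {D : ℝ}, Continuous g → (∀ x, ‖g x‖ ≤ D) →
      Integrable fun x => ψ x * g x := fun ψ g D hg hD =>
    ψ.integrable.mul_bdd hg.aestronglyMeasurable (Eventually.of_forall hD)
  have h := integral_mul_fderiv_eq_neg_fderiv_mul_of_integrable (μ := (volume : Measure Space))
    (f := φ) (g := f) (v := v) ?_ ?_ (hb φ hf.continuous hC) (fun x _ => φ.differentiableAt)
    (fun x _ => hf x)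
  · simp only [hf'] at h
    rw [h, neg_neg]
    rfl
  · exact hb (∂_{v} φ) hf.continuous hC
  · simp only [hf']
    exact hb φ hc hC'

theorem integral_lineDeriv_lineDeriv_mul_radialWave (φ : 𝓢(Space, ℂ)) (v : Space) {K : ℂ}
    (hK : 0 ≤ K.im) {ε : ℝ} (hε : 0 < ε) :
    ∫ x, (∂_{v} (∂_{v} φ)) x * radialWave K 1 (regNorm ε x) =
      ∫ x, φ x * (((‖v‖ ^ 2 : ℝ) : ℂ) * (Complex.I * K * radialWave K 2 (regNorm ε x) -
          radialWave K 3 (regNorm ε x)) +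
        ((inner ℝ x v ^ 2 : ℝ) : ℂ) * (-K ^ 2 * radialWave K 3 (regNorm ε x) -
          3 * Complex.I * K * radialWave K 4 (regNorm ε x) +
          3 * radialWave K 5 (regNorm ε x))) := by
  have hcw := fun n => continuous_radialWave_regNorm K n hε
  have hcv : Continuous fun x : Space => ((inner ℝ x v : ℝ) : ℂ) := by fun_prop
  have hw : ∀ n x, ‖radialWave K n (regNorm ε x)‖ ≤ (regNorm ε x ^ n)⁻¹ := fun n x =>
    norm_radialWave_le hK n (regNorm_pos hε x)
  have hi : ∀ x : Space, ‖((inner ℝ x v : ℝ) : ℂ)‖ ≤ regNorm ε x * ‖v‖ := fun x => by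
    rw [Complex.norm_real]
    exact (norm_inner_le_norm x v).trans (by gcongr; exact norm_le_regNorm ε x)
  set f1 : Space → ℂ := fun x => ((inner ℝ x v : ℝ) : ℂ) *
    (Complex.I * K * radialWave K 2 (regNorm ε x) - radialWave K 3 (regNorm ε x)) with hf1
  have hd0 := hasFDerivAt_radialWave_regNorm K 1 hε
  have hd1 : ∀ x, HasFDerivAt f1 _ x := fun x =>
    (((Complex.ofRealCLM.comp (innerSL ℝ v)).hasFDerivAt (x := x)).congr_of_eventuallyEq
      (f₁ := fun x : Space => ((inner ℝ x v : ℝ) : ℂ))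
      (Eventually.of_forall fun y => by simp [real_inner_comm])).mul
    (((hasFDerivAt_radialWave_regNorm K 2 hε x).const_mul (Complex.I * K)).sub
      (hasFDerivAt_radialWave_regNorm K 3 hε x))
  -- The factor `⟪x, v⟫` costs one power of the regularized norm, and the negative powers that
  -- remain are bounded because that norm is at least `ε`.
  have hb1 : ∀ x, ‖f1 x‖ ≤ ‖v‖ * (‖K‖ * ε⁻¹ + (ε ^ 2)⁻¹) := fun x => by
    have hR := regNorm_pos hε x
    have hRε := le_regNorm ε x
    calc ‖f1 x‖ ≤ (regNorm ε x * ‖v‖) * (‖K‖ * (regNorm ε x ^ 2)⁻¹ + (regNorm ε x ^ 3)⁻¹) := by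
          rw [hf1, norm_mul]
          gcongr
          · exact hi x
          · refine (norm_sub_le _ _).trans ?_
            rw [norm_mul, norm_mul, Complex.norm_I, one_mul]
            gcongr
            · exact hw 2 x
            · exact hw 3 x
      _ = ‖v‖ * (‖K‖ * (regNorm ε x)⁻¹ + (regNorm ε x ^ 2)⁻¹) := by field_simp
      _ ≤ _ := by gcongr
  rw [integral_lineDeriv_mul (∂_{v} φ) v (f := fun x => radialWave K 1 (regNorm ε x)) (f' := f1)
    (C := ε⁻¹) (fun x => (hd0 x).differentiableAt) ?deriv1 ?cont1 ?bound1 hb1]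
  · rw [integral_lineDeriv_mul φ v (f := f1) (C' := ‖v‖ ^ 2 * (‖K‖ * (ε ^ 2)⁻¹ + (ε ^ 3)⁻¹) +
      ‖v‖ ^ 2 * (‖K‖ ^ 2 * ε⁻¹ + 3 * ‖K‖ * (ε ^ 2)⁻¹ + 3 * (ε ^ 3)⁻¹))
      (fun x => (hd1 x).differentiableAt) ?deriv2 ?cont2 hb1 ?bound2, neg_neg]
    case deriv2 =>
      intro x
      rw [(hd1 x).fderiv]
      simp
      linear_combination (((inner ℝ x v : ℝ) : ℂ) ^ 2 * K ^ 2 *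
        radialWave K 3 (regNorm ε x)) * Complex.I_sq
    case cont2 =>
      have h2 := hcw 2
      have h3 := hcw 3
      have h4 := hcw 4
      have h5 := hcw 5
      fun_prop
    case bound2 =>
      intro x
      have hR := regNorm_pos hε x
      have hRε := le_regNorm ε x
      calc _ ≤ ‖v‖ ^ 2 * (‖K‖ * (regNorm ε x ^ 2)⁻¹ + (regNorm ε x ^ 3)⁻¹) +
            (regNorm ε x * ‖v‖) ^ 2 * (‖K‖ ^ 2 * (regNorm ε x ^ 3)⁻¹ +
              3 * ‖K‖ * (regNorm ε x ^ 4)⁻¹ + 3 * (regNorm ε x ^ 5)⁻¹) := by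
            refine (norm_add_le _ _).trans ?_
            rw [norm_mul, norm_mul]
            gcongr
            · simp
            · refine (norm_sub_le _ _).trans ?_
              rw [norm_mul, norm_mul, Complex.norm_I, one_mul]
              gcongr
              · exact hw 2 x
              · exact hw 3 x
            · rw [Complex.ofReal_pow, norm_pow]
              gcongr
              exact hi x
            · refine (norm_add_le _ _).trans (add_le_add ((norm_sub_le _ _).trans ?_) ?_)
              · simp only [norm_mul, norm_neg, norm_pow, Complex.norm_I, mul_one,
                  Complex.norm_ofNat]
                gcongr
                · exact hw 3 x
                · exact hw 4 x
              · simp only [norm_mul, Complex.norm_ofNat]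
                gcongr
                exact hw 5 x
        _ = ‖v‖ ^ 2 * (‖K‖ * (regNorm ε x ^ 2)⁻¹ + (regNorm ε x ^ 3)⁻¹) + ‖v‖ ^ 2 *
            (‖K‖ ^ 2 * (regNorm ε x)⁻¹ + 3 * ‖K‖ * (regNorm ε x ^ 2)⁻¹ +
              3 * (regNorm ε x ^ 3)⁻¹) := by field_simp
        _ ≤ _ := by gcongr
  case deriv1 =>
    intro x
    rw [(hd0 x).fderiv]
    simp [hf1]
  case cont1 =>
    have h2 := hcw 2
    have h3 := hcw 3
    rw [hf1]
    fun_prop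
  case bound1 =>
    intro x
    refine (hw 1 x).trans ?_
    rw [pow_one]
    have hRε := le_regNorm ε x
    gcongr

lemma basisVec_norm (j : Fin 3) : ‖basisVec j‖ = 1 := by simp [basisVec]

lemma inner_basisVec (x : Space) (j : Fin 3) : inner ℝ x (basisVec j) = x j := by
  rw [basisVec, EuclideanSpace.inner_single_right]
  simp

lemma integrable_mul_radialWave (ψ : 𝓢(Space, ℂ)) {K : ℂ} (hK : 0 ≤ K.im) (n : ℕ) {ε : ℝ}
    (hε : 0 < ε) : Integrable fun x => ψ x * radialWave K n (regNorm ε x) := by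
  refine ψ.integrable.mul_bdd (c := (ε ^ n)⁻¹)
    (continuous_radialWave_regNorm K n hε).aestronglyMeasurable (Eventually.of_forall fun x => ?_)
  refine (norm_radialWave_le hK n (regNorm_pos hε x)).trans ?_
  have := le_regNorm ε x
  gcongr

lemma integrable_mul_sq_radialWave (ψ : 𝓢(Space, ℂ)) {K : ℂ} (hK : 0 ≤ K.im) (n : ℕ) {ε : ℝ}
    (hε : 0 < ε) (j : Fin 3) : Integrable fun x =>
      ψ x * (((x j ^ 2 : ℝ) : ℂ) * radialWave K (n + 2) (regNorm ε x)) := by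
  refine ψ.integrable.mul_bdd (c := (ε ^ n)⁻¹) ?_ (Eventually.of_forall fun x => ?_)
  · have := continuous_radialWave_regNorm K (n + 2) hε
    exact Continuous.aestronglyMeasurable (by fun_prop)
  · have hR := regNorm_pos hε x
    have h1 : x j ^ 2 ≤ regNorm ε x ^ 2 := by
      rw [← sq_abs, ← Real.norm_eq_abs]
      exact pow_le_pow_left₀ (norm_nonneg _)
        ((PiLp.norm_apply_le x j).trans (norm_le_regNorm ε x)) 2
    rw [norm_mul, Complex.norm_real, Real.norm_of_nonneg (sq_nonneg _)]
    calc _ ≤ regNorm ε x ^ 2 * (regNorm ε x ^ (n + 2))⁻¹ := by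
          gcongr
          exact norm_radialWave_le hK _ hR
      _ = (regNorm ε x ^ n)⁻¹ := by field_simp; ring
      _ ≤ _ := by
        have := le_regNorm ε x
        gcongr

/-- The Helmholtz operator with wave number `K`. -/
def helmholtz (K : ℂ) (φ : 𝓢(Space, ℂ)) : 𝓢(Space, ℂ) :=
  (∑ j, ∂_{basisVec j} (∂_{basisVec j} φ)) + K ^ 2 • φ

/-- With `R = √(|x|² + ε²)`, every term of the Helmholtz operator applied to `exp(iKR)/R` cancels
except those carrying the factor `ε²` that arises from `|x|² = R² - ε²`. The `R⁻⁵` term is kept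
apart because it alone survives as `ε → 0`. -/
theorem integral_helmholtz_mul_radialWave (φ : 𝓢(Space, ℂ)) {K : ℂ} (hK : 0 ≤ K.im) {ε : ℝ}
    (hε : 0 < ε) :
    ∫ x, helmholtz K φ x * radialWave K 1 (regNorm ε x) =
      (∫ x, φ x * ((ε : ℂ) ^ 2 * (K ^ 2 * radialWave K 3 (regNorm ε x) +
          3 * Complex.I * K * radialWave K 4 (regNorm ε x)))) -
        ∫ x, φ x * ((ε : ℂ) ^ 2 * (3 * radialWave K 5 (regNorm ε x))) := by
  have hw := fun n => integrable_mul_radialWave φ hK n hε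
  have hsum : ∫ x, helmholtz K φ x * radialWave K 1 (regNorm ε x) =
      (∑ j, ∫ x, (∂_{basisVec j} (∂_{basisVec j} φ)) x * radialWave K 1 (regNorm ε x)) +
        ∫ x, K ^ 2 * (φ x * radialWave K 1 (regNorm ε x)) := by
    rw [← integral_finsetSum _ fun j _ => integrable_mul_radialWave _ hK 1 hε,
      ← integral_add (integrable_finsetSum _ fun j _ => integrable_mul_radialWave _ hK 1 hε)
        ((hw 1).const_mul _)]
    refine integral_congr_ae (Eventually.of_forall fun x => ?_)
    simp only [helmholtz, _root_.add_apply, _root_.smul_apply, smul_eq_mul, Finset.sum_mul,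
      _root_.sum_apply, add_mul, mul_assoc]
  have hint : ∀ j : Fin 3, Integrable fun x => φ x * (Complex.I * K * radialWave K 2 (regNorm ε x) -
          radialWave K 3 (regNorm ε x) +
        ((x j ^ 2 : ℝ) : ℂ) * (-K ^ 2 * radialWave K 3 (regNorm ε x) -
          3 * Complex.I * K * radialWave K 4 (regNorm ε x) +
          3 * radialWave K 5 (regNorm ε x))) := fun j => by
    have h3 := (integrable_mul_sq_radialWave φ hK 1 hε j).const_mul (-K ^ 2)
    have h4 := (integrable_mul_sq_radialWave φ hK 2 hε j).const_mul (3 * Complex.I * K)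
    have h5 := (integrable_mul_sq_radialWave φ hK 3 hε j).const_mul 3
    refine ((((hw 2).const_mul (Complex.I * K)).sub (hw 3)).add ((h3.sub h4).add h5)).congr
      (Eventually.of_forall fun x => ?_)
    simp only [Pi.add_apply, Pi.sub_apply]
    ring
  have hstep : ∀ j : Fin 3, ∫ x, (∂_{basisVec j} (∂_{basisVec j} φ)) x *
      radialWave K 1 (regNorm ε x) = ∫ x, φ x * (Complex.I * K * radialWave K 2 (regNorm ε x) -
          radialWave K 3 (regNorm ε x) +
        ((x j ^ 2 : ℝ) : ℂ) * (-K ^ 2 * radialWave K 3 (regNorm ε x) -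
          3 * Complex.I * K * radialWave K 4 (regNorm ε x) +
          3 * radialWave K 5 (regNorm ε x))) := fun j => by
    rw [integral_lineDeriv_lineDeriv_mul_radialWave φ _ hK hε]
    simp only [basisVec_norm, inner_basisVec, one_pow, Complex.ofReal_one, one_mul]
  rw [hsum]
  simp only [hstep]
  rw [← integral_finsetSum _ fun j _ => hint j,
    ← integral_add (integrable_finsetSum _ fun j _ => hint j) ((hw 1).const_mul _),
    ← integral_sub]
  · refine integral_congr_ae (Eventually.of_forall fun x => ?_)
    have hR := (regNorm_pos hε x).ne'
    have hsq : ((x 0 : ℝ) : ℂ) ^ 2 + (x 1 : ℂ) ^ 2 + (x 2 : ℂ) ^ 2 =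
        (regNorm ε x : ℂ) ^ 2 - (ε : ℂ) ^ 2 := by
      have h := sq_regNorm ε x
      rw [EuclideanSpace.norm_sq_eq, Fin.sum_univ_three] at h
      simp only [Real.norm_eq_abs, sq_abs] at h
      rw [eq_sub_iff_add_eq]
      exact_mod_cast h.symm
    simp only [Fin.sum_univ_three]
    rw [radialWave_eq_mul K 1 hR, radialWave_eq_mul K 2 hR, radialWave_eq_mul K 3 hR,
      radialWave_eq_mul K 4 hR]
    push_cast
    linear_combination φ x * (-K ^ 2 * (regNorm ε x) ^ 2 - 3 * Complex.I * K * regNorm ε x + 3) *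
      radialWave K 5 (regNorm ε x) * hsq
  · refine (((hw 3).const_mul ((ε : ℂ) ^ 2 * K ^ 2)).add
      ((hw 4).const_mul ((ε : ℂ) ^ 2 * (3 * Complex.I * K)))).congr
      (Eventually.of_forall fun x => ?_)
    simp only [Pi.add_apply]
    ring
  · refine ((hw 5).const_mul ((ε : ℂ) ^ 2 * 3)).congr (Eventually.of_forall fun x => ?_)
    ring

lemma finrank_space : Module.finrank ℝ Space = 3 := by simp

lemma integral_sq_div_sqrt_pow :
    ∫ r in Ioi (0 : ℝ), r ^ 2 * (√(r ^ 2 + 1 ^ 2) ^ 5)⁻¹ = 1 / 3 := by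
  have hs : ∀ r : ℝ, 0 < √(r ^ 2 + 1 ^ 2) := fun r => Real.sqrt_pos.2 (by positivity)
  -- An antiderivative of the integrand is `(r / √(r² + 1))³ / 3`.
  have h := integral_Ioi_of_hasDerivAt_of_nonneg'
    (g := fun r : ℝ => (r / √(r ^ 2 + 1 ^ 2)) ^ 3 / 3)
    (g' := fun r => r ^ 2 * (√(r ^ 2 + 1 ^ 2) ^ 5)⁻¹) (a := 0) (l := 1 ^ 3 / 3) ?_ ?_ ?_
  · rw [h]
    norm_num
  · intro r _
    have hs' := hs r
    have hsq : √(r ^ 2 + 1 ^ 2) ^ 2 = r ^ 2 + 1 ^ 2 := Real.sq_sqrt (by positivity)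
    have h1 : HasDerivAt (fun r : ℝ => √(r ^ 2 + 1 ^ 2)) (r / √(r ^ 2 + 1 ^ 2)) r := by
      refine (((hasDerivAt_pow 2 r).add_const (1 ^ 2)).sqrt (by positivity)).congr_deriv ?_
      field_simp
      simp
    refine ((((hasDerivAt_id r).div h1 hs'.ne').fun_pow 3).div_const 3).congr_deriv ?_
    simp only [id, Pi.div_apply]
    generalize √(r ^ 2 + 1 ^ 2) = s at hs' hsq
    field_simp
    rw [hsq]
    norm_num
    rw [div_pow, hsq]
    field_simp
  · intro r _
    positivity
  · have h1 : Tendsto (fun r : ℝ => √(1 - (r ^ 2 + 1 ^ 2)⁻¹)) atTop (𝓝 √(1 - 0)) := by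
      refine Tendsto.sqrt (tendsto_const_nhds.sub (tendsto_inv_atTop_zero.comp ?_))
      exact tendsto_atTop_add_const_right _ _ (tendsto_pow_atTop two_ne_zero)
    rw [sub_zero, Real.sqrt_one] at h1
    refine ((h1.congr' ?_).pow 3).div_const 3
    filter_upwards [eventually_ge_atTop 0] with r hr
    have h2 : r / √(r ^ 2 + 1 ^ 2) = √(r ^ 2 / (r ^ 2 + 1 ^ 2)) := by
      rw [Real.sqrt_div (sq_nonneg r), Real.sqrt_sq hr]
    rw [h2]
    congr 1
    field_simp
    ring

lemma integral_inv_regNorm_one_pow : ∫ x : Space, (regNorm 1 x ^ 5)⁻¹ = 4 * Real.pi / 3 := by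
  have h := integral_fun_norm_addHaar (volume : Measure Space)
    (fun r : ℝ => (√(r ^ 2 + 1 ^ 2) ^ 5)⁻¹)
  rw [finrank_space] at h
  have hv : (volume : Measure Space).real (Metric.ball 0 1) = Real.pi * 4 / 3 := by
    rw [Measure.real, EuclideanSpace.volume_ball_fin_three]
    simp
    positivity
  rw [hv] at h
  refine h.trans ?_
  simp only [smul_eq_mul, Nat.add_one_sub_one]
  rw [integral_sq_div_sqrt_pow]
  simp
  ring

/-- A function that is not integrable has integral `0` by convention, whereas this integral is
`4π/3`. -/
lemma integrable_inv_regNorm_one_pow : Integrable fun x : Space => (regNorm 1 x ^ 5)⁻¹ := by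
  refine not_imp_comm.1 integral_undef ?_
  rw [integral_inv_regNorm_one_pow]
  positivity

lemma integrable_norm_mul_inv_norm_pow (ψ : 𝓢(Space, ℂ)) {n : ℕ} (hn : n < 3) :
    Integrable fun x => ‖ψ x‖ * (‖x‖ ^ n)⁻¹ := by
  have h := ((polyIntegrable_norm_rpow_neg (E := Space) (α := n) (by positivity)
    (by rw [finrank_space]; exact_mod_cast hn)).integrable_mul ψ).norm
  refine h.congr (Eventually.of_forall fun x => ?_)
  simp only [norm_mul, Complex.norm_real]
  rw [Real.norm_of_nonneg (by positivity), Real.rpow_neg (norm_nonneg _), Real.rpow_natCast]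

lemma ae_norm_pos : ∀ᵐ x : Space, 0 < ‖x‖ := by
  filter_upwards [Measure.ae_ne (volume : Measure Space) 0] with x hx using norm_pos_iff.2 hx

lemma tendsto_regNorm (x : Space) : Tendsto (fun ε => regNorm ε x) (𝓝[>] 0) (𝓝 ‖x‖) := by
  have h : Continuous fun ε => regNorm ε x := by
    unfold regNorm
    fun_prop
  have h2 := (h.tendsto 0).mono_left (nhdsWithin_le_nhds (s := Ioi (0 : ℝ)))
  simpa [regNorm, Real.sqrt_sq] using h2

lemma tendsto_radialWave_regNorm (K : ℂ) (n : ℕ) {x : Space} (hx : 0 < ‖x‖) :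
    Tendsto (fun ε => radialWave K n (regNorm ε x)) (𝓝[>] 0) (𝓝 (radialWave K n ‖x‖)) :=
  ((hasDerivAt_radialWave K n hx.ne').continuousAt.tendsto).comp (tendsto_regNorm x)

lemma tendsto_integral_mul_radialWave (ψ : 𝓢(Space, ℂ)) {K : ℂ} (hK : 0 ≤ K.im) :
    Tendsto (fun ε => ∫ x, ψ x * radialWave K 1 (regNorm ε x)) (𝓝[>] 0)
      (𝓝 (∫ x, ψ x * radialWave K 1 ‖x‖)) := by
  refine tendsto_integral_filter_of_dominated_convergence _ ?_ ?_
    (integrable_norm_mul_inv_norm_pow ψ (n := 1) (by norm_num)) ?_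
  · filter_upwards [self_mem_nhdsWithin] with ε hε
    exact (integrable_mul_radialWave ψ hK 1 hε).aestronglyMeasurable
  · filter_upwards [self_mem_nhdsWithin] with ε hε
    filter_upwards [ae_norm_pos] with x hx
    rw [norm_mul]
    have := norm_le_regNorm ε x
    gcongr
    refine (norm_radialWave_le hK 1 (regNorm_pos hε x)).trans ?_
    gcongr
  · filter_upwards [ae_norm_pos] with x hx
    exact (tendsto_radialWave_regNorm K 1 hx).const_mul _

/-- Bounding `ε²` by `R²` lowers the singularities to `|x|⁻¹` and `|x|⁻²`, integrable in dimension
three, while the integrand tends to `0` for `x ≠ 0`. -/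
lemma tendsto_integral_radialWave_remainder (φ : 𝓢(Space, ℂ)) {K : ℂ} (hK : 0 ≤ K.im) :
    Tendsto (fun ε : ℝ => ∫ x, φ x * ((ε : ℂ) ^ 2 * (K ^ 2 * radialWave K 3 (regNorm ε x) +
          3 * Complex.I * K * radialWave K 4 (regNorm ε x)))) (𝓝[>] 0) (𝓝 0) := by
  have h0 : (0 : ℂ) = ∫ _ : Space, (0 : ℂ) := by simp
  rw [h0]
  refine tendsto_integral_filter_of_dominated_convergence
    (fun x => ‖K‖ ^ 2 * (‖φ x‖ * (‖x‖ ^ 1)⁻¹) + 3 * ‖K‖ * (‖φ x‖ * (‖x‖ ^ 2)⁻¹)) ?_ ?_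
    (((integrable_norm_mul_inv_norm_pow φ (n := 1) (by norm_num)).const_mul _).add
      ((integrable_norm_mul_inv_norm_pow φ (n := 2) (by norm_num)).const_mul _)) ?_
  · filter_upwards [self_mem_nhdsWithin] with ε hε
    have h3 := continuous_radialWave_regNorm K 3 hε
    have h4 := continuous_radialWave_regNorm K 4 hε
    have hφ := φ.continuous
    exact Continuous.aestronglyMeasurable (by fun_prop)
  · filter_upwards [self_mem_nhdsWithin] with ε hε
    filter_upwards [ae_norm_pos] with x hx
    have hε' : 0 < ε := hε
    have hR := regNorm_pos hε x
    have hRε := le_regNorm ε x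
    have hRx := norm_le_regNorm ε x
    calc _ ≤ ‖φ x‖ * (regNorm ε x ^ 2 * (‖K‖ ^ 2 * (regNorm ε x ^ 3)⁻¹ +
            3 * ‖K‖ * (regNorm ε x ^ 4)⁻¹)) := by
          rw [norm_mul, norm_mul, norm_pow, Complex.norm_real, Real.norm_of_nonneg hε'.le]
          gcongr
          refine (norm_add_le _ _).trans (add_le_add ?_ ?_)
          · rw [norm_mul, norm_pow]
            gcongr
            exact norm_radialWave_le hK 3 hR
          · simp only [norm_mul, Complex.norm_I, mul_one, Complex.norm_ofNat]
            gcongr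
            exact norm_radialWave_le hK 4 hR
      _ = ‖K‖ ^ 2 * (‖φ x‖ * (regNorm ε x ^ 1)⁻¹) +
            3 * ‖K‖ * (‖φ x‖ * (regNorm ε x ^ 2)⁻¹) := by field_simp
      _ ≤ _ := by gcongr
  · filter_upwards [ae_norm_pos] with x hx
    have hε : Tendsto (fun ε : ℝ => (ε : ℂ) ^ 2) (𝓝[>] 0) (𝓝 0) := by
      have h : Continuous fun ε : ℝ => (ε : ℂ) ^ 2 := by fun_prop
      simpa using (h.tendsto 0).mono_left (nhdsWithin_le_nhds (s := Ioi (0 : ℝ)))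
    have h := (hε.mul (((tendsto_radialWave_regNorm K 3 hx).const_mul (K ^ 2)).add
      ((tendsto_radialWave_regNorm K 4 hx).const_mul (3 * Complex.I * K)))).const_mul (φ x)
    simpa using h

lemma regNorm_smul {ε : ℝ} (hε : 0 < ε) (y : Space) : regNorm ε (ε • y) = ε * regNorm 1 y := by
  rw [regNorm, regNorm, norm_smul, Real.norm_of_nonneg hε.le, ← Real.sqrt_sq hε.le,
    ← Real.sqrt_mul (sq_nonneg ε), Real.sqrt_sq hε.le]
  congr 1
  ring

/-- The substitution `x = εy` removes all powers of `ε`, as `ε² ε³ ε⁻⁵ = 1`. The limit is `3 φ(0) ∫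
(1 + |y|²)^(-5/2) = 4π φ(0)`. -/
lemma tendsto_integral_radialWave_main (φ : 𝓢(Space, ℂ)) {K : ℂ} (hK : 0 ≤ K.im) :
    Tendsto (fun ε : ℝ => ∫ x, φ x * ((ε : ℂ) ^ 2 * (3 * radialWave K 5 (regNorm ε x))))
      (𝓝[>] 0) (𝓝 (4 * Real.pi * φ 0)) := by
  have hscale : ∀ ε ∈ Ioi (0 : ℝ),
      ∫ y, 3 * (φ (ε • y) * (Complex.exp (Complex.I * K * ((ε * regNorm 1 y : ℝ) : ℂ)) *
        (((regNorm 1 y ^ 5)⁻¹ : ℝ) : ℂ))) =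
      ∫ x, φ x * ((ε : ℂ) ^ 2 * (3 * radialWave K 5 (regNorm ε x))) := fun ε hε => by
    have hε' : 0 < ε := hε
    have h := Measure.integral_comp_smul (volume : Measure Space)
      (fun x => φ x * ((ε : ℂ) ^ 2 * (3 * radialWave K 5 (regNorm ε x)))) ε
    rw [finrank_space, abs_of_nonneg (by positivity)] at h
    have h2 : ∫ x, φ x * ((ε : ℂ) ^ 2 * (3 * radialWave K 5 (regNorm ε x))) =
        ε ^ 3 • ∫ y, φ (ε • y) * ((ε : ℂ) ^ 2 * (3 * radialWave K 5 (regNorm ε (ε • y)))) := by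
      rw [h, smul_smul, mul_inv_cancel₀ (by positivity), one_smul]
    rw [h2, ← integral_smul]
    refine integral_congr_ae (Eventually.of_forall fun y => ?_)
    have hS : ((regNorm 1 y : ℝ) : ℂ) ≠ 0 :=
      Complex.ofReal_ne_zero.2 (regNorm_pos one_pos y).ne'
    have hεc : (ε : ℂ) ≠ 0 := Complex.ofReal_ne_zero.2 hε'.ne'
    simp only [regNorm_smul hε', radialWave, Complex.real_smul]
    push_cast
    field_simp
  have hlim : 4 * Real.pi * φ 0 = ∫ y : Space, 3 * (φ 0 * (1 * (((regNorm 1 y ^ 5)⁻¹ : ℝ) : ℂ))) := by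
    simp only [integral_const_mul, one_mul]
    rw [integral_complex_ofReal, integral_inv_regNorm_one_pow]
    push_cast
    ring
  rw [hlim]
  refine Tendsto.congr' (f₁ := fun ε : ℝ => ∫ y, 3 * (φ (ε • y) *
    (Complex.exp (Complex.I * K * ((ε * regNorm 1 y : ℝ) : ℂ)) *
        (((regNorm 1 y ^ 5)⁻¹ : ℝ) : ℂ)))) (eventually_of_mem self_mem_nhdsWithin hscale) ?_
  have hc1 := continuous_regNorm 1
  have hφ := φ.continuous
  have hc5 : Continuous fun y : Space => (regNorm 1 y ^ 5)⁻¹ :=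
    (hc1.pow 5).inv₀ fun y => (pow_pos (regNorm_pos one_pos y) 5).ne'
  refine tendsto_integral_filter_of_dominated_convergence
    (fun y => 3 * (SchwartzMap.seminorm ℝ 0 0 φ * (1 * (regNorm 1 y ^ 5)⁻¹))) ?_ ?_
    (((integrable_inv_regNorm_one_pow.const_mul 1).const_mul _).const_mul 3) ?_
  · refine Eventually.of_forall fun ε => Continuous.aestronglyMeasurable ?_
    fun_prop
  · filter_upwards [self_mem_nhdsWithin] with ε hε
    refine Eventually.of_forall fun y => ?_
    have hε' : 0 < ε := hε
    have hS := regNorm_pos one_pos y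
    rw [norm_mul, norm_mul, norm_mul, Complex.norm_real, Complex.norm_ofNat,
      Real.norm_of_nonneg (by positivity)]
    gcongr
    · exact SchwartzMap.norm_le_seminorm ℝ φ _
    · exact norm_cexp_I_mul_le hK (by positivity)
  · refine Eventually.of_forall fun y => ?_
    have h : Continuous fun ε : ℝ => 3 * (φ (ε • y) *
      (Complex.exp (Complex.I * K * ((ε * regNorm 1 y : ℝ) : ℂ)) *
        (((regNorm 1 y ^ 5)⁻¹ : ℝ) : ℂ))) := by fun_prop
    simpa using (h.tendsto 0).mono_left (nhdsWithin_le_nhds (s := Ioi (0 : ℝ)))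

/-- `exp(i K ‖x‖) / ‖x‖` is a fundamental solution of the Helmholtz equation. -/
theorem integral_helmholtz_mul (φ : 𝓢(Space, ℂ)) {K : ℂ} (hK : 0 ≤ K.im) :
    ∫ x, helmholtz K φ x * radialWave K 1 ‖x‖ = -(4 * Real.pi * φ 0) := by
  refine tendsto_nhds_unique (tendsto_integral_mul_radialWave (helmholtz K φ) hK) ?_
  have h := (tendsto_integral_radialWave_remainder φ hK).sub
    (tendsto_integral_radialWave_main φ hK)
  rw [zero_sub] at h
  refine h.congr' (eventually_of_mem self_mem_nhdsWithin fun ε hε => ?_)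
  exact (integral_helmholtz_mul_radialWave φ hK hε).symm

/-! ### Anisotropic Helmholtz operators by scaling of the coordinates -/

/-- The diagonal scaling of the coordinates. -/
def diagScale (b : Fin 3 → ℝ) (hb : ∀ j, b j ≠ 0) : Space ≃L[ℝ] Space :=
  LinearEquiv.toContinuousLinearEquiv
    { toFun := fun x => WithLp.toLp 2 fun j => b j * x j
      invFun := fun x => WithLp.toLp 2 fun j => (b j)⁻¹ * x j
      map_add' := fun x y => by ext j; simp [mul_add]
      map_smul' := fun r x => by ext j; simp; ring
      left_inv := fun x => by ext j; simp [hb j]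
      right_inv := fun x => by ext j; simp [hb j] }

@[simp] lemma diagScale_apply (b : Fin 3 → ℝ) (hb : ∀ j, b j ≠ 0) (x : Space) (j : Fin 3) :
    diagScale b hb x j = b j * x j := rfl

lemma diagScale_basisVec (b : Fin 3 → ℝ) (hb : ∀ j, b j ≠ 0) (j : Fin 3) :
    diagScale b hb (basisVec j) = b j • basisVec j := by
  ext k
  rw [diagScale_apply]
  by_cases h : k = j
  · subst h
    simp [basisVec]
  · simp [basisVec, h]

lemma det_diagScale (b : Fin 3 → ℝ) (hb : ∀ j, b j ≠ 0) :
    (diagScale b hb : Space →L[ℝ] Space).det = ∏ j, b j := by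
  set e := (EuclideanSpace.basisFun (Fin 3) ℝ).toBasis
  have h : LinearMap.toMatrix e e ((diagScale b hb : Space →L[ℝ] Space) : Space →ₗ[ℝ] Space) =
      Matrix.diagonal b := by
    ext i j
    rw [LinearMap.toMatrix_apply, Matrix.diagonal_apply]
    have h1 : e j = basisVec j := by simp [e, basisVec]
    rw [h1]
    change diagScale b hb (basisVec j) i = _
    rw [diagScale_apply]
    by_cases hij : i = j
    · subst hij
      simp [basisVec]
    · simp [basisVec, hij]
  rw [ContinuousLinearMap.det, ← LinearMap.det_toMatrix e, h, Matrix.det_diagonal]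

lemma integral_comp_diagScale (b : Fin 3 → ℝ) (hb : ∀ j, 0 < b j) (g : Space → ℂ) :
    ∫ x, g x = (((∏ j, b j : ℝ)) : ℂ) * ∫ y, g (diagScale b (fun j => (hb j).ne') y) := by
  set D := diagScale b fun j => (hb j).ne'
  have h := integral_image_eq_integral_abs_det_fderiv_smul (volume : Measure Space)
    (f := D) (f' := fun _ => (D : Space →L[ℝ] Space)) MeasurableSet.univ
    (fun x _ => D.hasFDerivAt.hasFDerivWithinAt) D.injective.injOn g
  rw [image_univ, D.surjective.range_eq, setIntegral_univ, setIntegral_univ] at h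
  rw [h, det_diagScale, abs_of_pos (Finset.prod_pos fun j _ => hb j), integral_smul,
    Complex.real_smul]

/-- The ellipsoidal norm with semi-axes `b`. -/
def ellipNorm (b : Fin 3 → ℝ) (x : Space) : ℝ := √(∑ j, x j ^ 2 / b j ^ 2)

lemma ellipNorm_diagScale (b : Fin 3 → ℝ) (hb : ∀ j, 0 < b j) (y : Space) :
    ellipNorm b (diagScale b (fun j => (hb j).ne') y) = ‖y‖ := by
  rw [ellipNorm, EuclideanSpace.norm_eq]
  congr 1
  refine Finset.sum_congr rfl fun j _ => ?_
  have := (hb j).ne'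
  rw [diagScale_apply, Real.norm_eq_abs, sq_abs]
  field_simp

lemma exists_mul_norm_le_ellipNorm (b : Fin 3 → ℝ) (hb : ∀ j, 0 < b j) :
    ∃ C, 0 < C ∧ ∀ x, ‖x‖ ≤ C * ellipNorm b x := by
  set D := diagScale b fun j => (hb j).ne'
  refine ⟨‖(D : Space →L[ℝ] Space)‖ + 1, by positivity, fun x => ?_⟩
  have h := (D : Space →L[ℝ] Space).le_opNorm (D.symm x)
  have h2 : ellipNorm b x = ‖D.symm x‖ := by
    rw [← ellipNorm_diagScale b hb (D.symm x)]
    change _ = ellipNorm b (D (D.symm x))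
    rw [D.apply_symm_apply]
  rw [h2]
  have h3 : (D : Space →L[ℝ] Space) (D.symm x) = x := D.apply_symm_apply x
  rw [h3] at h
  nlinarith [norm_nonneg (D.symm x)]

lemma continuous_ellipNorm (b : Fin 3 → ℝ) : Continuous (ellipNorm b) := by
  unfold ellipNorm
  fun_prop

/-- The substitution `x = D y` with `D = diag(b)` turns `∑ b j² ∂ⱼ²` into the Laplacian and the
ellipsoidal norm into the Euclidean one; its Jacobian is the product of the `b j`. -/
theorem integral_anisotropic_helmholtz_mul (b : Fin 3 → ℝ) (hb : ∀ j, 0 < b j) (φ : 𝓢(Space, ℂ))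
    {K : ℂ} (hK : 0 ≤ K.im) :
    ∫ x, ((∑ j, ((b j ^ 2 : ℝ) : ℂ) * (∂_{basisVec j} (∂_{basisVec j} φ)) x) + K ^ 2 * φ x) *
      radialWave K 1 (ellipNorm b x) = -(4 * Real.pi * (∏ j, b j : ℝ) * φ 0) := by
  set D := diagScale b fun j => (hb j).ne' with hD
  set T := SchwartzMap.compCLMOfContinuousLinearEquiv ℂ (F := ℂ) D
  have hT : ∀ (ψ : 𝓢(Space, ℂ)) (j : Fin 3), ∂_{basisVec j} (T ψ) = (b j : ℂ) •
      T (∂_{basisVec j} ψ) := fun ψ j => by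
    rw [SchwartzMap.lineDerivOp_compCLMOfContinuousLinearEquiv, hD, diagScale_basisVec,
      LineDerivLeftSMul.lineDerivOp_left_smul, ← Complex.coe_smul, map_smul]
  have h := integral_helmholtz_mul (T φ) hK
  have h0 : T φ 0 = φ 0 := by
    change φ (D 0) = _
    rw [map_zero]
  have hkey : ∫ y, ((∑ j, ((b j ^ 2 : ℝ) : ℂ) * (∂_{basisVec j} (∂_{basisVec j} φ)) (D y)) +
      K ^ 2 * φ (D y)) * radialWave K 1 (ellipNorm b (D y)) =
      ∫ x, helmholtz K (T φ) x * radialWave K 1 ‖x‖ := by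
    refine integral_congr_ae (Eventually.of_forall fun y => ?_)
    have hy : ∀ ψ : 𝓢(Space, ℂ), T ψ y = ψ (D y) := fun ψ => rfl
    simp only [helmholtz, hT, LineDerivSMul.lineDerivOp_smul, smul_smul, _root_.add_apply, _root_.sum_apply,
      _root_.smul_apply, smul_eq_mul, hy]
    rw [ellipNorm_diagScale b hb]
    push_cast
    simp only [pow_two]
  rw [integral_comp_diagScale b hb, hkey, h, h0]
  ring

/-! ### Solving the Helmholtz equation in the Schwartz space -/

section Solve

variable {E : Type} [NormedAddCommGroup E] [NormedSpace ℝ E]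

lemma hasTemperateGrowth_quadForm (A : Fin 3 → ℝ) :
    (fun q : E × Space => ((∑ j, A j * q.2 j ^ 2 : ℝ) : ℂ)).HasTemperateGrowth := by
  have hj : ∀ j : Fin 3, (fun q : E × Space => q.2 j).HasTemperateGrowth := fun j => by
    convert ((innerSL ℝ (basisVec j)).comp
      (ContinuousLinearMap.snd ℝ E Space)).hasTemperateGrowth using 1
    ext q
    simp [real_inner_comm, inner_basisVec]
  have hs : (fun q : E × Space => ∑ j, A j * q.2 j ^ 2).HasTemperateGrowth :=
    Function.HasTemperateGrowth.sum fun j _ =>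
      (Function.HasTemperateGrowth.const (A j)).mul ((hj j).pow 2)
  exact Complex.ofRealCLM.hasTemperateGrowth.comp hs

/-- Solvability of the Helmholtz equation with a parameter. -/
theorem exists_helmholtz_solution {A : Fin 3 → ℝ} (hA : ∀ j, 0 ≤ A j) {κ : E → ℂ}
    (hκ : κ.HasTemperateGrowth) {c : ℝ} (hc : 0 < c) (h : ∀ x, ∀ r : ℝ, 0 ≤ r → c ≤ ‖κ x - r‖)
    (p : 𝓢(E × Space, ℂ)) : ∃ P : 𝓢(E × Space, ℂ),
      (∀ q : E × Space, (∑ j, (A j : ℂ) *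
        (∂_{((0, basisVec j) : E × Space)} (∂_{((0, basisVec j) : E × Space)} P)) q) +
          κ q.1 * P q = p q) ∧
      ∀ x, (∀ y, p (x, y) = 0) → ∀ y, P (x, y) = 0 := by
  -- The Fourier multiplier of the operator. The distance from `κ` to `[0, ∞)` bounds it below, so
  -- its reciprocal is a multiplier of Schwartz functions.
  set s : E × Space → ℂ := fun q => κ q.1 - ((∑ j, A j * q.2 j ^ 2 : ℝ) : ℂ) with hs
  have hst : s.HasTemperateGrowth :=
    (hκ.comp (ContinuousLinearMap.fst ℝ E Space).hasTemperateGrowth).sub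
      (hasTemperateGrowth_quadForm A)
  have hsc : ∀ q, c ≤ ‖s q‖ := fun q =>
    h q.1 _ (Finset.sum_nonneg fun j _ => mul_nonneg (hA j) (sq_nonneg _))
  have hs0 : ∀ q, s q ≠ 0 := fun q hq => by
    have := hsc q
    rw [hq, norm_zero] at this
    linarith
  have hinv := hasTemperateGrowth_inv hst hc hsc
  set F₁ := partialFourier (E := E) (F := Space) (one_ne_zero (α := ℝ))
  set F₂ := partialFourier (E := E) (F := Space) (neg_ne_zero.2 (one_ne_zero (α := ℝ))) with hF₂
  -- Division happens in the fibre over each `x`, so a fibre on which `p` vanishes gives a zero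
  -- solution there.
  set u := SchwartzMap.smulLeftCLM ℂ (fun q => (s q)⁻¹) (F₁ p) with hu
  have huq : ∀ q, u q = (s q)⁻¹ * F₁ p q := fun q => by
    rw [hu, SchwartzMap.smulLeftCLM_apply_apply hinv, smul_eq_mul]
  set C : ℂ := (((|2 * Real.pi / 1| ^ Module.finrank ℝ Space : ℝ)) : ℂ)
  have hC : C ≠ 0 := Complex.ofReal_ne_zero.2 (by positivity)
  refine ⟨C⁻¹ • F₂ u, fun ⟨x, y⟩ => ?_, fun x hx y => ?_⟩
  · have hd : ∀ j, (∂_{((0, basisVec j) : E × Space)} (∂_{((0, basisVec j) : E × Space)}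
        (C⁻¹ • F₂ u))) = C⁻¹ • F₂ (mulSnd (-1) (basisVec j) (mulSnd (-1) (basisVec j) u)) :=
      fun j => by
        rw [LineDerivSMul.lineDerivOp_smul, LineDerivSMul.lineDerivOp_smul, hF₂,
          lineDeriv_snd_partialFourier, lineDeriv_snd_partialFourier]
    have hinvF : F₂ (F₁ p) = C • p := partialFourier_neg_partialFourier one_ne_zero p
    have hκu : κ x * F₂ u (x, y) = ∫ ξ, phase (-1) ξ y * (κ x * u (x, ξ)) := by
      rw [hF₂, partialFourier_apply, ← integral_const_mul]
      refine integral_congr_ae (Eventually.of_forall fun ξ => ?_)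
      simp only
      ring
    have hku : Integrable fun ξ => phase (-1) ξ y * (κ x * u (x, ξ)) :=
      ((integrable_phase_smul_slice (-1) u x y).const_mul (κ x)).congr
        (Eventually.of_forall fun ξ => by simp only [smul_eq_mul]; ring)
    have hmain : (∑ j, (A j : ℂ) * F₂ (mulSnd (-1) (basisVec j) (mulSnd (-1) (basisVec j) u))
        (x, y)) + κ x * F₂ u (x, y) = F₂ (F₁ p) (x, y) := by
      rw [hκu, hF₂]
      simp only [partialFourier_apply, ← integral_const_mul]
      rw [← integral_finsetSum, ← integral_add _ hku]
      · refine integral_congr_ae (Eventually.of_forall fun ξ => ?_)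
        have hF : F₁ p (x, ξ) = s (x, ξ) * u (x, ξ) := by
          rw [huq, mul_inv_cancel_left₀ (hs0 _)]
        simp only [mulSnd_apply, inner_basisVec]
        rw [hF, hs]
        push_cast
        simp only [sub_mul, Finset.sum_mul, mul_sub, Finset.mul_sum]
        rw [add_comm, sub_eq_add_neg, ← Finset.sum_neg_distrib]
        congr 1
        refine Finset.sum_congr rfl fun j _ => ?_
        linear_combination (A j * phase (-1) ξ y * (ξ j : ℂ) ^ 2 * u (x, ξ)) * Complex.I_sq
      · exact integrable_finsetSum _ fun j _ => (integrable_phase_smul_slice (-1)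
          (mulSnd (-1) (basisVec j) (mulSnd (-1) (basisVec j) u)) x y).const_mul _
      · exact fun j _ => (integrable_phase_smul_slice (-1)
          (mulSnd (-1) (basisVec j) (mulSnd (-1) (basisVec j) u)) x y).const_mul _
    simp only [hd, _root_.smul_apply, smul_eq_mul]
    rw [hinvF, _root_.smul_apply, smul_eq_mul] at hmain
    calc _ = C⁻¹ * ((∑ j, (A j : ℂ) *
          F₂ (mulSnd (-1) (basisVec j) (mulSnd (-1) (basisVec j) u)) (x, y)) +
            κ x * F₂ u (x, y)) := by
          rw [mul_add, Finset.mul_sum]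
          congr 1
          · exact Finset.sum_congr rfl fun j _ => by ring
          · ring
      _ = _ := by rw [hmain, inv_mul_cancel_left₀ hC]
  · rw [_root_.smul_apply, hF₂, partialFourier_apply]
    have h0 : ∀ ξ, u (x, ξ) = 0 := fun ξ => by
      have : F₁ p (x, ξ) = 0 := by
        change ∫ _, _ = _
        simp [hx]
      rw [huq, this, mul_zero]
    simp [h0]

end Solve

/-! ### The functions `Φ i` at a fixed frequency -/

lemma upperSqrt_sq (z : ℂ) : upperSqrt z ^ 2 = z := by
  have h : (z ^ (1 / 2 : ℂ)) ^ 2 = z := by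
    rw [one_div]
    exact_mod_cast Complex.cpow_nat_inv_pow z two_ne_zero
  rw [upperSqrt]
  split_ifs
  · exact h
  · rw [neg_sq, h]

lemma upperSqrt_im_nonneg (z : ℂ) : 0 ≤ (upperSqrt z).im := by
  rw [upperSqrt]
  split_ifs with h
  · exact h
  · rw [Complex.neg_im]
    linarith

lemma measurable_upperSqrt : Measurable upperSqrt := by
  have h : Measurable fun z : ℂ => z ^ (1 / 2 : ℂ) := by fun_prop
  unfold upperSqrt
  exact Measurable.ite (measurableSet_le measurable_const (Complex.measurable_im.comp h)) h h.neg

/-- The operator `∑ j, A j ∂ⱼ² + κ`. -/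
def modeOp (A : Fin 3 → ℝ) (κ : ℂ) (φ : 𝓢(Space, ℂ)) : 𝓢(Space, ℂ) :=
  (∑ j, (A j : ℂ) • ∂_{basisVec j} (∂_{basisVec j} φ)) + κ • φ

lemma modeOp_apply (A : Fin 3 → ℝ) (κ : ℂ) (φ : 𝓢(Space, ℂ)) (x : Space) :
    modeOp A κ φ x = (∑ j, (A j : ℂ) * (∂_{basisVec j} (∂_{basisVec j} φ)) x) + κ * φ x := by
  simp [modeOp]

/-- A Schwartz solution of the Helmholtz equation at a wave number off the real axis. -/
lemma exists_modeOp_eq {A : Fin 3 → ℝ} (hA : ∀ j, 0 ≤ A j) {κ : ℂ} (hκ : κ.im ≠ 0)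
    (φ : 𝓢(Space, ℂ)) : ∃ P, modeOp A κ P = φ := by
  -- The equation without parameter is the case of a zero-dimensional parameter space.
  set e : ((Fin 0 → ℝ) × Space) ≃L[ℝ] Space := ContinuousLinearEquiv.uniqueProd ℝ Space (Fin 0 → ℝ)
  obtain ⟨P, hP, -⟩ := exists_helmholtz_solution hA
    (Function.HasTemperateGrowth.const (E := Fin 0 → ℝ) κ) (abs_pos.2 hκ)
    (fun _ r _ => by simpa using Complex.abs_im_le_norm (κ - r))
    (SchwartzMap.compCLMOfContinuousLinearEquiv ℂ e φ)
  refine ⟨SchwartzMap.compCLMOfContinuousLinearEquiv ℂ e.symm P, ?_⟩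
  ext y
  have he : ∀ y, e.symm y = (0, y) := fun y => Prod.ext (Subsingleton.elim _ _) rfl
  rw [modeOp_apply]
  simp only [SchwartzMap.lineDerivOp_compCLMOfContinuousLinearEquiv, he]
  have h := hP (e.symm y)
  refine h.trans ?_
  change φ (e (e.symm y)) = φ y
  rw [e.apply_symm_apply]

section Mode

variable {c : Matrix (Fin 6) (Fin 6) ℝ} {ρ : ℝ} {β : Fin 3 → ℝ} {a : ℝ → ℂ} {i : Fin 3}

lemma modeSpeeds_eq (c : Matrix (Fin 6) (Fin 6) ℝ) (ρ : ℝ) (i j : Fin 3) :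
    modeSpeeds c ρ i j = √(eigenCoeff c i j / ρ) := by
  fin_cases i <;> fin_cases j <;> rfl

lemma modeSpeeds_pos (hρ : 0 < ρ) (hc : ∀ i j, 0 < eigenCoeff c i j) (i j : Fin 3) :
    0 < modeSpeeds c ρ i j := by
  rw [modeSpeeds_eq]
  exact Real.sqrt_pos.2 (div_pos (hc i j) hρ)

lemma mul_sq_modeSpeeds (hρ : 0 < ρ) (hc : ∀ i j, 0 < eigenCoeff c i j) (i j : Fin 3) :
    ρ * modeSpeeds c ρ i j ^ 2 = eigenCoeff c i j := by
  rw [modeSpeeds_eq, Real.sq_sqrt (div_pos (hc i j) hρ).le]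
  field_simp

lemma phi_eq (c : Matrix (Fin 6) (Fin 6) ℝ) (ρ : ℝ) (β : Fin 3 → ℝ) (a : ℝ → ℂ) (i : Fin 3)
    (x : Space) (ω : ℝ) : phi c ρ β a i x ω =
      (1 - (β i : ℂ) * a ω) / (4 * Real.pi * ρ * ((∏ j, modeSpeeds c ρ i j : ℝ) : ℂ)) *
        radialWave (waveNumber β a i ω) 1 (ellipNorm (modeSpeeds c ρ i) x) := by
  rw [phi, radialWave, pow_one, div_mul_div_comm]
  rfl

/-- The coefficient `ρ ω² (1 - β Â(ω))` of the Helmholtz equation. -/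
def helmholtzCoeff (ρ : ℝ) (β : Fin 3 → ℝ) (a : ℝ → ℂ) (i : Fin 3) (ω : ℝ) : ℂ :=
  (ρ : ℂ) * (ω : ℂ) ^ 2 * (1 - (β i : ℂ) * a ω)

lemma waveNumber_sq (β : Fin 3 → ℝ) (a : ℝ → ℂ) (i : Fin 3) (ω : ℝ) :
    (ρ : ℂ) * waveNumber β a i ω ^ 2 = helmholtzCoeff ρ β a i ω := by
  rw [waveNumber, upperSqrt_sq, helmholtzCoeff]
  ring

/-- Since `L i` has coefficients `ρ b j²` and `ρ K²` is the Helmholtz coefficient, the operator is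
`ρ` times the anisotropic one with speeds `b j` and wave number `K`. -/
theorem integral_modeOp_mul_phi (hρ : 0 < ρ) (hc : ∀ i j, 0 < eigenCoeff c i j)
    (φ : 𝓢(Space, ℂ)) (ω : ℝ) :
    ∫ x, modeOp (eigenCoeff c i) (helmholtzCoeff ρ β a i ω) φ x * phi c ρ β a i x ω =
      -(1 - (β i : ℂ) * a ω) * φ 0 := by
  have hb := modeSpeeds_pos hρ hc i
  have h := integral_anisotropic_helmholtz_mul (modeSpeeds c ρ i) hb φ
    (K := waveNumber β a i ω) (upperSqrt_im_nonneg _)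
  have hprod : (((∏ j, modeSpeeds c ρ i j : ℝ)) : ℂ) ≠ 0 :=
    Complex.ofReal_ne_zero.2 (Finset.prod_pos fun j _ => hb j).ne'
  have hρ' : (ρ : ℂ) ≠ 0 := Complex.ofReal_ne_zero.2 hρ.ne'
  have hpi : (Real.pi : ℂ) ≠ 0 := Complex.ofReal_ne_zero.2 Real.pi_ne_zero
  calc _ = ∫ x, (1 - (β i : ℂ) * a ω) / (4 * Real.pi * ((∏ j, modeSpeeds c ρ i j : ℝ) : ℂ)) *
        (((∑ j, ((modeSpeeds c ρ i j ^ 2 : ℝ) : ℂ) *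
          (∂_{basisVec j} (∂_{basisVec j} φ)) x) + waveNumber β a i ω ^ 2 * φ x) *
            radialWave (waveNumber β a i ω) 1 (ellipNorm (modeSpeeds c ρ i) x)) := by
        refine integral_congr_ae (Eventually.of_forall fun x => ?_)
        have h1 : modeOp (eigenCoeff c i) (helmholtzCoeff ρ β a i ω) φ x = ρ *
            ((∑ j, ((modeSpeeds c ρ i j ^ 2 : ℝ) : ℂ) *
          (∂_{basisVec j} (∂_{basisVec j} φ)) x) + waveNumber β a i ω ^ 2 * φ x) := by
          rw [modeOp_apply, mul_add, ← mul_assoc, waveNumber_sq, Finset.mul_sum]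
          congr 1
          refine Finset.sum_congr rfl fun j _ => ?_
          rw [← mul_sq_modeSpeeds hρ hc i j]
          push_cast
          ring
        simp only [h1, phi_eq]
        field_simp
    _ = _ := by
        rw [integral_const_mul, h]
        field_simp

/-- The exponential is bounded by `1` because `Im K ≥ 0`. The frequency enters only through `1 - β i
Â`, so the bound also gives integrability in `(x, ω)` jointly. -/
lemma exists_norm_phi_le (hρ : 0 < ρ) (hc : ∀ i j, 0 < eigenCoeff c i j) : ∃ C : ℝ, 0 ≤ C ∧
    ∀ x ω, ‖phi c ρ β a i x ω‖ ≤ C * (‖x‖ ^ (-1 : ℝ) * ‖1 - (β i : ℂ) * a ω‖) := by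
  have hb := modeSpeeds_pos hρ hc i
  obtain ⟨D, hD, h⟩ := exists_mul_norm_le_ellipNorm (modeSpeeds c ρ i) hb
  refine ⟨(4 * Real.pi * ρ * ∏ j, modeSpeeds c ρ i j)⁻¹ * D, ?_, fun x ω => ?_⟩
  · have := Finset.prod_pos fun j (_ : j ∈ Finset.univ) => hb j
    positivity
  have hp := Finset.prod_pos fun j (_ : j ∈ Finset.univ) => hb j
  rw [phi_eq, norm_mul, norm_div]
  have h1 : ‖4 * (Real.pi : ℂ) * ρ * ((∏ j, modeSpeeds c ρ i j : ℝ) : ℂ)‖ =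
      4 * Real.pi * ρ * ∏ j, modeSpeeds c ρ i j := by
    rw [norm_mul, norm_mul, norm_mul, Complex.norm_real, Complex.norm_real, Complex.norm_real,
      Complex.norm_ofNat, Real.norm_of_nonneg Real.pi_pos.le, Real.norm_of_nonneg hρ.le,
      Real.norm_of_nonneg hp.le]
  have h2 : ‖radialWave (waveNumber β a i ω) 1 (ellipNorm (modeSpeeds c ρ i) x)‖ ≤
      D * ‖x‖ ^ (-1 : ℝ) := by
    -- At `x = 0` both sides are `0`, since inverses of zero are zero.
    rcases (norm_nonneg x).eq_or_lt with hx | hx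
    · have : x = 0 := norm_eq_zero.1 hx.symm
      subst this
      simp [ellipNorm, radialWave]
    have he : 0 < ellipNorm (modeSpeeds c ρ i) x := by
      have := hx.trans_le (h x)
      exact pos_of_mul_pos_right this hD.le
    refine (norm_radialWave_le (upperSqrt_im_nonneg _) 1 he).trans ?_
    rw [pow_one, Real.rpow_neg_one, inv_le_comm₀ he (by positivity), mul_inv, inv_inv,
      inv_mul_le_iff₀ hD]
    exact h x
  rw [h1]
  calc _ ≤ ‖1 - (β i : ℂ) * a ω‖ / (4 * Real.pi * ρ * ∏ j, modeSpeeds c ρ i j) *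
        (D * ‖x‖ ^ (-1 : ℝ)) := by gcongr
    _ = _ := by field_simp

lemma PolyIntegrable.mul_prod {E F : Type*} [NormedAddCommGroup E] [MeasureSpace E]
    [BorelSpace E] [NormedAddCommGroup F] [MeasureSpace F] [BorelSpace F]
    [SecondCountableTopology E] [SecondCountableTopology F]
    [SFinite (volume : Measure E)] [SFinite (volume : Measure F)] {f : E → ℂ} {g : F → ℂ}
    (hf : PolyIntegrable f) (hg : PolyIntegrable g) :
    PolyIntegrable fun p : E × F => f p.1 * g p.2 := by
  obtain ⟨N, hN⟩ := hf
  obtain ⟨M, hM⟩ := hg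
  refine ⟨N + M, ((hN.mul_prod hM).bdd_mul (c := 1) (f := fun p : E × F =>
    (((1 + ‖p.1‖) ^ N * (1 + ‖p.2‖) ^ M * ((1 + ‖p‖) ^ (N + M))⁻¹ : ℝ) : ℂ)) ?_ ?_).congr
      (Eventually.of_forall fun p => ?_)⟩
  · exact Measurable.aestronglyMeasurable (by fun_prop)
  · refine Eventually.of_forall fun p => ?_
    rw [Complex.norm_real, Real.norm_of_nonneg (by positivity), ← div_eq_mul_inv,
      div_le_one (by positivity), pow_add]
    have h1 : ‖p.1‖ ≤ ‖p‖ := norm_fst_le p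
    have h2 : ‖p.2‖ ≤ ‖p‖ := norm_snd_le p
    gcongr
  · have h1 : ((1 + ‖p.1‖ : ℝ) : ℂ) ≠ 0 := Complex.ofReal_ne_zero.2 (by positivity)
    have h2 : ((1 + ‖p.2‖ : ℝ) : ℂ) ≠ 0 := Complex.ofReal_ne_zero.2 (by positivity)
    have h3 : ((1 + ‖p‖ : ℝ) : ℂ) ≠ 0 := Complex.ofReal_ne_zero.2 (by positivity)
    simp only [Complex.ofReal_mul, Complex.ofReal_pow, Complex.ofReal_inv]
    field_simp

lemma measurable_phi (c : Matrix (Fin 6) (Fin 6) ℝ) (ρ : ℝ) (β : Fin 3 → ℝ) (i : Fin 3)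
    (ha : Measurable a) :
    Measurable fun p : Space × ℝ => phi c ρ β a i p.1 p.2 := by
  have hw : Measurable (waveNumber β a i) := by
    unfold waveNumber
    exact measurable_upperSqrt.comp (by fun_prop)
  have ht : Measurable (travelTime c ρ i) := (continuous_ellipNorm (modeSpeeds c ρ i)).measurable
  unfold phi
  fun_prop

lemma polyIntegrable_norm_inv : PolyIntegrable fun x : Space => ((‖x‖ ^ (-1 : ℝ) : ℝ) : ℂ) :=
  polyIntegrable_norm_rpow_neg (E := Space) zero_le_one (by rw [finrank_space]; norm_num)

lemma polyIntegrable_phi (hρ : 0 < ρ) (hc : ∀ i j, 0 < eigenCoeff c i j) (ha : Measurable a)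
    (ω : ℝ) : PolyIntegrable fun x => phi c ρ β a i x ω := by
  obtain ⟨C, hC, h⟩ := exists_norm_phi_le (β := β) (a := a) (i := i) hρ hc
  refine (polyIntegrable_norm_inv.const_mul (C * ‖1 - (β i : ℂ) * a ω‖ : ℝ)).mono
    (((measurable_phi c ρ β i ha).comp (measurable_prodMk_right)).aestronglyMeasurable)
    (Eventually.of_forall fun x => (h x ω).trans (le_of_eq ?_))
  rw [norm_mul, Complex.norm_real, Complex.norm_real, Real.norm_of_nonneg (by positivity),
    Real.norm_of_nonneg (by positivity)]
  ring

lemma polyIntegrable_phi_prod (hρ : 0 < ρ) (hc : ∀ i j, 0 < eigenCoeff c i j) (ha : Measurable a)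
    (hp : PolyIntegrable a) : PolyIntegrable fun p : Space × ℝ => phi c ρ β a i p.1 p.2 := by
  obtain ⟨C, hC, h⟩ := exists_norm_phi_le (β := β) (a := a) (i := i) hρ hc
  have h1 : PolyIntegrable fun ω => 1 - (β i : ℂ) * a ω := by
    have := polyIntegrable_one.add (hp.const_mul (-(β i : ℂ)))
    simpa [sub_eq_add_neg] using this
  refine ((polyIntegrable_norm_inv.mul_prod h1).const_mul (C : ℂ)).mono
    (measurable_phi c ρ β i ha).aestronglyMeasurable
    (Eventually.of_forall fun p => (h p.1 p.2).trans (le_of_eq ?_))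
  rw [norm_mul, norm_mul, Complex.norm_real, Complex.norm_real, Real.norm_of_nonneg hC,
    Real.norm_of_nonneg (by positivity)]

/-- The operator has even order and constant coefficients, so it is its own transpose. -/
lemma isHelmholtzSolution_iff (S : 𝓢'(Space, ℂ)) (ω : ℝ) :
    IsHelmholtzSolution c ρ β a i ω S ↔ ∀ φ : 𝓢(Space, ℂ),
      S (modeOp (eigenCoeff c i) (helmholtzCoeff ρ β a i ω) φ) =
        -(1 - (β i : ℂ) * a ω) * φ 0 := by
  have key : ∀ φ : 𝓢(Space, ℂ),
      ((∑ j, ((eigenCoeff c i j : ℝ) : ℂ) • (∂_{basisVec j} (∂_{basisVec j} S))) +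
        ((ρ : ℂ) * (ω : ℂ) ^ 2 * (1 - (β i : ℂ) * a ω)) • S) φ =
      S (modeOp (eigenCoeff c i) (helmholtzCoeff ρ β a i ω) φ) := fun φ => by
    simp [modeOp, helmholtzCoeff, -Complex.coe_smul]
  rw [IsHelmholtzSolution, DFunLike.ext_iff]
  refine forall_congr' fun φ => ?_
  rw [key]
  rfl

/-- Off the real axis every test function has the form `modeOp _ _ P`, and on such functions the
equation prescribes the value of a solution. -/
theorem exists_unique_helmholtz (hρ : 0 < ρ) (hc : ∀ i j, 0 < eigenCoeff c i j)
    (ha : Measurable a) {ω : ℝ} (him : (helmholtzCoeff ρ β a i ω).im ≠ 0) :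
    ∃ T : 𝓢'(Space, ℂ),
      (∀ φ : 𝓢(Space, ℂ), Integrable (fun x => φ x * phi c ρ β a i x ω) ∧
        T φ = ∫ x, φ x * phi c ρ β a i x ω) ∧
      ∀ S : 𝓢'(Space, ℂ), IsHelmholtzSolution c ρ β a i ω S ↔ S = T := by
  have hp := polyIntegrable_phi (β := β) (i := i) hρ hc ha ω
  obtain ⟨T, hT⟩ := hp.exists_distribution
  have hTs : IsHelmholtzSolution c ρ β a i ω T := by
    rw [isHelmholtzSolution_iff]
    intro φ
    rw [hT, integral_modeOp_mul_phi hρ hc]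
  refine ⟨T, fun φ => ⟨hp.integrable_mul φ, hT φ⟩, fun S => ⟨fun hS => ?_, fun h => h ▸ hTs⟩⟩
  rw [isHelmholtzSolution_iff] at hS hTs
  ext φ
  obtain ⟨P, rfl⟩ := exists_modeOp_eq (fun j => (hc i j).le) him φ
  rw [hS, hTs]

end Mode

/-! ### Fourier transform in time and the loss operator as a multiplier -/

lemma hasTemperateGrowth_cexp_I_mul (t : ℝ) :
    (fun ω : ℝ => Complex.exp (Complex.I * ω * t)).HasTemperateGrowth := by
  have hd : ∀ ω : ℝ, HasDerivAt (fun ω : ℝ => Complex.exp (Complex.I * ω * t))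
      (Complex.I * t * Complex.exp (Complex.I * ω * t)) ω := fun ω => by
    have h0 : HasDerivAt (fun r : ℝ => (r : ℂ)) 1 ω := Complex.ofRealCLM.hasDerivAt
    refine ((h0.const_mul Complex.I).mul_const (t : ℂ)).cexp.congr_deriv ?_
    ring
  have hit : ∀ n, iteratedDeriv n (fun ω : ℝ => Complex.exp (Complex.I * ω * t)) =
      fun ω : ℝ => (Complex.I * t) ^ n * Complex.exp (Complex.I * ω * t) := fun n => by
    induction n with
    | zero => simp
    | succ n ih =>
      rw [iteratedDeriv_succ, ih]
      ext ω
      rw [((hd ω).const_mul _).deriv]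
      ring
  have hs : ContDiff ℝ (⊤ : ℕ∞) (fun ω : ℝ => Complex.exp (Complex.I * ω * t)) :=
    ((contDiff_const.mul Complex.ofRealCLM.contDiff).mul contDiff_const).cexp
  refine ⟨hs, fun n => ⟨0, |t| ^ n, fun ω => ?_⟩⟩
  rw [norm_iteratedFDeriv_eq_norm_iteratedDeriv, hit, norm_mul, norm_cexp_I_mul_mul, norm_pow,
    norm_mul, Complex.norm_I, Complex.norm_real]
  simp

lemma phase_one (ω t : ℝ) : phase 1 ω t = Complex.exp (Complex.I * ω * t) := by
  simp [phase, mul_comm, mul_left_comm]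

/-- The Fourier transform in time `∫ ψ(x, ω) exp(iωt) dω`. -/
def timeFourier : 𝓢(SpaceTime, ℂ) →L[ℂ] 𝓢(SpaceTime, ℂ) :=
  partialFourier (E := Space) (F := ℝ) (one_ne_zero (α := ℝ))

/-- The inverse of the Fourier transform in time. -/
def timeFourierInv : 𝓢(SpaceTime, ℂ) →L[ℂ] 𝓢(SpaceTime, ℂ) :=
  (((2 * Real.pi)⁻¹ : ℝ) : ℂ) •
    partialFourier (E := Space) (F := ℝ) (neg_ne_zero.2 (one_ne_zero (α := ℝ)))

lemma timeFourier_apply (ψ : 𝓢(SpaceTime, ℂ)) (x : Space) (t : ℝ) :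
    timeFourier ψ (x, t) = ∫ ω : ℝ, ψ (x, ω) * Complex.exp (Complex.I * ω * t) := by
  rw [timeFourier, partialFourier_apply]
  simp only [phase_one, mul_comm]

lemma isTimeFourierOf_iff {ψ Ψ : 𝓢(SpaceTime, ℂ)} : IsTimeFourierOf ψ Ψ ↔ Ψ = timeFourier ψ := by
  refine ⟨fun h => ?_, fun h x t => by rw [h, timeFourier_apply]⟩
  ext ⟨x, t⟩
  rw [h x t, timeFourier_apply]

lemma two_pi_inv_mul : (((2 * Real.pi)⁻¹ : ℝ) : ℂ) *
    ((|2 * Real.pi / 1| ^ Module.finrank ℝ ℝ : ℝ) : ℂ) = 1 := by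
  rw [Module.finrank_self, pow_one, div_one, abs_of_pos Real.two_pi_pos, ← Complex.ofReal_mul,
    inv_mul_cancel₀ Real.two_pi_pos.ne', Complex.ofReal_one]

lemma timeFourierInv_timeFourier (ψ : 𝓢(SpaceTime, ℂ)) : timeFourierInv (timeFourier ψ) = ψ := by
  rw [timeFourierInv, timeFourier, _root_.smul_apply, partialFourier_neg_partialFourier, smul_smul,
    two_pi_inv_mul, one_smul]

lemma timeFourier_timeFourierInv (ψ : 𝓢(SpaceTime, ℂ)) : timeFourier (timeFourierInv ψ) = ψ := by
  have h := partialFourier_neg_partialFourier (E := Space) (F := ℝ) (c := -1)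
    (neg_ne_zero.2 one_ne_zero) ψ
  -- The proof of `c ≠ 0` is an argument, so replacing `-(-1)` by `1` goes through a general `c`.
  have h1 : ∀ {c : ℝ} (hc : c ≠ 0), c = 1 →
      partialFourier (E := Space) (F := ℝ) hc = timeFourier := by
    rintro c hc rfl
    rfl
  rw [h1 _ (neg_neg 1)] at h
  rw [timeFourierInv, _root_.smul_apply, map_smul, h, smul_smul]
  have : |2 * Real.pi / -1| = |2 * Real.pi / 1| := by rw [div_neg, abs_neg]
  rw [this, two_pi_inv_mul, one_smul]

lemma timeFourier_lineDeriv_space (ψ : 𝓢(SpaceTime, ℂ)) (y : Space) :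
    ∂_{((y, 0) : SpaceTime)} (timeFourier ψ) = timeFourier (∂_{((y, 0) : SpaceTime)} ψ) :=
  lineDeriv_fst_partialFourier _ ψ y

/-- Multiplication by `-ω²`. -/
def mulNegFreqSq : 𝓢(SpaceTime, ℂ) →L[ℂ] 𝓢(SpaceTime, ℂ) :=
  mulSnd (E := Space) (F := ℝ) 1 1 ∘L mulSnd (E := Space) (F := ℝ) 1 1

lemma mulNegFreqSq_apply (ψ : 𝓢(SpaceTime, ℂ)) (p : SpaceTime) :
    mulNegFreqSq ψ p = -(p.2 : ℂ) ^ 2 * ψ p := by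
  rw [mulNegFreqSq, ContinuousLinearMap.comp_apply, mulSnd_apply, mulSnd_apply]
  simp
  linear_combination ((p.2 : ℂ) ^ 2 * ψ p) * Complex.I_sq

lemma timeFourier_timeDeriv2 (ψ : 𝓢(SpaceTime, ℂ)) :
    ∂_{((0, 1) : SpaceTime)} (∂_{((0, 1) : SpaceTime)} (timeFourier ψ)) =
      timeFourier (mulNegFreqSq ψ) := by
  rw [timeFourier, lineDeriv_snd_partialFourier, lineDeriv_snd_partialFourier]
  rfl

lemma waveTransform_surjective : Function.Surjective waveTransform := fun φ => by
  set e := ContinuousLinearEquiv.unitsEquivAut ℝ (Units.mk0 (2 * Real.pi)⁻¹ (by positivity))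
  refine ⟨𝓕 (SchwartzMap.compCLMOfContinuousLinearEquiv ℂ e.symm φ), ?_⟩
  rw [waveTransform, FourierTransform.fourierInv_fourier_eq]
  ext t
  change φ (e.symm (e t)) = φ t
  rw [e.symm_apply_apply]

section Loss

variable {γ : ℝ} {a : ℝ → ℂ}

/-- A shift by `t` in time is the multiplier `exp(iωt)` on the slice, which keeps it a Schwartz
function to which the definition of the symbol applies. -/
lemma IsLossSymbol.lossKernel_timeFourier (ha : IsLossSymbol γ a) (p : 𝓢(SpaceTime, ℂ))
    (x : Space) (t : ℝ) :
    Integrable (fun ω => a ω * (p (x, ω) * Complex.exp (Complex.I * ω * t))) ∧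
    lossKernel γ (fun s => timeFourier p (x, t + s)) =
      ∫ ω, a ω * (p (x, ω) * Complex.exp (Complex.I * ω * t)) := by
  set φ : 𝓢(ℝ, ℂ) := SchwartzMap.smulLeftCLM ℂ (fun ω : ℝ => Complex.exp (Complex.I * ω * t))
    (sndSlice x p) with hφ
  have hφω : ∀ ω, φ ω = p (x, ω) * Complex.exp (Complex.I * ω * t) := fun ω => by
    rw [hφ, SchwartzMap.smulLeftCLM_apply_apply (hasTemperateGrowth_cexp_I_mul t), smul_eq_mul,
      sndSlice_apply, mul_comm]
  obtain ⟨h1, h2⟩ := ha.2 φ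
  simp only [hφω] at h1 h2
  refine ⟨h1, ?_⟩
  rw [← h2]
  congr 1
  ext s
  rw [timeFourier_apply]
  refine integral_congr_ae (Eventually.of_forall fun ω => ?_)
  change p (x, ω) * _ = p (x, ω) * _ * _
  rw [mul_assoc (p (x, ω)), ← Complex.exp_add]
  congr 2
  push_cast
  ring

lemma IsLossSymbol.isTransposedLoss_timeFourier (ha : IsLossSymbol γ a) {p q : 𝓢(SpaceTime, ℂ)}
    (h : ∀ x ω, ω ≠ 0 → q (x, ω) = a ω * p (x, ω)) :
    IsTransposedLoss γ (timeFourier p) (timeFourier q) := by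
  intro x t
  rw [(ha.lossKernel_timeFourier p x t).2, timeFourier_apply]
  refine integral_congr_ae ?_
  filter_upwards [Measure.ae_ne (volume : Measure ℝ) 0] with ω hω
  rw [h x ω hω, mul_assoc]

/-- The difference `a p - q` on a slice is integrable with zero Fourier transform, so it vanishes
almost everywhere, and off `ω = 0` everywhere by continuity. -/
lemma IsLossSymbol.eq_mul_of_isTransposedLoss (ha : IsLossSymbol γ a) {p q : 𝓢(SpaceTime, ℂ)}
    (h : IsTransposedLoss γ (timeFourier p) (timeFourier q)) (x : Space) :
    ∀ ω, ω ≠ 0 → q (x, ω) = a ω * p (x, ω) := by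
  set f : ℝ → ℂ := fun ω => a ω * p (x, ω) - q (x, ω) with hf
  have hint : Integrable f := (ha.2 (sndSlice x p)).1.sub (sndSlice x q).integrable
  have hzero : ∀ t : ℝ, ∫ ω, f ω * Complex.exp (Complex.I * ω * t) = 0 := fun t => by
    obtain ⟨h1, h2⟩ := ha.lossKernel_timeFourier p x t
    have h3 := h x t
    rw [h2, timeFourier_apply] at h3
    have h4 : ∀ ω : ℝ, f ω * Complex.exp (Complex.I * ω * t) =
        a ω * (p (x, ω) * Complex.exp (Complex.I * ω * t)) -
          sndSlice x q ω * Complex.exp (Complex.I * ω * t) := fun ω => by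
      rw [hf, sndSlice_apply]
      ring
    simp only [h4]
    rw [integral_sub h1 (integrable_mul_cexp (sndSlice x q) t), sub_eq_zero]
    exact h3.symm
  -- Fubini moves the transform onto the test function; since `waveTransform` is onto, this covers
  -- all test functions.
  have hwave : ∀ φ : 𝓢(ℝ, ℂ), ∫ ω, waveTransform φ ω * f ω = 0 := fun φ => by
    have h1 : ∀ ω, waveTransform φ ω * f ω =
        ∫ t, φ t * (f ω * Complex.exp (Complex.I * ω * t)) := fun ω => by
      rw [waveTransform_apply, ← integral_mul_const]
      refine integral_congr_ae (Eventually.of_forall fun t => ?_)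
      simp only
      rw [mul_right_comm Complex.I (ω : ℂ) (t : ℂ)]
      ring
    simp only [h1]
    rw [integral_integral_swap]
    · simp only [integral_const_mul, hzero, mul_zero, integral_zero]
    · refine ((hint.mul_prod φ.integrable).mul_bdd (c := 1)
        (g := fun z : ℝ × ℝ => Complex.exp (Complex.I * z.1 * z.2)) ?_ ?_).congr
          (Eventually.of_forall fun z => ?_)
      · exact Continuous.aestronglyMeasurable (by fun_prop)
      · exact Eventually.of_forall fun z => (norm_cexp_I_mul_mul z.1 z.2).le
      · simp only [Function.uncurry]
        ring
  have hU : IsOpen ({0}ᶜ : Set ℝ) := isOpen_compl_singleton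
  have hae := integral_mul_eq_zero_imp hU (hint.locallyIntegrable.locallyIntegrableOn _) fun φ => by
    obtain ⟨φ', rfl⟩ := waveTransform_surjective φ
    exact hwave φ'
  have hcont : ContinuousOn f {0}ᶜ := by
    have hp := (sndSlice x p).continuous.continuousOn (s := {0}ᶜ)
    have hq := (sndSlice x q).continuous.continuousOn (s := {0}ᶜ)
    exact (ha.1.mul hp).sub hq
  have h1 : f =ᵐ[volume.restrict {0}ᶜ] 0 := by
    filter_upwards [ae_restrict_of_ae hae, ae_restrict_mem hU.measurableSet] with ω h hω
    exact h hω
  intro ω hω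
  have := Measure.eqOn_open_of_ae_eq h1 hU hcont continuousOn_const hω
  exact (sub_eq_zero.1 this).symm

end Loss

/-! ### Algebra of the medium -/

section Medium

variable {μ c v : Matrix (Fin 6) (Fin 6) ℝ} {β : Fin 3 → ℝ}

/-- In the first medium, the Christoffel tensor is diagonal. -/
lemma IsMediumI.sum_smul_eq (h : IsMediumI μ) {M : Type*} [AddCommGroup M] [Module ℝ M]
    (D : Fin 3 → Fin 3 → Fin 3 → M) (hD : ∀ j k l, D j k l = D j l k) (i : Fin 3) :
    ∑ j, ∑ k, ∑ l, tensorOfVoigt μ k i l j • D j k l = ∑ j, eigenCoeff μ i j • D i j j := by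
  -- Only off-diagonal entries carry information; the diagonal ones are read as `μ p p = μ p p`.
  have e : ∀ p q, μ p q = _ := fun p q => congrFun (congrFun h p) q
  have e01 := e 0 1
  have e02 := e 0 2
  have e03 := e 0 3
  have e04 := e 0 4
  have e05 := e 0 5
  have e10 := e 1 0
  have e12 := e 1 2
  have e13 := e 1 3
  have e14 := e 1 4
  have e15 := e 1 5
  have e20 := e 2 0
  have e21 := e 2 1
  have e23 := e 2 3
  have e24 := e 2 4
  have e25 := e 2 5
  have e30 := e 3 0
  have e31 := e 3 1
  have e32 := e 3 2
  have e34 := e 3 4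
  have e35 := e 3 5
  have e40 := e 4 0
  have e41 := e 4 1
  have e42 := e 4 2
  have e43 := e 4 3
  have e45 := e 4 5
  have e50 := e 5 0
  have e51 := e 5 1
  have e52 := e 5 2
  have e53 := e 5 3
  have e54 := e 5 4
  simp at e01 e02 e03 e04 e05 e10 e12 e13 e14 e15 e20 e21 e23 e24 e25 e30 e31 e32 e34 e35 e40 e41 e42 e43 e45 e50 e51 e52 e53 e54
  -- For `i ≠ j` the entries `-μ` and `μ` multiply `D j k l` and `D j l k`, which the symmetry of
  -- `D` identifies.
  have h10 := fun j => hD j 1 0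
  have h20 := fun j => hD j 2 0
  have h21 := fun j => hD j 2 1
  fin_cases i <;>
  · simp [Fin.sum_univ_three, tensorOfVoigt, voigtIndex, eigenCoeff, e01, e02, e03, e04, e05, e10, e12, e13, e14, e15, e20, e21, e23, e24, e25, e30, e31, e32, e34, e35, e40, e41, e42, e43, e45, e50, e51, e52, e53, e54, h10, h20, h21]
    try module

lemma christoffel_mulVec (h : IsMediumI μ) (i : Fin 3) (n : Fin 3 → ℝ) :
    (christoffel (tensorOfVoigt μ) n).mulVec (Pi.single i 1) =
      eigenForm μ i n • (Pi.single i 1 : Fin 3 → ℝ) := by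
  ext p
  have h1 := h.sum_smul_eq (fun j k l => n k * n l * (Pi.single i 1 : Fin 3 → ℝ) j)
    (fun j k l => by ring) p
  rw [Matrix.mulVec, dotProduct]
  simp only [christoffel, Matrix.of_apply, Finset.sum_mul]
  refine (Finset.sum_congr rfl fun j _ => Finset.sum_congr rfl fun k _ => Finset.sum_congr rfl
    fun l _ => ?_).trans (h1.trans ?_)
  · rw [smul_eq_mul]
    ring
  · rw [Pi.smul_apply, smul_eq_mul, eigenForm, Finset.sum_mul]
    by_cases hp : p = i
    · subst hp
      exact Finset.sum_congr rfl fun j _ => by rw [smul_eq_mul]; ring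
    · simp [hp]

lemma eigenForm_single (μ : Matrix (Fin 6) (Fin 6) ℝ) (i j : Fin 3) :
    eigenForm μ i (Pi.single j 1) = eigenCoeff μ i j := by
  rw [eigenForm, Finset.sum_eq_single j]
  · simp
  · intro k _ hk
    simp [hk]
  · simp

lemma eigenCoeff_eq_mul (hβ : ∀ (i : Fin 3) (n : Fin 3 → ℝ), eigenForm v i n = β i * eigenForm c i n)
    (i j : Fin 3) : eigenCoeff v i j = β i * eigenCoeff c i j := by
  simpa only [eigenForm_single] using hβ i (Pi.single j 1)

/-- Test on `e i ⊗ e i` for the first three entries and on `e i ⊗ e j + e j ⊗ e i` for the shear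
ones, where the entry is counted four times. -/
lemma IsPositiveDefinite.diag_pos (h : IsPositiveDefinite (tensorOfVoigt μ)) (p : Fin 6) :
    0 < μ p p := by
  obtain ⟨δ, hδ, H⟩ := h
  have key : ∀ ξ : Matrix (Fin 3) (Fin 3) ℝ, ξ.IsSymm → ∀ r : ℝ, 0 < r →
      (∑ i, ∑ j, ∑ k, ∑ l, tensorOfVoigt μ i j k l * ξ k l * ξ i j) = r * μ p p →
      0 < ∑ i, ∑ j, ξ i j ^ 2 → 0 < μ p p := by
    intro ξ hξ r hr h1 h2
    have h3 := H ξ hξ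
    rw [h1] at h3
    exact pos_of_mul_pos_right ((mul_pos hδ h2).trans_le h3) hr.le
  fin_cases p
  · refine key !![1, 0, 0; 0, 0, 0; 0, 0, 0] ?_ 1 one_pos ?_ ?_
    · ext i j; fin_cases i <;> fin_cases j <;> rfl
    all_goals simp [Fin.sum_univ_three, tensorOfVoigt, voigtIndex]
  · refine key !![0, 0, 0; 0, 1, 0; 0, 0, 0] ?_ 1 one_pos ?_ ?_
    · ext i j; fin_cases i <;> fin_cases j <;> rfl
    all_goals simp [Fin.sum_univ_three, tensorOfVoigt, voigtIndex]
  · refine key !![0, 0, 0; 0, 0, 0; 0, 0, 1] ?_ 1 one_pos ?_ ?_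
    · ext i j; fin_cases i <;> fin_cases j <;> rfl
    all_goals simp [Fin.sum_univ_three, tensorOfVoigt, voigtIndex]
  · refine key !![0, 0, 0; 0, 0, 1; 0, 1, 0] ?_ 4 four_pos ?_ ?_
    · ext i j; fin_cases i <;> fin_cases j <;> rfl
    all_goals simp [Fin.sum_univ_three, tensorOfVoigt, voigtIndex]
    ring
  · refine key !![0, 0, 1; 0, 0, 0; 1, 0, 0] ?_ 4 four_pos ?_ ?_
    · ext i j; fin_cases i <;> fin_cases j <;> rfl
    all_goals simp [Fin.sum_univ_three, tensorOfVoigt, voigtIndex]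
    ring
  · refine key !![0, 1, 0; 1, 0, 0; 0, 0, 0] ?_ 4 four_pos ?_ ?_
    · ext i j; fin_cases i <;> fin_cases j <;> rfl
    all_goals simp [Fin.sum_univ_three, tensorOfVoigt, voigtIndex]
    ring

lemma IsPositiveDefinite.eigenCoeff_pos (h : IsPositiveDefinite (tensorOfVoigt μ)) (i j : Fin 3) :
    0 < eigenCoeff μ i j := by
  have := h.diag_pos
  fin_cases i <;> fin_cases j <;> exact this _

lemma lineDeriv_comm {E : Type*} [NormedAddCommGroup E] [NormedSpace ℝ E] (ψ : 𝓢(E, ℂ))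
    (u w : E) : ∂_{u} (∂_{w} ψ) = ∂_{w} (∂_{u} ψ) := by
  have hd : ∀ u w x, (∂_{u} (∂_{w} ψ)) x = fderiv ℝ (fderiv ℝ ψ) x u w := fun u w x => by
    rw [SchwartzMap.lineDerivOp_apply_eq_fderiv]
    have h1 : ((∂_{w} ψ : 𝓢(E, ℂ)) : E → ℂ) = fun y => fderiv ℝ ψ y w :=
      funext fun y => SchwartzMap.lineDerivOp_apply_eq_fderiv w ψ y
    have h2 : DifferentiableAt ℝ (fderiv ℝ ψ) x :=
      ((ψ.smooth 2).fderiv_right (m := 1) (by norm_num)).differentiable one_ne_zero x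
    rw [h1, fderiv_clm_apply h2 (differentiableAt_const w)]
    simp
  ext x
  rw [hd, hd]
  have h := ContDiffAt.isSymmSndFDerivAt (𝕜 := ℝ) (n := 2) (ψ.smooth 2).contDiffAt (x := x)
    (by simp)
  exact h u w

/-- The operator `∑ j, A j ∂ⱼ²` on space-time. -/
def spaceOp (A : Fin 3 → ℝ) (ψ : 𝓢(SpaceTime, ℂ)) : 𝓢(SpaceTime, ℂ) :=
  ∑ j, (A j : ℂ) • ∂_{((basisVec j, 0) : SpaceTime)} (∂_{((basisVec j, 0) : SpaceTime)} ψ)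

lemma christoffelOp_apply (h : IsMediumI μ) (G : MatrixDistribution) (i m : Fin 3)
    (ψ : 𝓢(SpaceTime, ℂ)) :
    christoffelOp (tensorOfVoigt μ) G i m ψ = G i m (spaceOp (eigenCoeff μ i) ψ) := by
  have h1 := h.sum_smul_eq (fun j k l => G j m
    (∂_{((basisVec l, 0) : SpaceTime)} (∂_{((basisVec k, 0) : SpaceTime)} ψ)))
    (fun j k l => by rw [lineDeriv_comm]) i
  rw [spaceOp, map_sum]
  refine Eq.trans ?_ (h1.trans (Finset.sum_congr rfl fun j _ => ?_))
  · simp [christoffelOp]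
  · rw [map_smul, Complex.coe_smul]

end Medium

/-! ### The approximate equation in the frequency domain and its solution -/

section Green

variable {c v : Matrix (Fin 6) (Fin 6) ℝ} {ρ γ : ℝ} {β : Fin 3 → ℝ} {a : ℝ → ℂ}

lemma viscoelasticResidual_sub (hc : IsMediumI c) (hv : IsMediumI v)
    (hβ : ∀ (i : Fin 3) (n : Fin 3 → ℝ), eigenForm v i n = β i * eigenForm c i n)
    (G : MatrixDistribution) (ψ χ χ' : 𝓢(SpaceTime, ℂ)) (i m : Fin 3) :
    viscoelasticResidual (tensorOfVoigt c) (tensorOfVoigt v) ρ G i m ψ χ -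
        (β i : ℂ) * viscoelasticResidual (tensorOfVoigt c) (tensorOfVoigt v) ρ G i m χ χ' =
      approxResidual (tensorOfVoigt c) β ρ G i m ψ χ -
        (β i : ℂ) ^ 2 * christoffelOp (tensorOfVoigt c) G i m χ' := by
  -- Row `i` of `Γᵛ[∇]` is `β i` times row `i` of `Γᶜ[∇]`, by comparing coefficients of the
  -- quadratic forms.
  have hop : ∀ ψ, christoffelOp (tensorOfVoigt v) G i m ψ =
      β i * christoffelOp (tensorOfVoigt c) G i m ψ := fun ψ => by
    rw [christoffelOp_apply hv, christoffelOp_apply hc, ← smul_eq_mul, ← map_smul]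
    congr 1
    simp only [spaceOp, Finset.smul_sum, smul_smul]
    refine Finset.sum_congr rfl fun j _ => ?_
    rw [eigenCoeff_eq_mul hβ]
    push_cast
    rfl
  rw [viscoelasticResidual, viscoelasticResidual, approxResidual, hop, hop]
  ring

lemma greenHat_apply (c : Matrix (Fin 6) (Fin 6) ℝ) (ρ : ℝ) (β : Fin 3 → ℝ) (a : ℝ → ℂ) (x : Space)
    (ω : ℝ) (i m : Fin 3) :
    greenHat c ρ β a x ω i m = (if i = m then 1 else 0) * phi c ρ β a i x ω := by
  rw [greenHat, Matrix.sum_apply]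
  by_cases h : i = m
  · subst h
    rw [Finset.sum_eq_single i]
    · simp [dyad, Matrix.vecMulVec_apply]
    · intro k _ hk
      simp [dyad, Matrix.vecMulVec_apply, hk.symm]
    · simp
  · rw [if_neg h, zero_mul]
    refine Finset.sum_eq_zero fun k _ => ?_
    by_cases hk : i = k
    · subst hk
      simp [dyad, Matrix.vecMulVec_apply, Ne.symm h]
    · simp [dyad, Matrix.vecMulVec_apply, hk]

lemma greenHat_eq (hρ : 0 < ρ) (hc : ∀ p, 0 < c p p) (β : Fin 3 → ℝ) (a : ℝ → ℂ) (x : Space)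
    (ω : ℝ) :
    greenHat c ρ β a x ω = (1 / (4 * (Real.pi : ℂ) * (ρ : ℂ))) • ∑ i : Fin 3,
      (((speed c ρ (Fin.natAdd 3 i) : ℝ) : ℂ) * (1 - (β i : ℂ) * a ω) /
          (((speed c ρ (Fin.castAdd 3 i) * speed c ρ 3 * speed c ρ 4 * speed c ρ 5 : ℝ) : ℂ) *
            (travelTime c ρ i x : ℂ)) *
        Complex.exp (Complex.I * waveNumber β a i ω * (travelTime c ρ i x : ℂ))) • dyad i := by
  have hs : ∀ p, ((speed c ρ p : ℝ) : ℂ) ≠ 0 := fun p =>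
    Complex.ofReal_ne_zero.2 (Real.sqrt_pos.2 (div_pos (hc p) hρ)).ne'
  have hpi : (Real.pi : ℂ) ≠ 0 := Complex.ofReal_ne_zero.2 Real.pi_ne_zero
  have hρ' : (ρ : ℂ) ≠ 0 := Complex.ofReal_ne_zero.2 hρ.ne'
  rw [greenHat, Finset.smul_sum]
  refine Finset.sum_congr rfl fun i _ => ?_
  rw [smul_smul]
  congr 1
  rw [phi]
  -- Where the travel time vanishes, division by zero makes both sides zero.
  by_cases ht : (travelTime c ρ i x : ℂ) = 0
  · simp [ht]
  have h0 := hs 0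
  have h1 := hs 1
  have h2 := hs 2
  have h3 := hs 3
  have h4 := hs 4
  have h5 := hs 5
  have e0 : speed c ρ (Fin.natAdd 3 (0 : Fin 3)) = speed c ρ 3 := rfl
  have e1 : speed c ρ (Fin.natAdd 3 (1 : Fin 3)) = speed c ρ 4 := rfl
  have e2 : speed c ρ (Fin.natAdd 3 (2 : Fin 3)) = speed c ρ 5 := rfl
  have f0 : speed c ρ (Fin.castAdd 3 (0 : Fin 3)) = speed c ρ 0 := rfl
  have f1 : speed c ρ (Fin.castAdd 3 (1 : Fin 3)) = speed c ρ 1 := rfl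
  have f2 : speed c ρ (Fin.castAdd 3 (2 : Fin 3)) = speed c ρ 2 := rfl
  rw [Fin.prod_univ_three]
  -- Row `i` of the speeds consists of `c i` and two of the three shear speeds; the missing one is
  -- `c (i + 3)`.
  have hm : ∀ i : Fin 3, modeSpeeds c ρ i 0 * modeSpeeds c ρ i 1 * modeSpeeds c ρ i 2 *
      speed c ρ (Fin.natAdd 3 i) =
      speed c ρ (Fin.castAdd 3 i) * speed c ρ 3 * speed c ρ 4 * speed c ρ 5 := fun i => by
    fin_cases i
    · change speed c ρ 0 * speed c ρ 5 * speed c ρ 4 * speed c ρ 3 = speed c ρ 0 * _ * _ * _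
      ring
    · change speed c ρ 5 * speed c ρ 1 * speed c ρ 3 * speed c ρ 4 = speed c ρ 1 * _ * _ * _
      ring
    · change speed c ρ 4 * speed c ρ 3 * speed c ρ 2 * speed c ρ 5 = speed c ρ 2 * _ * _ * _
      ring
  rw [← hm i]
  have hn := hs (Fin.natAdd 3 i)
  push_cast
  have hmod : ∀ j, ((modeSpeeds c ρ i j : ℝ) : ℂ) ≠ 0 := fun j => by
    fin_cases i <;> fin_cases j <;> exact hs _
  have m0 := hmod 0
  have m1 := hmod 1
  have m2 := hmod 2
  field_simp

/-- The frequency-domain form of the approximate equation. -/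
lemma approxResidual_timeFourier (hc : IsMediumI c)
    {p q : 𝓢(SpaceTime, ℂ)} (h : ∀ x ω, ω ≠ 0 → q (x, ω) = a ω * p (x, ω)) (i : Fin 3) :
    ∃ r : 𝓢(SpaceTime, ℂ),
      (∀ x ω, r (x, ω) = modeOp (eigenCoeff c i) (helmholtzCoeff ρ β a i ω) (fstSlice ω p) x) ∧
      ∀ (G : MatrixDistribution) (m : Fin 3),
        approxResidual (tensorOfVoigt c) β ρ G i m (timeFourier p) (timeFourier q) =
          G i m (timeFourier r) +
            (if i = m then 1 else 0) * ∫ ω, (1 - (β i : ℂ) * a ω) * p (0, ω) := by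
  refine ⟨spaceOp (eigenCoeff c i) p + ((ρ : ℂ) * β i) • mulNegFreqSq q -
    (ρ : ℂ) • mulNegFreqSq p, fun x ω => ?_, fun G m => ?_⟩
  · rw [modeOp_apply]
    simp only [spaceOp, _root_.sub_apply, _root_.add_apply, _root_.smul_apply, _root_.sum_apply,
      smul_eq_mul, mulNegFreqSq_apply, ← fstSlice_lineDeriv, fstSlice_apply, helmholtzCoeff]
    -- At `ω = 0` the factor `ω²` hides the value of `q`, which the hypothesis leaves open there.
    by_cases hω : ω = 0
    · simp [hω]
    · rw [h x ω hω]
      ring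
  · have h0 : ∀ u : 𝓢(SpaceTime, ℂ), timeFourier u 0 = ∫ ω, u (0, ω) := fun u => by
      change timeFourier u (0, 0) = _
      rw [timeFourier_apply]
      simp
    have hint : timeFourier p 0 - (β i : ℂ) * timeFourier q 0 =
        ∫ ω, (1 - (β i : ℂ) * a ω) * p (0, ω) := by
      have h1 : Integrable fun ω => p (0, ω) := (sndSlice 0 p).integrable
      have h2 : Integrable fun ω => q (0, ω) := (sndSlice 0 q).integrable
      rw [h0, h0, ← integral_const_mul, ← integral_sub h1 (h2.const_mul _)]
      refine integral_congr_ae ?_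
      filter_upwards [Measure.ae_ne (volume : Measure ℝ) 0] with ω hω
      rw [h 0 ω hω]
      ring
    have hspace : spaceOp (eigenCoeff c i) (timeFourier p) =
        timeFourier (spaceOp (eigenCoeff c i) p) := by
      simp only [spaceOp, map_sum, map_smul, timeFourier_lineDeriv_space]
    have htime : ∀ u : 𝓢(SpaceTime, ℂ), timeDeriv2 (G i m) (timeFourier u) =
        G i m (timeFourier (mulNegFreqSq u)) := fun u => by
      rw [← timeFourier_timeDeriv2, timeDeriv2]
      simp
    rw [approxResidual, hint, christoffelOp_apply hc, hspace, htime, htime]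
    simp only [map_sub, map_add, map_smul, smul_eq_mul]

/-- Fubini reduces this to the identity for `Φ i` at each fixed frequency. -/
lemma integral_mul_phi (hρ : 0 < ρ) (hc : ∀ i j, 0 < eigenCoeff c i j) (ha : Measurable a)
    (hp : PolyIntegrable a) (i : Fin 3) {p r : 𝓢(SpaceTime, ℂ)} (hr : ∀ x ω, r (x, ω) =
      modeOp (eigenCoeff c i) (helmholtzCoeff ρ β a i ω) (fstSlice ω p) x) :
    ∫ z : SpaceTime, r z * phi c ρ β a i z.1 z.2 = -∫ ω, (1 - (β i : ℂ) * a ω) * p (0, ω) := by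
  have hint := (polyIntegrable_phi_prod (β := β) (i := i) hρ hc ha hp).integrable_mul r
  rw [Measure.volume_eq_prod] at hint ⊢
  rw [integral_prod_symm _ hint, ← integral_neg]
  refine integral_congr_ae (Eventually.of_forall fun ω => ?_)
  simp only [hr]
  rw [integral_modeOp_mul_phi hρ hc, fstSlice_apply, neg_mul]

theorem exists_isApproxGreen (hγ : 0 < γ) (hρ : 0 < ρ) (hc : IsMediumI c)
    (hcp : ∀ i j, 0 < eigenCoeff c i j) (ha : IsLossSymbol γ a) :
    ∃ G : MatrixDistribution, IsApproxGreen (tensorOfVoigt c) β ρ γ G ∧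
      ∀ i m : Fin 3, HasTimeFourier (G i m) (fun x ω => greenHat c ρ β a x ω i m) := by
  have ham : Measurable a := measurable_of_continuousOn_compl_singleton 0 ha.1
  have hap := (ha.isRegular hγ).2.2.2
  have hφ := fun i => polyIntegrable_phi_prod (β := β) (i := i) hρ hcp ham hap
  choose T hT using fun i => (hφ i).exists_distribution
  -- The inverse Fourier transform in time of the distribution `Φ i`, by transposition.
  set G : MatrixDistribution := fun i m =>
    (if i = m then (1 : ℂ) else 0) • PointwiseConvergenceCLM.precomp ℂ timeFourierInv (T i) with hG
  have hGF : ∀ i m r, G i m (timeFourier r) =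
      (if i = m then 1 else 0) * ∫ z : SpaceTime, r z * phi c ρ β a i z.1 z.2 := fun i m r => by
    rw [← hT]
    conv_rhs => rw [← timeFourierInv_timeFourier r]
    rfl
  refine ⟨G, fun ψ χ h i m => ?_, fun i m ψ Ψ h => ?_⟩
  · rw [← timeFourier_timeFourierInv ψ, ← timeFourier_timeFourierInv χ] at h ⊢
    obtain ⟨r, hr, hres⟩ := approxResidual_timeFourier (β := β) (ρ := ρ) hc
      (ha.eq_mul_of_isTransposedLoss h) i
    rw [hres, hGF, integral_mul_phi hρ hcp ham hap i hr]
    ring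
  · rw [isTimeFourierOf_iff.1 h, hGF]
    simp only [greenHat_apply, mul_left_comm _ (if i = m then (1 : ℂ) else 0)]
    exact ⟨((hφ i).integrable_mul ψ).const_mul _, (integral_const_mul _ _).symm⟩

end Green

/-! ### Uniqueness at nonzero frequencies -/

/-- A smooth cutoff that equals `1` on a compact set of nonzero frequencies. -/
lemma exists_frequency_cutoff {K : Set ℝ} (hK : IsCompact K) (h0 : (0 : ℝ) ∉ K) :
    ∃ θ : ℝ → ℝ, ContDiff ℝ (⊤ : ℕ∞) θ ∧ HasCompactSupport θ ∧ (∀ ω ∈ K, θ ω = 1) ∧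
      (∀ ω, 0 ≤ θ ω) ∧ ∀ᶠ ω in 𝓝 0, θ ω = 0 := by
  obtain ⟨R, hR⟩ := hK.isBounded.subset_closedBall 0
  obtain ⟨ε, hε, hε'⟩ := Metric.isOpen_iff.1 hK.isClosed.isOpen_compl 0 h0
  -- `f` is `1` on a ball containing `K`; `g` is `1` near zero and lives in a ball that misses `K`,
  -- so the factor `1 - g` is `1` on `K`. The maximum keeps the radius positive.
  let f : ContDiffBump (0 : ℝ) := ⟨max R 1, max R 1 + 1, by positivity, by linarith⟩
  let g : ContDiffBump (0 : ℝ) := ⟨ε / 2, ε, by positivity, by linarith⟩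
  refine ⟨fun ω => f ω * (1 - g ω), f.contDiff.mul (contDiff_const.sub g.contDiff),
    f.hasCompactSupport.mul_right, fun ω hω => ?_,
    fun ω => mul_nonneg f.nonneg (sub_nonneg.2 g.le_one), ?_⟩
  · have h1 : f ω = 1 := f.one_of_mem_closedBall
      (Metric.closedBall_subset_closedBall (le_max_left _ _) (hR hω))
    have h2 : g ω = 0 := g.zero_of_le_dist (not_lt.1 fun hlt => hε' hlt hω)
    change f ω * (1 - g ω) = 1
    rw [h1, h2]
    norm_num
  · filter_upwards [Metric.closedBall_mem_nhds (0 : ℝ) (half_pos hε)] with ω hω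
    rw [show g ω = 1 from g.one_of_mem_closedBall hω, sub_self, mul_zero]

lemma contDiff_cutoff_mul {θ : ℝ → ℝ} (hθ : ContDiff ℝ (⊤ : ℕ∞) θ) (h0 : ∀ᶠ ω in 𝓝 0, θ ω = 0)
    {f : ℝ → ℂ} (hf : ContDiffOn ℝ (⊤ : ℕ∞) f {0}ᶜ) :
    ContDiff ℝ (⊤ : ℕ∞) fun ω => (θ ω : ℂ) * f ω := by
  rw [contDiff_iff_contDiffAt]
  intro ω
  by_cases hω : ω = 0
  · subst hω
    refine (contDiffAt_const (c := (0 : ℂ))).congr_of_eventuallyEq ?_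
    filter_upwards [h0] with ω hω
    rw [hω, Complex.ofReal_zero, zero_mul]
  · exact (Complex.ofRealCLM.contDiff.comp hθ).contDiffAt.mul
      (hf.contDiffAt (isOpen_compl_singleton.mem_nhds hω))

lemma hasTemperateGrowth_cutoff_mul {θ : ℝ → ℝ} (hθ : ContDiff ℝ (⊤ : ℕ∞) θ)
    (hθc : HasCompactSupport θ) (h0 : ∀ᶠ ω in 𝓝 0, θ ω = 0)
    {f : ℝ → ℂ} (hf : ContDiffOn ℝ (⊤ : ℕ∞) f {0}ᶜ) :
    (fun ω => (θ ω : ℂ) * f ω).HasTemperateGrowth :=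
  HasCompactSupport.hasTemperateGrowth
    ((hθc.comp_left (g := fun x : ℝ => (x : ℂ)) Complex.ofReal_zero).mul_right)
    (contDiff_cutoff_mul hθ h0 hf)

/-- A continuous function that avoids `[0, ∞)` and is eventually `-1` stays at a positive distance
from `[0, ∞)`. -/
lemma exists_forall_le_norm_sub {f : ℝ → ℂ} (hf : Continuous f)
    (hc : HasCompactSupport fun ω => f ω + 1) (h : ∀ ω, ∀ r : ℝ, 0 ≤ r → f ω ≠ r) :
    ∃ c : ℝ, 0 < c ∧ ∀ ω, ∀ r : ℝ, 0 ≤ r → c ≤ ‖f ω - r‖ := by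
  set S : Set ℂ := (fun r : ℝ => (r : ℂ)) '' Ici 0 with hS
  have hSc : IsClosed S :=
    Complex.isometry_ofReal.isClosedEmbedding.isClosedMap _ isClosed_Ici
  have hSn : S.Nonempty := ⟨0, 0, by simp, by simp⟩
  have hpos : ∀ ω, 0 < Metric.infDist (f ω) S := fun ω =>
    (hSc.notMem_iff_infDist_pos hSn).1 fun ⟨r, hr, hrf⟩ => h ω r hr hrf.symm
  obtain ⟨c, hc0, hc1⟩ : ∃ c : ℝ, 0 < c ∧ ∀ ω, c ≤ Metric.infDist (f ω) S := by
    have hcont : Continuous fun ω => Metric.infDist (f ω) S :=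
      (Metric.continuous_infDist_pt S).comp hf
    obtain ⟨M, hM⟩ : ∃ M : ℝ, 0 < M ∧ Metric.infDist (-1 : ℂ) S = M :=
      ⟨_, (hSc.notMem_iff_infDist_pos hSn).1 fun ⟨r, hr, hrf⟩ => by
        have := congrArg Complex.re hrf
        simp at this
        have hr' : (0 : ℝ) ≤ r := hr
        linarith, rfl⟩
    -- Off the compact support of `f + 1` the distance to `[0, ∞)` is that of `-1`; on it a minimum
    -- is attained.
    rcases (tsupport fun ω => f ω + 1).eq_empty_or_nonempty with he | hne
    · refine ⟨M, hM.1, fun ω => ?_⟩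
      have : f ω + 1 = 0 := image_eq_zero_of_notMem_tsupport (f := fun ω => f ω + 1) (by rw [he]; simp)
      rw [eq_neg_of_add_eq_zero_left this, hM.2]
    · obtain ⟨ω₀, -, hω₀⟩ := IsCompact.exists_isMinOn hc hne hcont.continuousOn
      refine ⟨min M (Metric.infDist (f ω₀) S), lt_min hM.1 (hpos ω₀), fun ω => ?_⟩
      by_cases hω : ω ∈ tsupport fun ω => f ω + 1
      · exact (min_le_right _ _).trans (hω₀ hω)
      · have : f ω + 1 = 0 := image_eq_zero_of_notMem_tsupport (f := fun ω => f ω + 1) hω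
        rw [eq_neg_of_add_eq_zero_left this, hM.2]
        exact min_le_left _ _
  refine ⟨c, hc0, fun ω r hr => (hc1 ω).trans ?_⟩
  rw [← dist_eq_norm]
  exact Metric.infDist_le_dist_of_mem ⟨r, hr, rfl⟩

section Green

variable {c : Matrix (Fin 6) (Fin 6) ℝ} {ρ γ : ℝ} {β : Fin 3 → ℝ} {a : ℝ → ℂ}

lemma helmholtzCoeff_im_ne_zero (hρ : 0 < ρ) {i : Fin 3} (hβ : β i ≠ 0) {ω : ℝ} (hω : ω ≠ 0)
    (ha : (a ω).im ≠ 0) : (helmholtzCoeff ρ β a i ω).im ≠ 0 := by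
  have h : helmholtzCoeff ρ β a i ω = ((ρ * ω ^ 2 : ℝ) : ℂ) * (1 - (β i : ℂ) * a ω) := by
    rw [helmholtzCoeff]
    push_cast
    ring
  rw [h, Complex.im_ofReal_mul]
  simp
  exact ⟨⟨hρ.ne', hω⟩, hβ, ha⟩

/-- Solvability of the Helmholtz equation for data supported away from zero frequency. -/
lemma exists_modeOp_fstSlice_eq (hρ : 0 < ρ) (hc : ∀ i j, 0 < eigenCoeff c i j) {i : Fin 3}
    (hβ : β i ≠ 0) (ha : IsRegularLossSymbol γ a) {ψ : 𝓢(SpaceTime, ℂ)}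
    (hψ : HasCompactSupport ψ) (h0 : ∀ p ∈ tsupport ψ, p.2 ≠ 0) :
    ∃ P Q : 𝓢(SpaceTime, ℂ), (∀ x ω, Q (x, ω) = a ω * P (x, ω)) ∧
      ∀ x ω, modeOp (eigenCoeff c i) (helmholtzCoeff ρ β a i ω) (fstSlice ω P) x = ψ (x, ω) := by
  set K : Set ℝ := Prod.snd '' tsupport ψ with hKdef
  have hK : IsCompact K := IsCompact.image hψ continuous_snd
  have hK0 : (0 : ℝ) ∉ K := fun ⟨p, hp, hp0⟩ => h0 p hp hp0
  have hψK : ∀ ω ∉ K, ∀ x, ψ (x, ω) = 0 := fun ω hω x =>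
    image_eq_zero_of_notMem_tsupport fun hx => hω ⟨_, hx, rfl⟩
  obtain ⟨θ, hθ, hθc, hθ1, hθn, hθ0⟩ := exists_frequency_cutoff hK hK0
  have hκs : ContDiffOn ℝ (⊤ : ℕ∞) (fun ω => helmholtzCoeff ρ β a i ω + 1) {0}ᶜ := by
    have h1 : ContDiff ℝ (⊤ : ℕ∞) (fun ω : ℝ => (ρ : ℂ) * (ω : ℂ) ^ 2) :=
      contDiff_const.mul (Complex.ofRealCLM.contDiff.pow 2)
    exact (h1.contDiffOn.mul (contDiffOn_const.sub (contDiffOn_const.mul ha.2.1))).add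
      contDiffOn_const
  -- The coefficient is cut off towards `-1`, not `0`, so that it avoids `[0, ∞)`: it is `-1` where
  -- `θ = 0`, and elsewhere its imaginary part is `θ` times a nonzero number.
  set κ : ℝ → ℂ := fun ω => (θ ω : ℂ) * (helmholtzCoeff ρ β a i ω + 1) - 1 with hκ
  have hκt : κ.HasTemperateGrowth :=
    (hasTemperateGrowth_cutoff_mul hθ hθc hθ0 hκs).sub (Function.HasTemperateGrowth.const 1)
  have hκK : ∀ ω ∈ K, κ ω = helmholtzCoeff ρ β a i ω := fun ω hω => by
    simp [hκ, hθ1 ω hω]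
  obtain ⟨d, hd, hdist⟩ := exists_forall_le_norm_sub (f := κ) hκt.1.continuous
    (by
      have : (fun ω => κ ω + 1) = fun ω => (θ ω : ℂ) * (helmholtzCoeff ρ β a i ω + 1) := by
        ext ω
        simp [hκ]
      rw [this]
      exact (hθc.comp_left (g := fun x : ℝ => (x : ℂ)) Complex.ofReal_zero).mul_right)
    (fun ω r hr hωr => by
      by_cases hθω : θ ω = 0
      · have := congrArg Complex.re hωr
        simp [hκ, hθω] at this
        linarith
      · have hω : ω ≠ 0 := fun h => hθω (h ▸ hθ0.self_of_nhds)
        have := congrArg Complex.im hωr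
        simp [hκ, hθω] at this
        exact helmholtzCoeff_im_ne_zero hρ hβ hω (ha.2.2.1 ω hω) this)
  -- The frequency is the parameter, which `exists_helmholtz_solution` expects as first component.
  set e : (ℝ × Space) ≃L[ℝ] SpaceTime := ContinuousLinearEquiv.prodComm ℝ ℝ Space
  obtain ⟨P, hP, hP0⟩ := exists_helmholtz_solution (fun j => (hc i j).le) hκt hd hdist
    (SchwartzMap.compCLMOfContinuousLinearEquiv ℂ e ψ)
  set P' := SchwartzMap.compCLMOfContinuousLinearEquiv ℂ e.symm P with hP'
  have hPK : ∀ ω ∉ K, ∀ x, P' (x, ω) = 0 := fun ω hω x => hP0 ω (fun y => hψK ω hω y) x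
  have hθa := (hasTemperateGrowth_cutoff_mul hθ hθc hθ0 ha.2.1).comp
    (ContinuousLinearMap.snd ℝ Space ℝ).hasTemperateGrowth
  -- `θ a` is a smooth multiplier although `a` may be singular at `0`; it may replace `a` because
  -- `P'` vanishes at frequencies outside `K`, where `θ` need not be `1`.
  refine ⟨P', SchwartzMap.smulLeftCLM ℂ ((fun ω => (θ ω : ℂ) * a ω) ∘
    ContinuousLinearMap.snd ℝ Space ℝ) P', fun x ω => ?_, fun x ω => ?_⟩
  · rw [SchwartzMap.smulLeftCLM_apply_apply hθa, smul_eq_mul]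
    by_cases hω : ω ∈ K
    · simp [hθ1 ω hω]
    · rw [hPK ω hω, mul_zero, mul_zero]
  · by_cases hω : ω ∈ K
    · have h := hP (ω, x)
      rw [modeOp_apply]
      simp only [← fstSlice_lineDeriv, fstSlice_apply]
      rw [← hκK ω hω, hP']
      simp only [SchwartzMap.lineDerivOp_compCLMOfContinuousLinearEquiv]
      exact h
    · have hz : fstSlice ω P' = 0 := by
        ext y
        exact hPK ω hω y
      have hd : ∀ y : Space, ∂_{y} (0 : 𝓢(Space, ℂ)) = 0 := fun y =>
        map_zero (LineDeriv.lineDerivOpCLM ℂ 𝓢(Space, ℂ) y)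
      rw [hz, hψK ω hω, modeOp_apply]
      simp [hd]

/-- The test function is the Helmholtz operator applied to some `P`, and `Â P` is again a Schwartz
function. The equation tested on the transforms of `P` and `Â P` therefore fixes the value of `G`,
and `Φ i` gives the same value. -/
theorem IsApproxGreen.hasTimeFourierOffZero (hγ : 0 < γ) (hρ : 0 < ρ) (hc : IsMediumI c)
    (hcp : ∀ i j, 0 < eigenCoeff c i j) (hβ : ∀ i, β i ≠ 0) (ha : IsLossSymbol γ a)
    {G : MatrixDistribution} (hG : IsApproxGreen (tensorOfVoigt c) β ρ γ G) (i m : Fin 3) :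
    HasTimeFourierOffZero (G i m) (fun x ω => greenHat c ρ β a x ω i m) := by
  have ham : Measurable a := measurable_of_continuousOn_compl_singleton 0 ha.1
  have har := ha.isRegular hγ
  have hφ := polyIntegrable_phi_prod (β := β) (i := i) hρ hcp ham har.2.2.2
  intro ψ Ψ hΨ hψ h0
  obtain ⟨P, Q, hQ, hP⟩ := exists_modeOp_fstSlice_eq hρ hcp (hβ i) har hψ h0
  have hPQ : ∀ x ω, ω ≠ 0 → Q (x, ω) = a ω * P (x, ω) := fun x ω _ => hQ x ω
  obtain ⟨r, hr, hres⟩ := approxResidual_timeFourier (β := β) (ρ := ρ) hc hPQ i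
  have hrψ : r = ψ := by
    ext ⟨x, ω⟩
    rw [hr, hP]
  subst hrψ
  have h1 := hG _ _ (ha.isTransposedLoss_timeFourier hPQ) i m
  rw [hres] at h1
  have h2 := integral_mul_phi hρ hcp ham har.2.2.2 i hr
  rw [isTimeFourierOf_iff.1 hΨ]
  simp only [greenHat_apply, mul_left_comm _ (if i = m then (1 : ℂ) else 0)]
  refine ⟨(hφ.integrable_mul r).const_mul _, ?_⟩
  rw [integral_const_mul, h2, eq_neg_of_add_eq_zero_left h1]
  ring

end Green

end Viscoelastic

end
theorem mainTheorem1
    (c v : Matrix (Fin 6) (Fin 6) ℝ) (ρ γ : ℝ) (β : Fin 3 → ℝ)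
    (hρ : 0 < ρ) (hγ : 0 < γ)
    (hc : Viscoelastic.IsMediumI c) (hv : Viscoelastic.IsMediumI v)
    (hcpos : Viscoelastic.IsPositiveDefinite (Viscoelastic.tensorOfVoigt c))
    (hvpos : Viscoelastic.IsPositiveDefinite (Viscoelastic.tensorOfVoigt v))
    (hβ : ∀ (i : Fin 3) (n : Fin 3 → ℝ),
      Viscoelastic.eigenForm v i n = β i * Viscoelastic.eigenForm c i n) :
    -- the coordinate axes are eigenvectors of both Christoffel tensors
    (∀ (i : Fin 3) (n : Fin 3 → ℝ),
      (Viscoelastic.christoffel (Viscoelastic.tensorOfVoigt c) n).mulVec (Pi.single i 1)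
          = Viscoelastic.eigenForm c i n • (Pi.single i 1 : Fin 3 → ℝ) ∧
      (Viscoelastic.christoffel (Viscoelastic.tensorOfVoigt v) n).mulVec (Pi.single i 1)
          = Viscoelastic.eigenForm v i n • (Pi.single i 1 : Fin 3 → ℝ)) ∧
    -- applying `1 - B 𝒜` to the viscoelastic equation gives the approximate equation, up to the
    -- term `-B² 𝒜² Γᶜ[∇] G`
    (∀ (G : Viscoelastic.MatrixDistribution)
        (ψ χ χ' : 𝓢(Viscoelastic.SpaceTime, ℂ)),
      Viscoelastic.IsTransposedLoss γ ψ χ → Viscoelastic.IsTransposedLoss γ χ χ' →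
      ∀ i m : Fin 3,
        Viscoelastic.viscoelasticResidual (Viscoelastic.tensorOfVoigt c)
              (Viscoelastic.tensorOfVoigt v) ρ G i m ψ χ
            - (β i : ℂ) * Viscoelastic.viscoelasticResidual (Viscoelastic.tensorOfVoigt c)
              (Viscoelastic.tensorOfVoigt v) ρ G i m χ χ'
          = Viscoelastic.approxResidual (Viscoelastic.tensorOfVoigt c) β ρ G i m ψ χ
            - (β i : ℂ) ^ 2 *
              Viscoelastic.christoffelOp (Viscoelastic.tensorOfVoigt c) G i m χ') ∧
    -- the Fourier transform of the kernel of the loss operator is a function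
    (∃ a : ℝ → ℂ, Viscoelastic.IsLossSymbol γ a) ∧
    ∀ a : ℝ → ℂ, Viscoelastic.IsLossSymbol γ a →
      -- the closed form
      (∀ (x : Viscoelastic.Space) (ω : ℝ),
        Viscoelastic.greenHat c ρ β a x ω
          = (1 / (4 * (Real.pi : ℂ) * (ρ : ℂ))) • ∑ i : Fin 3,
              (((Viscoelastic.speed c ρ (Fin.natAdd 3 i) : ℝ) : ℂ) * (1 - (β i : ℂ) * a ω) /
                  (((Viscoelastic.speed c ρ (Fin.castAdd 3 i) * Viscoelastic.speed c ρ 3 *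
                    Viscoelastic.speed c ρ 4 * Viscoelastic.speed c ρ 5 : ℝ) : ℂ) *
                    (Viscoelastic.travelTime c ρ i x : ℂ)) *
                Complex.exp (Complex.I * Viscoelastic.waveNumber β a i ω *
                  (Viscoelastic.travelTime c ρ i x : ℂ))) • Viscoelastic.dyad i) ∧
      -- at every nonzero frequency, `Φ i` is the tempered fundamental solution
      (∀ (i : Fin 3) (ω : ℝ), ω ≠ 0 →
        ∃ T : 𝓢'(Viscoelastic.Space, ℂ),
          (∀ φ : 𝓢(Viscoelastic.Space, ℂ),
            MeasureTheory.Integrable (fun x => φ x * Viscoelastic.phi c ρ β a i x ω) ∧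
              T φ = ∫ x, φ x * Viscoelastic.phi c ρ β a i x ω) ∧
          ∀ S : 𝓢'(Viscoelastic.Space, ℂ),
            Viscoelastic.IsHelmholtzSolution c ρ β a i ω S ↔ S = T) ∧
      -- `Ĝ` is the Fourier transform in time of an approximate Green function
      (∃ G : Viscoelastic.MatrixDistribution,
        Viscoelastic.IsApproxGreen (Viscoelastic.tensorOfVoigt c) β ρ γ G ∧
        ∀ i m : Fin 3, Viscoelastic.HasTimeFourier (G i m)
          (fun x ω => Viscoelastic.greenHat c ρ β a x ω i m)) ∧
      -- and every approximate Green function has this Fourier transform at nonzero frequencies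
      (∀ G : Viscoelastic.MatrixDistribution,
        Viscoelastic.IsApproxGreen (Viscoelastic.tensorOfVoigt c) β ρ γ G →
        ∀ i m : Fin 3, Viscoelastic.HasTimeFourierOffZero (G i m)
          (fun x ω => Viscoelastic.greenHat c ρ β a x ω i m)) := by
  have hcp := hcpos.eigenCoeff_pos
  -- If `β i` were zero, row `i` of the viscosity coefficients would vanish, against positive
  -- definiteness of the viscosity tensor.
  have hβ0 : ∀ i, β i ≠ 0 := fun i h => by
    have h1 := hvpos.eigenCoeff_pos i 0
    rw [Viscoelastic.eigenCoeff_eq_mul hβ, h, zero_mul] at h1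
    exact h1.false
  refine ⟨fun i n => ⟨Viscoelastic.christoffel_mulVec hc i n,
    Viscoelastic.christoffel_mulVec hv i n⟩,
    fun G ψ χ χ' _ _ i m => Viscoelastic.viscoelasticResidual_sub hc hv hβ G ψ χ χ' i m,
    (Viscoelastic.exists_isRegularLossSymbol hγ).imp fun a ha => ha.1, fun a ha =>
      ⟨fun x ω => Viscoelastic.greenHat_eq hρ hcpos.diag_pos β a x ω, fun i ω hω => ?_,
        Viscoelastic.exists_isApproxGreen hγ hρ hc hcp ha,
        fun G hG i m => hG.hasTimeFourierOffZero hγ hρ hc hcp hβ0 ha i m⟩⟩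
  exact Viscoelastic.exists_unique_helmholtz hρ hcp
    (measurable_of_continuousOn_compl_singleton 0 ha.1)
    (Viscoelastic.helmholtzCoeff_im_ne_zero hρ (hβ0 i) hω ((ha.isRegular hγ).2.2.1 ω hω))
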